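/- **Setting.** Let $\rho$ be a probability measure on $\mathbb R$ that is even, has no atom at $0$, has variance one ($\int x^2\,d\rho=1$) and satisfies $\int e^{tx}\,d\rho(x)<\infty$ for all real $t$. For $N\ge 1$ and $0<\beta<\infty$ let ${\bf P}_N$ be the following joint law. The $K_{ij}$ ($1\le i<j\le N$) are i.i.d. with law $\rho$, and $J_{ij}=K_{ij}/\sqrt N$. Given the couplings, the two replicas $\sigma,\tau\in\{-1,+1\}^N$ are independent samples from the Gibbs distribution, i.e. $(\sigma,\tau)$ has conditional probability proportional to $\exp\big[\beta\sum_{i<j}J_{ij}(\sigma_i\sigma_j+\tau_i\tau_j)\big]$. The $U^{\ell}_{ij}$ ($i<j$, $\ell=1,2$) are i.i.d. mean-one exponential variables, independent of all the others. The bond $\{i,j\}$ is FK-occupied in replica $1$ if $J_{ij}\sigma_i\sigma_j\ge 0$ and $U^1_{ij}\le 2\beta|J_{ij}|$, and FK-occupied in replica $2$ if $J_{ij}\tau_i\tau_j\ge 0$ and $U^2_{ij}\le 2\beta|J_{ij}|$. Let $D_k=D_k^{\mathrm{TRFK}}(N,\beta)$ be $N^{-1}$ times the number of sites of the $k$-th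 largest connected component of the graph on $\{1,\dots,N\}$ whose edges are the bonds that are FK-occupied in both replicas ($D_k=0$ if there are fewer than $k$ components), and let $Q=Q(N,\beta)=N^{-1}\sum_{i}\sigma_i\tau_i$. For $c\ge 0$ let $\theta(c)$ be the asymptotic density of the largest cluster of the Erdős–Rényi random graph $G(n,c/n)$, that is, the limit in probability as $n\to\infty$ of $n^{-1}$ times the size of its largest connected component. **Theorem.** The limit defining $\theta(c)$ exists for every $c\ge 0$. For every such $\rho$ and every $\beta\in(0,\infty)$, as $N\to\infty$, $$D_1-\theta\Big(2\beta^2\,\tfrac{1+|Q|}{2}\Big)\tfrac{1+|Q|}{2}\to 0,\qquad D_2-\theta\Big(2\beta^2\,\tfrac{1-|Q|}{2}\Big)\tfrac{1-|Q|}{2}\to 0,\qquad D_3\to 0$$ in probability, i.e. for each of these three sequences the ${\bf P}_N$-probability that its absolute value exceeds $\varepsilon$ tends to $0$ as $N\to\infty$, for every $\varepsilon>0$. -/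

import Mathlib

open MeasureTheory ProbabilityTheory Filter Topology
open scoped ENNReal

namespace SKPercolation

noncomputable section

/-! ### Clusters and convergence in probability -/

/-- The number of vertices of the `k`-th largest connected component (`k ≥ 1`, counted with
multiplicity) of a finite graph: the largest `m` such that at least `k` components have at least
`m` vertices. It is `0` if the graph has fewer than `k` components. -/
def clusterSize {V : Type*} (G : SimpleGraph V) (k : ℕ) : ℕ :=
  sSup {m : ℕ | k ≤ {C : G.ConnectedComponent | m ≤ C.supp.ncard}.ncard}

/-- The density of the `k`-th largest cluster of a graph on `N` vertices. -/
def clusterDensity {N : ℕ} (G : SimpleGraph (Fin N)) (k : ℕ) : ℝ :=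
  (clusterSize G k : ℝ) / N

/-- The random variables `X N`, each on its own probability space, tend to `0` in probability. -/
def TendsToZeroInProbability {Ω : ℕ → Type*} [∀ N, MeasurableSpace (Ω N)]
    (P : ∀ N, Measure (Ω N)) (X : ∀ N, Ω N → ℝ) : Prop :=
  ∀ ε : ℝ, 0 < ε → Tendsto (fun N => P N {ω | ε < |X N ω|}) atTop (𝓝 0)

/-! ### The Erdős–Rényi order parameter -/

/-- The edge probability `c / N`, truncated to the unit interval. -/
def edgeProb (c : ℝ) (N : ℕ) : unitInterval := Set.projIcc 0 1 zero_le_one (c / N)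

/-- `t` is the asymptotic density of the largest cluster of the random graph `G(N, c / N)`: the
density of its largest cluster converges to `t` in probability. -/
def IsGiantDensity (c t : ℝ) : Prop :=
  TendsToZeroInProbability (fun N => SimpleGraph.binomialRandom (Fin N) (edgeProb c N))
    (fun _ G => clusterDensity G 1 - t)

open Classical in
/-- The order parameter `θ(c)` of mean-field percolation: the asymptotic density of the largest
cluster of `G(N, c / N)` (with the value `0` should there be none). -/
def theta (c : ℝ) : ℝ := if h : ∃ t, IsGiantDensity c t then h.choose else 0

/-! ### The Sherrington–Kirkpatrick model with two replicas -/

/-- The assumptions on the law `ρ` of a single coupling variable. -/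
structure IsCouplingLaw (ρ : Measure ℝ) : Prop where
  prob : IsProbabilityMeasure ρ
  even : ρ.map (fun x => -x) = ρ
  no_atom : ρ {0} = 0
  variance : ∫ x, x ^ 2 ∂ρ = 1
  exp_integrable : ∀ t : ℝ, Integrable (fun x => Real.exp (t * x)) ρ

/-- The pairs `i < j` of sites. -/
abbrev Bond (N : ℕ) : Type := {e : Fin N × Fin N // e.1 < e.2}

/-- The couplings `K i j` for `i < j`, before division by `√N`. -/
abbrev Couplings (N : ℕ) : Type := Bond N → ℝ

/-- Spin configurations; `true` encodes the spin `+1` and `false` the spin `-1`. -/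
abbrev Spins (N : ℕ) : Type := Fin N → Bool

/-- The value `±1` of the spin at a site. -/
def spin {N : ℕ} (s : Spins N) (i : Fin N) : ℝ := if s i then 1 else -1

/-- The coupling `J i j = K i j / √N`. -/
def coupling {N : ℕ} (K : Couplings N) (e : Bond N) : ℝ := K e / √N

/-- The unnormalised Gibbs weight `exp (β ∑_{i < j} J i j σ i σ j)` of a single replica. -/
def boltzmann {N : ℕ} (β : ℝ) (K : Couplings N) (s : Spins N) : ℝ :=
  Real.exp (β * ∑ e : Bond N, coupling K e * (spin s e.1.1 * spin s e.1.2))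

/-- The partition function of a single replica. -/
def partitionFunction {N : ℕ} (β : ℝ) (K : Couplings N) : ℝ := ∑ s : Spins N, boltzmann β K s

lemma measurable_boltzmann {N : ℕ} (β : ℝ) (s : Spins N) :
    Measurable fun K : Couplings N => boltzmann β K s := by
  unfold boltzmann coupling
  fun_prop

lemma partitionFunction_pos {N : ℕ} (β : ℝ) (K : Couplings N) : 0 < partitionFunction β K :=
  Finset.sum_pos (fun _ _ => Real.exp_pos _) Finset.univ_nonempty

/-- The Gibbs distribution of one replica given the couplings, as a kernel. -/
def gibbs (N : ℕ) (β : ℝ) : Kernel (Couplings N) (Spins N) where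
  toFun K := ∑ s : Spins N,
    ENNReal.ofReal (boltzmann β K s / partitionFunction β K) • Measure.dirac s
  measurable' := by
    refine Measure.measurable_of_measurable_coe _ fun A _ => ?_
    simp only [Measure.coe_finsetSum, Finset.sum_apply, Measure.smul_apply, smul_eq_mul]
    refine Finset.measurable_fun_sum _ fun s _ => Measurable.mul_const ?_ _
    refine ((measurable_boltzmann β s).div ?_).ennreal_ofReal
    exact Finset.measurable_fun_sum _ fun s _ => measurable_boltzmann β s

instance (N : ℕ) (β : ℝ) : IsMarkovKernel (gibbs N β) where
  isProbabilityMeasure K := by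
    constructor
    have hZ := partitionFunction_pos β K
    change (∑ s : Spins N,
      ENNReal.ofReal (boltzmann β K s / partitionFunction β K) • Measure.dirac s) Set.univ = 1
    simp only [Measure.coe_finsetSum, Finset.sum_apply, Measure.smul_apply, smul_eq_mul,
      measure_univ, mul_one]
    have hs : ∀ s ∈ (Finset.univ : Finset (Spins N)),
        0 ≤ boltzmann β K s / partitionFunction β K :=
      fun s _ => div_nonneg (Real.exp_pos _).le hZ.le
    rw [← ENNReal.ofReal_sum_of_nonneg hs, ← Finset.sum_div]
    change ENNReal.ofReal (partitionFunction β K / partitionFunction β K) = 1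
    rw [div_self hZ.ne', ENNReal.ofReal_one]

/-- Sample points: the couplings and the spins of the two replicas, and the auxiliary
variables `U i j ℓ` of the two replicas `ℓ`. -/
abbrev Sample (N : ℕ) : Type :=
  (Couplings N × (Spins N × Spins N)) × (Bond N × Fin 2 → ℝ)

/-- The law `P_N`: the couplings `K i j` are i.i.d. with law `ρ`; given these, the two replicas are
independent samples from the Gibbs distribution; the `U i j ℓ` are i.i.d. mean one exponential
variables, independent of the couplings and the spins. -/
def law (ρ : Measure ℝ) (β : ℝ) (N : ℕ) : Measure (Sample N) :=
  ((Measure.pi fun _ : Bond N => ρ) ⊗ₘ (gibbs N β ×ₖ gibbs N β)).prod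
    (Measure.pi fun _ : Bond N × Fin 2 => expMeasure 1)

lemma isProbabilityMeasure_law {ρ : Measure ℝ} (hρ : IsCouplingLaw ρ) (β : ℝ) (N : ℕ) :
    IsProbabilityMeasure (law ρ β N) := by
  have := hρ.prob
  have := isProbabilityMeasure_expMeasure one_pos
  unfold law
  infer_instance

/-- The spin configuration of replica `ℓ`. -/
def replica {N : ℕ} (ω : Sample N) (ℓ : Fin 2) : Spins N :=
  if ℓ = 0 then ω.1.2.1 else ω.1.2.2

/-- The bond `e = {i, j}` is FK-occupied in replica `ℓ`: it is satisfied (`J i j σ i σ j` is not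
negative) and `U i j ℓ ≤ 2 β |J i j|`. -/
def FKOccupied {N : ℕ} (β : ℝ) (ω : Sample N) (ℓ : Fin 2) (e : Bond N) : Prop :=
  0 ≤ coupling ω.1.1 e * (spin (replica ω ℓ) e.1.1 * spin (replica ω ℓ) e.1.2) ∧
    ω.2 (e, ℓ) ≤ 2 * β * |coupling ω.1.1 e|

/-- The graph of the bonds that are FK-occupied in both replicas. -/
def trfkGraph {N : ℕ} (β : ℝ) (ω : Sample N) : SimpleGraph (Fin N) :=
  SimpleGraph.fromRel fun i j => ∃ h : i < j, ∀ ℓ : Fin 2, FKOccupied β ω ℓ ⟨(i, j), h⟩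

/-- The overlap `Q` of the two replicas. -/
def overlap {N : ℕ} (ω : Sample N) : ℝ :=
  (N : ℝ)⁻¹ * ∑ i, spin (replica ω 0) i * spin (replica ω 1) i

/-- The density of the `k`-th largest doubly FK-occupied cluster. -/
def trfkDensity {N : ℕ} (β : ℝ) (ω : Sample N) (k : ℕ) : ℝ := clusterDensity (trfkGraph β ω) k

end

end SKPercolation

open SKPercolation

/-!
Given the couplings and the spins `s`, `t` of the two replicas, the bonds are doubly occupied
independently of each other (`law_eq`), and a bond `{i, j}` with `s i * t i ≠ s j * t j` never is,
since it can be satisfied in one replica only. The sites therefore split into the group where the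
replicas agree and the group where they do not, with `N (1 + Q) / 2` and `N (1 - Q) / 2` sites, and
no cluster meets both groups.

Within a group, the doubly occupied bonds form almost a random graph with edge probability
`2 β ^ 2 / N`. Indeed, one coupling is of order `N ^ (-1/2)`, so it affects the Gibbs weights only
by a factor close to `1` (`pairProb_update_le`); as `ρ` is even with variance one, the conditional
probability that a bond is doubly occupied, given the spins and all other bonds, lies between
`lowProb` and `upProb` (`le_integral_occProb`, `integral_occProb_le`), and `N` times these bounds
tends to `2 β ^ 2`. Replacing the bonds of a group by independent ones one after the other
(`le_bexp_of_le_resample`) turns this into a domination from both sides by genuine random graphs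
(`integral_bprob_restrict_le`, `le_integral_bprob_restrict`). The upper bound on the number of sites
in large clusters and the lower bound on the largest cluster concern increasing events, and together
they determine the three largest clusters (`clusterSize_of_two_groups`).

For the random graph `G(n, q)` itself, let `θ` be the survival probability of a branching process
with Poisson offspring distribution of mean `n q`. The proportion of vertices at which a
self-avoiding path of length `m` starts is close to the probability that the branching process
reaches generation `m`, by induction on `m` and the second moment method
(`exists_bexp_abs_pathStarts_le`). Hence at most about `θ n` vertices are in clusters of linear size
(`exists_bprob_largeSet_le`), and at least about `θ n` vertices are in clusters of at least `m + 1`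
vertices. Opening a few more edges joins most of the latter to a single cluster, because the
number of ways to split the clusters of at least `m + 1` vertices into two groups is at most
`exp (n / (m + 1))`, while the probability that no new edge joins two large groups is smaller
(`exists_le_bprob_compSize`). In particular the order parameter `theta` is the survival probability
(`theta_eq_survivalLim`), which is continuous, so that small errors in `n q` do not matter.
-/

namespace SKPercolation

noncomputable section

/-! ### Independent Bernoulli edges -/

section Bernoulli

variable {E : Type*} [Fintype E] [DecidableEq E]

/-- The expectation of `f η` when the states `η e` of the edges `e` are independent and `η e = true`
(the edge `e` is open) has probability `p e`. -/
def bexp (p : E → ℝ) (f : (E → Bool) → ℝ) : ℝ :=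
  ∑ η : E → Bool, (∏ e, if η e then p e else 1 - p e) * f η

open scoped Classical in
/-- The probability of the event `A` under independent open edges. -/
def bprob (p : E → ℝ) (A : (E → Bool) → Prop) : ℝ := bexp p fun η => if A η then 1 else 0

/-- The conditional expectation of `f` given the states of all edges but `e`. -/
def resample (p : E → ℝ) (e : E) (f : (E → Bool) → ℝ) (η : E → Bool) : ℝ :=
  p e * f (Function.update η e true) + (1 - p e) * f (Function.update η e false)

variable {p p' p₁ p₂ : E → ℝ} {f g : (E → Bool) → ℝ}

lemma bexp_add : bexp p (fun η => f η + g η) = bexp p f + bexp p g := by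
  simp only [bexp, mul_add, Finset.sum_add_distrib]

lemma bexp_sub : bexp p (fun η => f η - g η) = bexp p f - bexp p g := by
  simp only [bexp, mul_sub, Finset.sum_sub_distrib]

lemma bexp_const_mul (c : ℝ) : bexp p (fun η => c * f η) = c * bexp p f := by
  simp only [bexp, Finset.mul_sum]
  exact Finset.sum_congr rfl fun η _ => by ring

lemma bexp_sum {ι : Type*} (s : Finset ι) (F : ι → (E → Bool) → ℝ) :
    bexp p (fun η => ∑ i ∈ s, F i η) = ∑ i ∈ s, bexp p (F i) := by
  simp only [bexp, Finset.mul_sum]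
  exact Finset.sum_comm

lemma bexp_mono (hp : ∀ e, p e ∈ Set.Icc (0 : ℝ) 1) (h : ∀ η, f η ≤ g η) :
    bexp p f ≤ bexp p g := by
  refine Finset.sum_le_sum fun η _ => mul_le_mul_of_nonneg_left (h η) ?_
  refine Finset.prod_nonneg fun e _ => ?_
  have := hp e
  split_ifs
  · exact this.1
  · linarith [this.2]

lemma bexp_const (c : ℝ) : bexp p (fun _ => c) = c := by
  have h : ∑ η : E → Bool, ∏ e, (if η e then p e else 1 - p e) = 1 := by
    rw [← Fintype.prod_sum (fun e (b : Bool) => if b then p e else 1 - p e)]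
    simp
  simp only [bexp, ← Finset.sum_mul, h, one_mul]

lemma bexp_nonneg (hp : ∀ e, p e ∈ Set.Icc (0 : ℝ) 1) (h : ∀ η, 0 ≤ f η) : 0 ≤ bexp p f := by
  simpa [bexp_const] using bexp_mono (f := fun _ => 0) hp h

/-- Flipping the state of one edge is an involution, so a sum over all configurations is half the
sum over the two states of that edge. -/
lemma two_mul_sum_config (e : E) (F : (E → Bool) → ℝ) :
    2 * ∑ η, F η =
      ∑ η, (F (Function.update η e true) + F (Function.update η e false)) := by
  have hinv : Function.Involutive fun η : E → Bool => Function.update η e (!η e) := by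
    intro η
    simp
  have h := Equiv.sum_comp hinv.toPerm F
  rw [two_mul]
  nth_rewrite 2 [← h]
  rw [← Finset.sum_add_distrib]
  refine Finset.sum_congr rfl fun η _ => ?_
  change F η + F (Function.update η e (!η e)) = _
  have hη := Function.update_eq_self e η
  cases hb : η e <;> rw [hb] at hη <;> simp only [Bool.not_false, Bool.not_true]
  · conv_lhs => rw [← hη]
    simp [add_comm]
  · conv_lhs => rw [← hη]
    simp

lemma bexp_resample (p : E → ℝ) (e : E) (f : (E → Bool) → ℝ) :
    bexp p (resample p e f) = bexp p f := by
  have key : 2 * bexp p (resample p e f) = 2 * bexp p f := by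
    unfold bexp
    rw [two_mul_sum_config e, two_mul_sum_config e]
    refine Finset.sum_congr rfl fun η _ => ?_
    have hw : ∀ b : Bool, (∏ x, if Function.update η e b x then p x else 1 - p x) =
        (if b then p e else 1 - p e) * ∏ x ∈ Finset.univ.erase e, if η x then p x else 1 - p x := by
      intro b
      rw [← Finset.mul_prod_erase _ _ (Finset.mem_univ e)]
      simp only [Function.update_self]
      congr 1
      refine Finset.prod_congr rfl fun x hx => ?_
      rw [Function.update_of_ne (Finset.ne_of_mem_erase hx)]
    simp only [hw, resample, Function.update_idem]
    simp
    ring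
  linarith

omit [Fintype E] in
lemma resample_mono (hp : ∀ e, p e ∈ Set.Icc (0 : ℝ) 1) (hf : Monotone f) (e : E) :
    Monotone (resample p e f) := by
  intro η η' h
  have := hp e
  have hu : ∀ b, Function.update η e b ≤ Function.update η' e b := fun b =>
    update_le_update_iff.2 ⟨le_rfl, fun j _ => h j⟩
  exact add_le_add (mul_le_mul_of_nonneg_left (hf (hu _)) this.1)
    (mul_le_mul_of_nonneg_left (hf (hu _)) (by linarith [this.2]))

/-- If replacing one edge at a time by an independent one does not decrease the expectation `Φ` of
the functions in a class that is closed under this operation, then `Φ` is at most the expectation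
under independent edges for the functions of this class. -/
theorem le_bexp_of_class {P : ((E → Bool) → ℝ) → Prop} (hP : ∀ e g, P g → P (resample p e g))
    {Φ : ((E → Bool) → ℝ) → ℝ} {m : ℝ} (hconst : ∀ c, Φ (fun _ => c) = m * c)
    (h : ∀ e g, P g → Φ g ≤ Φ (resample p e g)) (hf : P f) :
    Φ f ≤ m * bexp p f := by
  suffices H : ∀ (S : Finset E) (f : (E → Bool) → ℝ), P f →
      (∀ η η', (∀ e ∈ S, η e = η' e) → f η = f η') → Φ f ≤ m * bexp p f from
    H Finset.univ f hf fun η η' h => by rw [funext fun e => h e (Finset.mem_univ e)]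
  intro S
  induction S using Finset.induction_on with
  | empty =>
    intro f _ hdep
    have : f = fun _ => f fun _ => false := funext fun η => hdep _ _ (by simp)
    rw [this, hconst, bexp_const]
  | insert e S he ih =>
    intro f hf hdep
    calc Φ f ≤ Φ (resample p e f) := h e f hf
      _ ≤ m * bexp p (resample p e f) := by
        refine ih _ (hP e f hf) fun η η' hη => ?_
        have : ∀ b, f (Function.update η e b) = f (Function.update η' e b) := by
          intro b
          refine hdep _ _ fun x hx => ?_
          by_cases hxe : x = e
          · subst hxe; simp
          · replace hx := (Finset.mem_insert.1 hx).resolve_left hxe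
            simp [Function.update_of_ne hxe, hη x hx]
        simp only [resample, this]
      _ = m * bexp p f := by rw [bexp_resample]

/-- The version of `le_bexp_of_class` for equalities. -/
theorem eq_bexp_of_class {P : ((E → Bool) → ℝ) → Prop} (hP : ∀ e g, P g → P (resample p e g))
    {Φ : ((E → Bool) → ℝ) → ℝ} {m : ℝ} (hconst : ∀ c, Φ (fun _ => c) = m * c)
    (h : ∀ e g, P g → Φ g = Φ (resample p e g)) (hf : P f) : Φ f = m * bexp p f := by
  refine (le_bexp_of_class hP hconst (fun e g hg => (h e g hg).le) hf).antisymm ?_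
  have := le_bexp_of_class (Φ := fun f => -Φ f) (m := -m) hP
    (fun c => by rw [hconst]; ring) (fun e g hg => (neg_inj.2 (h e g hg)).le) hf
  linarith

/-- **Stochastic domination.** If replacing one edge at a time by an independent one does not
decrease the expectation `Φ` of increasing functions, then `Φ` is dominated by the law of
independent edges. -/
theorem le_bexp_of_le_resample (hp : ∀ e, p e ∈ Set.Icc (0 : ℝ) 1)
    {Φ : ((E → Bool) → ℝ) → ℝ} {m : ℝ} (hconst : ∀ c, Φ (fun _ => c) = m * c)
    (h : ∀ e g, Monotone g → Φ g ≤ Φ (resample p e g)) (hf : Monotone f) :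
    Φ f ≤ m * bexp p f :=
  le_bexp_of_class (fun e _ hg => resample_mono hp hg e) hconst h hf

/-- The version of `le_bexp_of_le_resample` for bounds from below. -/
theorem bexp_le_of_resample_le (hp : ∀ e, p e ∈ Set.Icc (0 : ℝ) 1)
    {Φ : ((E → Bool) → ℝ) → ℝ} {m : ℝ} (hconst : ∀ c, Φ (fun _ => c) = m * c)
    (h : ∀ e g, Monotone g → Φ (resample p e g) ≤ Φ g) (hf : Monotone f) :
    m * bexp p f ≤ Φ f := by
  have := le_bexp_of_le_resample (Φ := fun f => -Φ f) (m := -m) hp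
    (fun c => by rw [hconst]; ring) (fun e g hg => neg_le_neg (h e g hg)) hf
  linarith

/-- The expectation of a function that does not depend on the edge `a` does not depend on the
probability of this edge. -/
lemma bexp_congr_of_update {a : E} (hp : ∀ e, e ≠ a → p e = p' e)
    (hf : ∀ η b, f (Function.update η a b) = f η) : bexp p f = bexp p' f := by
  have h := eq_bexp_of_class (p := p') (Φ := bexp p) (m := 1)
    (P := fun f => ∀ η b, f (Function.update η a b) = f η) ?_ (fun c => by rw [bexp_const, one_mul])
    ?_ hf
  · rw [h, one_mul]
  · intro e g hg η b
    by_cases he : e = a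
    · subst he
      simp [resample]
    · simp only [resample, Function.update_comm (Ne.symm he), hg]
  · intro e g hg
    by_cases he : e = a
    · subst he
      congr 1
      funext η
      simp only [resample, hg]
      ring
    · rw [← bexp_resample p e]
      unfold resample
      rw [hp e he]

/-- An edge that is open if and only if two independent edges are. -/
lemma bexp_and (p : E × Fin 2 → ℝ) (f : (E → Bool) → ℝ) :
    bexp p (fun η => f fun e => η (e, 0) && η (e, 1)) =
      bexp (fun e => p (e, 0) * p (e, 1)) f := by
  have h := eq_bexp_of_class (p := fun e => p (e, 0) * p (e, 1)) (P := fun _ => True) (m := 1)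
    (Φ := fun f => bexp p (fun η => f fun e => η (e, 0) && η (e, 1))) (f := f)
    (fun _ _ _ => trivial) (fun c => by rw [bexp_const, one_mul]) (fun a g _ => ?_) trivial
  · simpa using h
  · have hand : ∀ (η : E × Fin 2 → Bool) (b c : Bool),
        (fun e => Function.update (Function.update η (a, 0) b) (a, 1) c (e, 0) &&
          Function.update (Function.update η (a, 0) b) (a, 1) c (e, 1)) =
        Function.update (fun e => η (e, 0) && η (e, 1)) a (b && c) := by
      intro η b c
      funext e
      by_cases he : e = a
      · subst he
        simp
      · simp [he]
    rw [← bexp_resample p (a, 1), ← bexp_resample p (a, 0)]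
    congr 1
    funext η
    simp only [resample, hand]
    simp
    ring

/-- **Sprinkling.** The union of two independent sets of open edges is dominated by the set of open
edges with a probability at least `p₁ + p₂ - p₁ p₂`. -/
theorem bexp_sup_le (hp₁ : ∀ e, p₁ e ∈ Set.Icc (0 : ℝ) 1) (hp₂ : ∀ e, p₂ e ∈ Set.Icc (0 : ℝ) 1)
    (hp : ∀ e, p e ∈ Set.Icc (0 : ℝ) 1) (h : ∀ e, p₁ e + p₂ e - p₁ e * p₂ e ≤ p e)
    (hf : Monotone f) :
    bexp p₁ (fun η => bexp p₂ fun ξ => f (η ⊔ ξ)) ≤ bexp p f := by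
  have key := le_bexp_of_le_resample
    (Φ := fun f => bexp p₁ fun η => bexp p₂ fun ξ => f (η ⊔ ξ)) (m := 1) hp
    (fun c => by simp [bexp_const]) (fun e g hg => ?_) hf
  · simpa using key
  have hsup : ∀ (η ξ : E → Bool) (b c : Bool),
      Function.update η e b ⊔ Function.update ξ e c = Function.update (η ⊔ ξ) e (b ⊔ c) := by
    intro η ξ b c
    funext x
    by_cases hx : x = e
    · subst hx; simp
    · simp [Function.update_of_ne hx]
  have h2 : ∀ η : E → Bool, bexp p₂ (fun ξ => g (η ⊔ ξ)) =
      bexp p₂ (resample p₂ e fun ξ => g (η ⊔ ξ)) := fun η => (bexp_resample _ _ _).symm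
  calc bexp p₁ (fun η => bexp p₂ fun ξ => g (η ⊔ ξ))
      = bexp p₁ (resample p₁ e fun η => bexp p₂ fun ξ =>
          resample p₂ e (fun ξ => g (η ⊔ ξ)) ξ) := by
        rw [bexp_resample]
        simp only [h2]
    _ ≤ bexp p₁ (fun η => bexp p₂ fun ξ => resample p e g (η ⊔ ξ)) := by
        refine bexp_mono hp₁ fun η => ?_
        unfold resample
        rw [← bexp_const_mul, ← bexp_const_mul, ← bexp_add]
        refine bexp_mono hp₂ fun ξ => ?_
        simp only [hsup]
        have h1 : g (Function.update (η ⊔ ξ) e false) ≤ g (Function.update (η ⊔ ξ) e true) :=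
          hg (update_le_update_iff.2 ⟨Bool.false_le _, fun _ _ => le_rfl⟩)
        simp
        nlinarith [h e]

open scoped Classical in
/-- If a random set `R η` of edges is not affected by the states of the edges that it can
contain, then given `R η` the edges in it are still independent. -/
theorem bprob_closed (p : E → ℝ) (R : (E → Bool) → Finset E)
    (hR : ∀ η η' b, ∀ e ∈ R η', R (Function.update η e b) = R η) :
    bprob p (fun η => ∀ e ∈ R η, η e = false) = bexp p fun η => ∏ e ∈ R η, (1 - p e) := by
  have aux : ∀ (F : Finset E) (f : (E → Bool) → ℝ),
      (∀ η b, ∀ e ∈ F, f (Function.update η e b) = f η) →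
      bexp p (fun η => if ∀ e ∈ F, η e = false then f η else 0) =
        (∏ e ∈ F, (1 - p e)) * bexp p f := by
    intro F
    induction F using Finset.induction_on with
    | empty => intro f _; simp
    | insert a F ha ih =>
      intro f hf
      rw [Finset.prod_insert ha, mul_assoc,
        ← ih f fun η b e he => hf η b e (Finset.mem_insert_of_mem he), ← bexp_const_mul,
        ← bexp_resample p a]
      congr 1
      funext η
      have hF : ∀ b, (∀ e ∈ F, Function.update η a b e = false) ↔ ∀ e ∈ F, η e = false := by
        intro b
        refine forall₂_congr fun e he => ?_
        rw [Function.update_of_ne (by rintro rfl; exact ha he)]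
      simp only [resample, Finset.forall_mem_insert, hF, hf _ _ a (Finset.mem_insert_self a F),
        Function.update_self]
      simp
  have hpart : ∀ (η : E → Bool) (x : Finset E → ℝ),
      x (R η) = ∑ S : Finset E, if R η = S then x S else 0 := by
    intro η x
    simp
  have h1 : ∀ S : Finset E, bexp p (fun η => if R η = S then
      (if ∀ e ∈ S, η e = false then (1 : ℝ) else 0) else 0) =
      bexp p (fun η => if R η = S then ∏ e ∈ S, (1 - p e) else 0) := by
    intro S
    by_cases hS : ∃ η', R η' = S
    · obtain ⟨η', rfl⟩ := hS
      have := aux (R η') (fun η => if R η = R η' then 1 else 0)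
        (fun η b e he => by rw [hR η η' b e he])
      rw [← bexp_const_mul] at this
      convert this using 2
      · funext η; split_ifs <;> simp_all
      · funext η; simp
    · simp only [not_exists] at hS
      simp [hS]
  calc bprob p (fun η => ∀ e ∈ R η, η e = false)
      = bexp p (fun η => ∑ S : Finset E, if R η = S then
          (if ∀ e ∈ S, η e = false then (1 : ℝ) else 0) else 0) := by
        unfold bprob
        congr 1
        funext η
        convert hpart η fun S => if ∀ e ∈ S, η e = false then (1 : ℝ) else 0
    _ = bexp p (fun η => ∑ S : Finset E, if R η = S then ∏ e ∈ S, (1 - p e) else 0) := by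
        rw [bexp_sum, bexp_sum]
        exact Finset.sum_congr rfl fun S _ => h1 S
    _ = bexp p fun η => ∏ e ∈ R η, (1 - p e) := by
        congr 1
        funext η
        exact (hpart η fun S => ∏ e ∈ S, (1 - p e)).symm

/-- **Markov's inequality.** -/
lemma bprob_le_div (hp : ∀ e, p e ∈ Set.Icc (0 : ℝ) 1) {A : (E → Bool) → Prop} {a : ℝ} (ha : 0 < a)
    (hf : ∀ η, 0 ≤ f η) (h : ∀ η, A η → a ≤ f η) : bprob p A ≤ bexp p f / a := by
  rw [le_div_iff₀ ha, mul_comm, bprob, ← bexp_const_mul]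
  refine bexp_mono hp fun η => ?_
  split_ifs with hA
  · simpa using h η hA
  · simpa using hf η

lemma bprob_mono (hp : ∀ e, p e ∈ Set.Icc (0 : ℝ) 1) {A B : (E → Bool) → Prop}
    (h : ∀ η, A η → B η) : bprob p A ≤ bprob p B := by
  refine bexp_mono hp fun η => ?_
  split_ifs with hA hB hB
  · exact le_rfl
  · exact absurd (h η hA) hB
  · exact zero_le_one
  · exact le_rfl

lemma bprob_le_one (hp : ∀ e, p e ∈ Set.Icc (0 : ℝ) 1) (A : (E → Bool) → Prop) :
    bprob p A ≤ 1 := by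
  refine (bexp_mono hp fun η => ?_).trans_eq (bexp_const 1)
  split_ifs <;> simp

lemma bprob_true {A : (E → Bool) → Prop} (h : ∀ η, A η) : bprob p A = 1 := by
  simp [bprob, h, bexp_const]

lemma bprob_not (A : (E → Bool) → Prop) : bprob p (fun η => ¬A η) = 1 - bprob p A := by
  unfold bprob
  rw [← bexp_const (p := p) 1, ← bexp_sub, bexp_const]
  congr 1
  funext η
  by_cases h : A η <;> simp [h]

lemma bprob_or_le (hp : ∀ e, p e ∈ Set.Icc (0 : ℝ) 1) (A B : (E → Bool) → Prop) :
    bprob p (fun η => A η ∨ B η) ≤ bprob p A + bprob p B := by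
  unfold bprob
  rw [← bexp_add]
  refine bexp_mono hp fun η => ?_
  by_cases hA : A η <;> by_cases hB : B η <;> simp [hA, hB]

lemma bprob_exists_le {ι : Type*} (hp : ∀ e, p e ∈ Set.Icc (0 : ℝ) 1) (s : Finset ι)
    (A : ι → (E → Bool) → Prop) :
    bprob p (fun η => ∃ i ∈ s, A i η) ≤ ∑ i ∈ s, bprob p (A i) := by
  unfold bprob
  rw [← bexp_sum]
  refine bexp_mono hp fun η => ?_
  split_ifs with h
  · obtain ⟨i, hi, hA⟩ := h
    refine le_trans ?_ (Finset.single_le_sum (fun j _ => ?_) hi)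
    · simp [hA]
    · positivity
  · exact Finset.sum_nonneg fun j _ => by positivity

omit [Fintype E] [DecidableEq E] in
open scoped Classical in
lemma monotone_ite {A : (E → Bool) → Prop} (hA : ∀ η ξ, η ≤ ξ → A η → A ξ) :
    Monotone fun η => if A η then (1 : ℝ) else 0 := by
  intro η ξ h
  by_cases h1 : A η
  · simp [h1, hA η ξ h h1]
  · by_cases h2 : A ξ <;> simp [h1, h2]

lemma bprob_sup_le (hp₁ : ∀ e, p₁ e ∈ Set.Icc (0 : ℝ) 1) (hp₂ : ∀ e, p₂ e ∈ Set.Icc (0 : ℝ) 1)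
    (hp : ∀ e, p e ∈ Set.Icc (0 : ℝ) 1) (h : ∀ e, p₁ e + p₂ e - p₁ e * p₂ e ≤ p e)
    {A : (E → Bool) → Prop} (hA : ∀ η ξ, η ≤ ξ → A η → A ξ) :
    bexp p₁ (fun η => bprob p₂ fun ξ => A (η ⊔ ξ)) ≤ bprob p A := by
  have := bexp_sup_le hp₁ hp₂ hp h (monotone_ite hA)
  unfold bprob
  exact this

end Bernoulli

/-! ### The survival probability of a Poisson branching process -/

/-- The probability that a branching process with Poisson offspring distribution of mean `c` reaches
generation `m`. -/
def survival (c : ℝ) : ℕ → ℝ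
  | 0 => 1
  | m + 1 => 1 - Real.exp (-(c * survival c m))

/-- The survival probability of a branching process with Poisson offspring distribution of
mean `c`. -/
def survivalLim (c : ℝ) : ℝ := ⨅ m, survival c m

lemma survival_mem {c : ℝ} (hc : 0 ≤ c) (m : ℕ) : survival c m ∈ Set.Icc (0 : ℝ) 1 := by
  induction m with
  | zero => simp [survival]
  | succ m ih =>
    have h1 : Real.exp (-(c * survival c m)) ≤ 1 :=
      Real.exp_le_one_iff.2 (neg_nonpos.2 (mul_nonneg hc ih.1))
    have h2 := Real.exp_pos (-(c * survival c m))
    simp only [survival, Set.mem_Icc]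
    constructor <;> linarith

lemma survival_antitone {c : ℝ} (hc : 0 ≤ c) : Antitone (survival c) := by
  refine antitone_nat_of_succ_le fun m => ?_
  induction m with
  | zero => exact (survival_mem hc 1).2
  | succ m ih =>
    simp only [survival] at ih ⊢
    gcongr

lemma survival_mono {c c' : ℝ} (hc : 0 ≤ c) (h : c ≤ c') (m : ℕ) :
    survival c m ≤ survival c' m := by
  induction m with
  | zero => exact le_rfl
  | succ m ih =>
    simp only [survival]
    have := (survival_mem hc m).1
    have h' := hc.trans h
    gcongr

lemma continuous_survival (m : ℕ) : Continuous fun c => survival c m := by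
  induction m with
  | zero => exact continuous_const
  | succ m ih =>
    simp only [survival]
    fun_prop

lemma survivalLim_le {c : ℝ} (hc : 0 ≤ c) (m : ℕ) : survivalLim c ≤ survival c m :=
  ciInf_le ⟨0, by rintro _ ⟨m, rfl⟩; exact (survival_mem hc m).1⟩ m

lemma survivalLim_mem {c : ℝ} (hc : 0 ≤ c) : survivalLim c ∈ Set.Icc (0 : ℝ) 1 :=
  ⟨le_ciInf fun m => (survival_mem hc m).1, survivalLim_le hc 0⟩

lemma tendsto_survival {c : ℝ} (hc : 0 ≤ c) :
    Tendsto (survival c) atTop (𝓝 (survivalLim c)) :=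
  tendsto_atTop_ciInf (survival_antitone hc)
    ⟨0, by rintro _ ⟨m, rfl⟩; exact (survival_mem hc m).1⟩

lemma survivalLim_mono {c c' : ℝ} (hc : 0 ≤ c) (h : c ≤ c') : survivalLim c ≤ survivalLim c' :=
  le_ciInf fun m => (survivalLim_le hc m).trans (survival_mono hc h m)

lemma survivalLim_eq {c : ℝ} (hc : 0 ≤ c) :
    survivalLim c = 1 - Real.exp (-(c * survivalLim c)) := by
  refine tendsto_nhds_unique ((tendsto_add_atTop_iff_nat 1).2 (tendsto_survival hc)) ?_
  exact tendsto_const_nhds.sub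
    ((Real.continuous_exp.tendsto _).comp ((tendsto_survival hc).const_mul c).neg)

/-- The survival probability is the largest fixed point of `x ↦ 1 - exp (-c x)`, and even the
largest point at which this map is not below the diagonal. -/
lemma le_survivalLim {c x : ℝ} (hc : 0 ≤ c) (hx : x ≤ 1) (h : x ≤ 1 - Real.exp (-(c * x))) :
    x ≤ survivalLim c := by
  refine le_ciInf fun m => ?_
  induction m with
  | zero => exact hx
  | succ m ih =>
    refine h.trans ?_
    simp only [survival]
    gcongr

/-- By strict convexity of the exponential, the map `x ↦ 1 - exp (-c x)` is above the diagonal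
between its fixed points. -/
lemma lt_one_sub_exp {c x y : ℝ} (hy : y = 1 - Real.exp (-(c * y))) (hx : 0 < x) (hxy : x < y) :
    x < 1 - Real.exp (-(c * x)) := by
  have hy0 : 0 < y := hx.trans hxy
  have hc : -(c * y) ≠ 0 := by
    intro h0
    rw [h0] at hy
    simp at hy
    linarith
  have h := strictConvexOn_exp.2 (Set.mem_univ (0 : ℝ)) (Set.mem_univ (-(c * y))) hc.symm
    (show (0 : ℝ) < 1 - x / y by rw [sub_pos, div_lt_one hy0]; exact hxy)
    (show 0 < x / y by positivity) (by ring)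
  have h1 : x / y * (c * y) = c * x := by field_simp
  have h2 : Real.exp (-(c * y)) = 1 - y := by linarith
  have h3 : x / y * y = x := by field_simp
  simp only [smul_eq_mul, mul_zero, zero_add, Real.exp_zero, mul_one, mul_neg, h1, h2] at h
  nlinarith

/-- The limit of a decreasing sequence of continuous functions is upper semicontinuous; lower
semicontinuity comes from the characterization as the largest fixed point. -/
lemma continuousOn_survivalLim : ContinuousOn survivalLim (Set.Ici 0) := by
  intro c hc
  have hc0 : (0 : ℝ) ≤ c := hc
  refine tendsto_order.2 ⟨fun a ha => ?_, fun a ha => ?_⟩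
  · obtain ⟨x, hax, hx⟩ := exists_between ha
    by_cases hx0 : 0 < x
    · have h1 := lt_one_sub_exp (survivalLim_eq hc0) hx0 hx
      have h2 : Continuous fun c : ℝ => 1 - Real.exp (-(c * x)) := by fun_prop
      filter_upwards [mem_nhdsWithin_of_mem_nhds (h2.continuousAt.eventually (lt_mem_nhds h1)),
        self_mem_nhdsWithin] with d hd hd0
      exact hax.trans_le (le_survivalLim hd0 (hx.le.trans (survivalLim_mem hc0).2) hd.le)
    · filter_upwards [self_mem_nhdsWithin] with d hd
      have := (survivalLim_mem (c := d) hd).1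
      linarith
  · obtain ⟨m, hm⟩ := ((tendsto_survival hc0).eventually (gt_mem_nhds ha)).exists
    filter_upwards [mem_nhdsWithin_of_mem_nhds
      ((continuous_survival m).continuousAt.eventually (gt_mem_nhds hm)),
      self_mem_nhdsWithin] with d hd hd0
    exact (survivalLim_le hd0 m).trans_lt hd

/-- By Dini's theorem, the convergence to the survival probability is locally uniform in the mean. -/
lemma exists_survival_le (C : ℝ) {ε : ℝ} (hε : 0 < ε) :
    ∃ m, ∀ c ∈ Set.Icc 0 C, survival c m ≤ survivalLim c + ε := by
  have h := Antitone.tendstoUniformlyOn_of_forall_tendsto (isCompact_Icc (a := (0 : ℝ)) (b := C))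
    (F := fun m c => survival c m) (fun m => (continuous_survival m).continuousOn)
    (fun c hc => survival_antitone hc.1)
    (continuousOn_survivalLim.mono Set.Icc_subset_Ici_self) (fun c hc => tendsto_survival hc.1)
  rw [Metric.tendstoUniformlyOn_iff] at h
  obtain ⟨m, hm⟩ := (h ε hε).exists
  refine ⟨m, fun c hc => ?_⟩
  have := hm c hc
  rw [Real.dist_eq, abs_lt] at this
  linarith

lemma exists_survivalLim_near (C : ℝ) {ε : ℝ} (hε : 0 < ε) :
    ∃ δ > 0, ∀ c ∈ Set.Icc 0 C, ∀ c' ∈ Set.Icc 0 C, |c - c'| < δ →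
      |survivalLim c - survivalLim c'| < ε := by
  have h := (isCompact_Icc (a := (0 : ℝ)) (b := C)).uniformContinuousOn_of_continuous
    (continuousOn_survivalLim.mono Set.Icc_subset_Ici_self)
  rw [Metric.uniformContinuousOn_iff] at h
  exact h ε hε

/-! ### Long paths in the random graph -/

section Paths

variable {V : Type*} [Fintype V] [DecidableEq V]

/-- The edge probabilities of the random graph `G(V, q)`: the diagonal of `Sym2 V` carries no
edges. -/
def er (q : ℝ) (e : Sym2 V) : ℝ := if e.IsDiag then 0 else q

omit [Fintype V] in
lemma er_mem {q : ℝ} (hq : q ∈ Set.Icc (0 : ℝ) 1) (e : Sym2 V) : er q e ∈ Set.Icc (0 : ℝ) 1 := by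
  unfold er
  split_ifs
  · simp
  · exact hq

/-- The end points of the self-avoiding paths of `m` open edges that start at `v` and visit no
vertex of `A` after that. -/
def ends (η : Sym2 V → Bool) : ℕ → Finset V → V → Finset V
  | 0, _, v => {v}
  | m + 1, A, v => (Finset.univ.filter fun u => u ∉ insert v A ∧ η s(v, u) = true).biUnion
      fun u => ends η m (insert v A) u

/-- The vertices outside `A` at which a self-avoiding path of `m` open edges starts that
avoids `A`. -/
def pathStarts (η : Sym2 V → Bool) (m : ℕ) (A : Finset V) : Finset V :=
  Finset.univ.filter fun v => v ∉ A ∧ (ends η m A v).Nonempty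

lemma mem_pathStarts {η : Sym2 V → Bool} {m : ℕ} {A : Finset V} {v : V} :
    v ∈ pathStarts η m A ↔ v ∉ A ∧ (ends η m A v).Nonempty := by
  simp [pathStarts]

lemma ends_succ_nonempty {η : Sym2 V → Bool} {m : ℕ} {A : Finset V} {v : V} :
    (ends η (m + 1) A v).Nonempty ↔ ∃ u ∈ pathStarts η m (insert v A), η s(v, u) = true := by
  simp only [ends, Finset.biUnion_nonempty, Finset.mem_filter, Finset.mem_univ, true_and,
    mem_pathStarts]
  exact ⟨fun ⟨u, ⟨h1, h2⟩, h3⟩ => ⟨u, ⟨h1, h3⟩, h2⟩, fun ⟨u, ⟨h1, h3⟩, h2⟩ => ⟨u, ⟨h1, h2⟩, h3⟩⟩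

/-- Paths that avoid `A` do not depend on the edges with an end point in `A`. -/
lemma ends_update {η : Sym2 V → Bool} {e : Sym2 V} {b : Bool} (m : ℕ) {A : Finset V} {v a : V}
    (ha : a ∈ A) (hae : a ∈ e) (hv : v ∉ A) :
    ends (Function.update η e b) m A v = ends η m A v := by
  induction m generalizing A v with
  | zero => rfl
  | succ m ih =>
    have h1 : ∀ u, u ∉ insert v A → Function.update η e b s(v, u) = η s(v, u) := by
      intro u hu
      refine Function.update_of_ne ?_ _ _
      rintro rfl
      rcases Sym2.mem_iff.1 hae with rfl | rfl
      · exact hv ha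
      · exact hu (Finset.mem_insert_of_mem ha)
    simp only [ends]
    have h2 : (Finset.univ.filter fun u => u ∉ insert v A ∧ Function.update η e b s(v, u) = true) =
        Finset.univ.filter fun u => u ∉ insert v A ∧ η s(v, u) = true :=
      Finset.filter_congr fun u _ => and_congr_right fun hu => by rw [h1 u hu]
    rw [h2]
    refine Finset.biUnion_congr rfl fun u hu => ?_
    exact ih (Finset.mem_insert_of_mem ha) (Finset.mem_filter.1 hu).2.1

lemma pathStarts_update {η : Sym2 V → Bool} {e : Sym2 V} {b : Bool} (m : ℕ) {A : Finset V} {a : V}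
    (ha : a ∈ A) (hae : a ∈ e) :
    pathStarts (Function.update η e b) m A = pathStarts η m A := by
  refine Finset.filter_congr fun v _ => and_congr_right fun hv => ?_
  rw [ends_update m ha hae hv]

lemma ends_anti (η : Sym2 V → Bool) (m : ℕ) {A B : Finset V} (h : A ⊆ B) (v : V) :
    ends η m B v ⊆ ends η m A v := by
  induction m generalizing A B v with
  | zero => exact subset_rfl
  | succ m ih =>
    have h' := Finset.insert_subset_insert v h
    refine (Finset.biUnion_mono fun u _ => ih h' u).trans
      (Finset.biUnion_subset_biUnion_of_subset_left _ fun u hu => ?_)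
    simp only [Finset.mem_filter, Finset.mem_univ, true_and] at hu ⊢
    exact ⟨fun hu' => hu.1 (h' hu'), hu.2⟩

lemma pathStarts_anti (η : Sym2 V → Bool) (m : ℕ) {A B : Finset V} (h : A ⊆ B) :
    pathStarts η m B ⊆ pathStarts η m A := fun v hv => by
  rw [mem_pathStarts] at hv ⊢
  exact ⟨fun hA => hv.1 (h hA), hv.2.mono (ends_anti η m h v)⟩

variable {q : ℝ}

/-- A vertex `v` starts a path of length `m + 1` if and only if one of its edges to the starting
points of paths of length `m` that avoid `v` is open, and those edges are independent of these
starting points. -/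
lemma bexp_notMem_pathStarts (m : ℕ) {A : Finset V} {v : V} (hv : v ∉ A) :
    bexp (er q) (fun η => if v ∈ pathStarts η (m + 1) A then 0 else 1) =
      bexp (er q) fun η => (1 - q) ^ (pathStarts η m (insert v A)).card := by
  classical
  have h := bprob_closed (er q)
    (fun η => (pathStarts η m (insert v A)).image fun w => s(v, w)) (fun η η' b e he => by
      obtain ⟨w, -, rfl⟩ := Finset.mem_image.1 he
      simp only [pathStarts_update m (Finset.mem_insert_self v A) (Sym2.mem_mk_left v w)])
  unfold bprob at h
  convert h using 2
  · funext η
    rw [← ite_not]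
    congr 1
    simp only [mem_pathStarts, hv, not_false_iff, true_and, ends_succ_nonempty, not_exists,
      Finset.forall_mem_image, Bool.not_eq_true, not_and]
  · funext η
    rw [Finset.prod_image fun x _ y _ hxy => Sym2.congr_right.1 hxy]
    rw [← Finset.prod_const]
    refine Finset.prod_congr rfl fun w hw => ?_
    have : v ≠ w := by
      rintro rfl
      exact (mem_pathStarts.1 hw).1 (Finset.mem_insert_self _ _)
    simp [er, this]

/-- Two vertices are treated as in `bexp_notMem_pathStarts`; leaving out the paths that visit both
gives a one-sided bound. -/
lemma bexp_notMem_pathStarts_pair (hq : q ∈ Set.Icc (0 : ℝ) 1) (m : ℕ) {A : Finset V} {v v' : V}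
    (hv : v ∉ A) (hv' : v' ∉ A) (hne : v ≠ v') :
    bexp (er q) (fun η => (if v ∈ pathStarts η (m + 1) A then 0 else 1) *
        (if v' ∈ pathStarts η (m + 1) A then 0 else 1)) ≤
      bexp (er q) fun η => ((1 - q) ^ (pathStarts η m (insert v (insert v' A))).card) ^ 2 := by
  classical
  set B := insert v (insert v' A) with hB
  have h := bprob_closed (er q)
    (fun η => (pathStarts η m B).image (fun w => s(v, w)) ∪
      (pathStarts η m B).image (fun w => s(v', w))) (fun η η' b e he => by
      have hu : pathStarts (Function.update η e b) m B = pathStarts η m B := by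
        rcases Finset.mem_union.1 he with he | he
        · obtain ⟨w, -, rfl⟩ := Finset.mem_image.1 he
          exact pathStarts_update m (a := v) (by simp [hB]) (Sym2.mem_mk_left _ w)
        · obtain ⟨w, -, rfl⟩ := Finset.mem_image.1 he
          exact pathStarts_update m (a := v') (by simp [hB]) (Sym2.mem_mk_left _ w)
      simp only [hu])
  have hprod : ∀ η : Sym2 V → Bool, ∀ x ∈ B,
      ∏ e ∈ (pathStarts η m B).image (fun w => s(x, w)), (1 - er q e) =
        (1 - q) ^ (pathStarts η m B).card := by
    intro η x hx
    rw [Finset.prod_image fun x _ y _ hxy => Sym2.congr_right.1 hxy, ← Finset.prod_const]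
    refine Finset.prod_congr rfl fun w hw => ?_
    have : x ≠ w := by
      rintro rfl
      exact (mem_pathStarts.1 hw).1 hx
    simp [er, this]
  have h2 : (fun η : Sym2 V → Bool => ((1 - q) ^ (pathStarts η m B).card) ^ 2) = fun η =>
      ∏ e ∈ (pathStarts η m B).image (fun w => s(v, w)) ∪
        (pathStarts η m B).image (fun w => s(v', w)), (1 - er q e) := by
    funext η
    rw [Finset.prod_union, hprod η v (by simp [hB]), hprod η v' (by simp [hB]), sq]
    refine Finset.disjoint_left.2 fun e he he' => ?_
    obtain ⟨w, hw, rfl⟩ := Finset.mem_image.1 he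
    obtain ⟨w', hw', he'⟩ := Finset.mem_image.1 he'
    have h1 := (mem_pathStarts.1 hw).1
    simp only [hB, Finset.mem_insert, not_or] at h1
    rcases Sym2.eq_iff.1 he' with ⟨h, -⟩ | ⟨h, -⟩
    · exact hne h.symm
    · exact h1.2.1 h.symm
  rw [h2, ← h, bprob]
  refine bexp_mono (er_mem hq) fun η => ?_
  by_cases h1 : v ∈ pathStarts η (m + 1) A
  · simp only [h1, if_true, zero_mul]
    split_ifs <;> norm_num
  by_cases h1' : v' ∈ pathStarts η (m + 1) A
  · simp only [h1', if_true, mul_zero]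
    split_ifs <;> norm_num
  rw [if_neg h1, if_neg h1', if_pos]
  · norm_num
  have key : ∀ x ∈ ({v, v'} : Finset V), x ∉ A → x ∉ pathStarts η (m + 1) A →
      ∀ w ∈ pathStarts η m B, η s(x, w) = false := by
    intro x hx hxA hxP w hw
    rw [mem_pathStarts, ends_succ_nonempty] at hxP
    simp only [hxA, not_false_iff, true_and, not_exists, not_and, Bool.not_eq_true] at hxP
    refine hxP w (pathStarts_anti η m ?_ hw)
    intro y hy
    simp only [Finset.mem_insert, Finset.mem_singleton, hB] at hx hy ⊢
    rcases hy with rfl | hy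
    · tauto
    · exact Or.inr (Or.inr hy)
  intro e he
  rcases Finset.mem_union.1 he with he | he
  · obtain ⟨w, hw, rfl⟩ := Finset.mem_image.1 he
    exact key v (by simp) hv h1 w hw
  · obtain ⟨w, hw, rfl⟩ := Finset.mem_image.1 he
    exact key v' (by simp) hv' h1' w hw

lemma abs_pow_sub_pow_le_mul {a b : ℝ} (ha : a ∈ Set.Icc (0 : ℝ) 1) (hb : b ∈ Set.Icc (0 : ℝ) 1)
    (X : ℕ) : |a ^ X - b ^ X| ≤ X * |a - b| := by
  induction X with
  | zero => simp
  | succ X ih =>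
    have h : a ^ (X + 1) - b ^ (X + 1) = a * (a ^ X - b ^ X) + (a - b) * b ^ X := by ring
    rw [h]
    refine (abs_add_le _ _).trans ?_
    rw [abs_mul, abs_mul, abs_of_nonneg ha.1, abs_of_nonneg (pow_nonneg hb.1 X)]
    have h1 : b ^ X ≤ 1 := pow_le_one₀ hb.1 hb.2
    have h2 : a * |a ^ X - b ^ X| ≤ 1 * |a ^ X - b ^ X| :=
      mul_le_mul_of_nonneg_right ha.2 (abs_nonneg _)
    have h3 : |a - b| * b ^ X ≤ |a - b| * 1 := mul_le_mul_of_nonneg_left h1 (abs_nonneg _)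
    push_cast
    linarith

lemma abs_exp_neg_sub_exp_neg_le {u v : ℝ} (hu : 0 ≤ u) (hv : 0 ≤ v) :
    |Real.exp (-u) - Real.exp (-v)| ≤ |u - v| := by
  wlog h : u ≤ v generalizing u v
  · rw [abs_sub_comm, abs_sub_comm u v]
    exact this hv hu (le_of_not_ge h)
  have h1 : Real.exp (-v) ≤ Real.exp (-u) := Real.exp_le_exp.2 (by linarith)
  rw [abs_of_nonneg (by linarith), abs_of_nonpos (by linarith)]
  have h2 : Real.exp (-v) = Real.exp (-u) * Real.exp (-(v - u)) := by
    rw [← Real.exp_add]; ring_nf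
  have h3 : Real.exp (-u) ≤ 1 := Real.exp_le_one_iff.2 (by linarith)
  have h4 := Real.add_one_le_exp (-(v - u))
  have h5 := Real.exp_pos (-u)
  nlinarith

/-- The probability that `X` out of `n` possible edges are closed, in the Poisson
approximation. -/
lemma abs_one_sub_pow_sub_exp_le {n X : ℕ} {C t : ℝ} (hn : 0 < n) (hX : X ≤ n)
    (hq : q ∈ Set.Icc (0 : ℝ) 1) (hC : n * q ≤ C) (ht : 0 ≤ t) :
    |(1 - q) ^ X - Real.exp (-(n * q * t))| ≤ C ^ 2 / n + C * |(X : ℝ) / n - t| := by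
  have hn' : (0 : ℝ) < n := by exact_mod_cast hn
  have hX' : (X : ℝ) ≤ n := by exact_mod_cast hX
  have hnq : 0 ≤ n * q := mul_nonneg hn'.le hq.1
  have h1 : |(1 - q) ^ X - Real.exp (-q) ^ X| ≤ X * |1 - q - Real.exp (-q)| :=
    abs_pow_sub_pow_le_mul ⟨by linarith [hq.2], by linarith [hq.1]⟩
      ⟨(Real.exp_pos _).le, Real.exp_le_one_iff.2 (by linarith [hq.1])⟩ X
  have h2 : |1 - q - Real.exp (-q)| ≤ q ^ 2 := by
    have := Real.abs_exp_sub_one_sub_id_le (x := -q) (by rw [abs_neg, abs_of_nonneg hq.1]; exact hq.2)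
    rw [abs_sub_comm, show Real.exp (-q) - (1 - q) = Real.exp (-q) - 1 - -q by ring]
    simpa using this
  have h3 : (X : ℝ) * |1 - q - Real.exp (-q)| ≤ C ^ 2 / n := by
    rw [le_div_iff₀ hn']
    calc (X : ℝ) * |1 - q - Real.exp (-q)| * n ≤ n * q ^ 2 * n := by gcongr
      _ = (n * q) ^ 2 := by ring
      _ ≤ C ^ 2 := by gcongr
  have h4 : Real.exp (-q) ^ X = Real.exp (-(n * q * (X / n))) := by
    rw [← Real.exp_nat_mul]
    congr 1
    field_simp
  have h5 : |Real.exp (-q) ^ X - Real.exp (-(n * q * t))| ≤ C * |(X : ℝ) / n - t| := by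
    rw [h4]
    refine (abs_exp_neg_sub_exp_neg_le (by positivity) (by positivity)).trans ?_
    rw [← mul_sub, abs_mul, abs_of_nonneg hnq]
    gcongr
  calc _ ≤ |(1 - q) ^ X - Real.exp (-q) ^ X| + |Real.exp (-q) ^ X - Real.exp (-(n * q * t))| :=
        abs_sub_le _ _ _
    _ ≤ _ := add_le_add (h1.trans h3) h5

end Paths

section Concentration

variable {V : Type*} [Fintype V] [DecidableEq V] {q : ℝ}

lemma card_pathStarts_add_card (η : Sym2 V → Bool) (m : ℕ) (A : Finset V) :
    ((pathStarts η m A).card : ℝ) + ∑ v ∈ Aᶜ, (if v ∈ pathStarts η m A then (0 : ℝ) else 1) +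
      A.card = Fintype.card V := by
  have h1 : ((pathStarts η m A).card : ℝ) = ∑ v ∈ Aᶜ, if v ∈ pathStarts η m A then (1 : ℝ) else 0 := by
    rw [Finset.sum_boole]
    congr 2
    ext v
    simp [mem_pathStarts]
  rw [h1, ← Finset.sum_add_distrib]
  have h2 : ∀ v ∈ Aᶜ, ((if v ∈ pathStarts η m A then (1 : ℝ) else 0) +
      if v ∈ pathStarts η m A then (0 : ℝ) else 1) = 1 := by
    intro v _
    split_ifs <;> simp
  rw [Finset.sum_congr rfl h2, Finset.sum_const, nsmul_eq_mul, mul_one, ← Nat.cast_add,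
    Finset.card_compl_add_card]

/-- One step of the recursion for the density of the starting points of paths of length `m`: if it
is close to its limit in mean when a few more vertices are forbidden, the second moment of the
next deviation is small. -/
lemma bexp_sq_le (hq : q ∈ Set.Icc (0 : ℝ) 1) {C : ℝ} (hC : Fintype.card V * q ≤ C) (m : ℕ)
    {A : Finset V} {r : ℕ} (hA : A.card ≤ r) {t δ : ℝ} (ht : t ∈ Set.Icc (0 : ℝ) 1)
    (hn : 0 < Fintype.card V)
    (h : ∀ B : Finset V, B.card ≤ r + 2 →
      bexp (er q) (fun η => |((pathStarts η m B).card : ℝ) / Fintype.card V - t|) ≤ δ) :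
    bexp (er q) (fun η => ((∑ v ∈ Aᶜ, if v ∈ pathStarts η (m + 1) A then (0 : ℝ) else 1) /
        Fintype.card V - Real.exp (-(Fintype.card V * q * t))) ^ 2) ≤
      (1 + 2 * r) / Fintype.card V + 4 * (C ^ 2 / Fintype.card V + C * δ) := by
  set n : ℝ := ((Fintype.card V : ℕ) : ℝ) with hndef
  have hn' : 0 < n := by rw [hndef]; exact_mod_cast hn
  have hnq : 0 ≤ n * q := mul_nonneg hn'.le hq.1
  have hC0 : 0 ≤ C := hnq.trans hC
  have hδ : 0 ≤ δ := (bexp_nonneg (er_mem hq) fun η => abs_nonneg _).trans (h ∅ (by simp))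
  set x := Real.exp (-(n * q * t)) with hx
  have hx0 : 0 ≤ x := (Real.exp_pos _).le
  have hx1 : x ≤ 1 := Real.exp_le_one_iff.2 (neg_nonpos.2 (mul_nonneg hnq ht.1))
  set err := C ^ 2 / n + C * δ with herr
  have herr0 : 0 ≤ err := by positivity
  have hcard : ∀ (η : Sym2 V → Bool) (B : Finset V),
      |(1 - q) ^ (pathStarts η m B).card - x| ≤
        C ^ 2 / n + C * |((pathStarts η m B).card : ℝ) / n - t| := fun η B =>
    abs_one_sub_pow_sub_exp_le hn (Finset.card_le_univ _) hq hC ht.1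
  have hmean : ∀ B : Finset V, B.card ≤ r + 2 →
      bexp (er q) (fun η => C ^ 2 / n + C * |((pathStarts η m B).card : ℝ) / n - t|) ≤ err := by
    intro B hB
    rw [bexp_add, bexp_const, bexp_const_mul]
    have := mul_le_mul_of_nonneg_left (h B hB) hC0
    linarith
  have hpow : ∀ k : ℕ, (1 - q) ^ k ∈ Set.Icc (0 : ℝ) 1 := fun k =>
    ⟨pow_nonneg (by linarith [hq.2]) _, pow_le_one₀ (by linarith [hq.2]) (by linarith [hq.1])⟩
  set I : V → (Sym2 V → Bool) → ℝ := fun v η => if v ∈ pathStarts η (m + 1) A then 0 else 1 with hI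
  have hI01 : ∀ v η, I v η ∈ Set.Icc (0 : ℝ) 1 := by
    intro v η
    simp only [hI]
    split_ifs <;> simp
  -- the first moment
  have h1 : ∀ v ∈ Aᶜ, x - err ≤ bexp (er q) (I v) := by
    intro v hv
    rw [Finset.mem_compl] at hv
    have hB : (insert v A).card ≤ r + 2 := (Finset.card_insert_le _ _).trans (by omega)
    rw [hI, bexp_notMem_pathStarts m hv]
    have := bexp_mono (er_mem hq) (fun η : Sym2 V → Bool =>
      (abs_le.1 (hcard η (insert v A))).1)
    simp only [bexp_sub, bexp_const] at this
    have h3 := hmean _ hB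
    have h4 : bexp (er q) (fun η : Sym2 V → Bool =>
        -(C ^ 2 / n + C * |((pathStarts η m (insert v A)).card : ℝ) / n - t|)) =
        - bexp (er q) (fun η : Sym2 V → Bool =>
          (C ^ 2 / n + C * |((pathStarts η m (insert v A)).card : ℝ) / n - t|)) := by
      rw [← neg_one_mul, ← bexp_const_mul]
      simp only [neg_one_mul]
    linarith
  -- the second moment
  have h2 : ∀ v ∈ Aᶜ, ∀ v' ∈ Aᶜ, bexp (er q) (fun η => I v η * I v' η) ≤
      (if v = v' then 1 else 0) + (x ^ 2 + 2 * err) := by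
    intro v hv v' hv'
    rw [Finset.mem_compl] at hv hv'
    split_ifs with hvv
    · have : bexp (er q) (fun η => I v η * I v' η) ≤ bexp (er q) fun _ => 1 :=
        bexp_mono (er_mem hq) fun η => mul_le_one₀ (hI01 v η).2 (hI01 v' η).1 (hI01 v' η).2
      rw [bexp_const] at this
      nlinarith
    · have hB : (insert v (insert v' A)).card ≤ r + 2 :=
        (Finset.card_insert_le _ _).trans (by have := Finset.card_insert_le v' A; omega)
      refine (bexp_notMem_pathStarts_pair hq m hv hv' hvv).trans ?_
      have h3 : ∀ η : Sym2 V → Bool,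
          ((1 - q) ^ (pathStarts η m (insert v (insert v' A))).card) ^ 2 ≤ x ^ 2 + 2 *
            (C ^ 2 / n + C * |((pathStarts η m (insert v (insert v' A))).card : ℝ) / n - t|) := by
        intro η
        have h4 := (abs_le.1 (hcard η (insert v (insert v' A)))).2
        have h5 := (abs_nonneg _).trans (hcard η (insert v (insert v' A)))
        have h6 := hpow (pathStarts η m (insert v (insert v' A))).card
        nlinarith [h6.1, h6.2]
      refine (bexp_mono (er_mem hq) h3).trans ?_
      rw [bexp_add, bexp_const, bexp_const_mul]
      linarith [hmean _ hB]
  have hAc : (Aᶜ.card : ℝ) + A.card = n := by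
    rw [← Nat.cast_add, Finset.card_compl_add_card]
  have hAr : (A.card : ℝ) ≤ r := by exact_mod_cast hA
  have hA0 : (0 : ℝ) ≤ A.card := Nat.cast_nonneg _
  have hAc0 : (0 : ℝ) ≤ Aᶜ.card := Nat.cast_nonneg _
  have hE1 : n * (x - err) - r ≤ bexp (er q) (fun η => ∑ v ∈ Aᶜ, I v η) := by
    rw [bexp_sum]
    refine le_trans ?_ (Finset.sum_le_sum h1)
    rw [Finset.sum_const, nsmul_eq_mul]
    nlinarith
  have hE2 : bexp (er q) (fun η => (∑ v ∈ Aᶜ, I v η) ^ 2) ≤ n + n ^ 2 * (x ^ 2 + 2 * err) := by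
    have : (fun η => (∑ v ∈ Aᶜ, I v η) ^ 2) = fun η => ∑ v ∈ Aᶜ, ∑ v' ∈ Aᶜ, I v η * I v' η := by
      funext η
      rw [sq, Finset.sum_mul_sum]
    rw [this, bexp_sum]
    simp only [bexp_sum]
    refine (Finset.sum_le_sum fun v hv => Finset.sum_le_sum fun v' hv' => h2 v hv v' hv').trans ?_
    simp only [Finset.sum_add_distrib, Finset.sum_ite_eq, Finset.sum_const, nsmul_eq_mul]
    have h3 : ∑ v ∈ Aᶜ, (if v ∈ Aᶜ then (1 : ℝ) else 0) = Aᶜ.card := by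
      rw [Finset.sum_congr rfl fun v hv => if_pos hv]
      simp
    rw [h3]
    have h4 : (Aᶜ.card : ℝ) ≤ n := by linarith
    have h5 : 0 ≤ x ^ 2 + 2 * err := by positivity
    have h6 : (Aᶜ.card : ℝ) * (Aᶜ.card * (x ^ 2 + 2 * err)) ≤ n * (n * (x ^ 2 + 2 * err)) := by
      gcongr
    linarith [h6, h4, sq n]
  have hexp : (fun η => ((∑ v ∈ Aᶜ, I v η) / n - x) ^ 2) = fun η =>
      (1 / n ^ 2 * (∑ v ∈ Aᶜ, I v η) ^ 2 - 2 * x / n * (∑ v ∈ Aᶜ, I v η)) + x ^ 2 := by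
    funext η
    ring
  change bexp (er q) (fun η => ((∑ v ∈ Aᶜ, I v η) / n - x) ^ 2) ≤ _
  rw [hexp, bexp_add, bexp_sub, bexp_const_mul, bexp_const_mul, bexp_const]
  have h7 : 1 / n ^ 2 * bexp (er q) (fun η => (∑ v ∈ Aᶜ, I v η) ^ 2) ≤
      1 / n + (x ^ 2 + 2 * err) := by
    calc _ ≤ 1 / n ^ 2 * (n + n ^ 2 * (x ^ 2 + 2 * err)) := by gcongr
      _ = _ := by field_simp
  have h8 : 2 * x * (x - err) - 2 * x * r / n ≤
      2 * x / n * bexp (er q) (fun η => ∑ v ∈ Aᶜ, I v η) := by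
    calc _ = 2 * x / n * (n * (x - err) - r) := by field_simp
      _ ≤ _ := by gcongr
  have h9 : 2 * x * r / n ≤ 2 * r / n := by
    gcongr
    nlinarith [(Nat.cast_nonneg r : (0 : ℝ) ≤ r)]
  have h10 : x * err ≤ 1 * err := by gcongr
  have h11 : (1 + 2 * (r : ℝ)) / n = 1 / n + 2 * r / n := by ring
  rw [h11]
  nlinarith

end Concentration

/-- **Law of large numbers for long paths.** The proportion of vertices of `G(n, q)` at which a
self-avoiding path of length `m` starts is close to the probability that a branching process with
Poisson offspring distribution of mean `n q` reaches generation `m`. This is uniform as long as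
`n q` is bounded, and not affected by forbidding a bounded number of vertices. -/
theorem exists_bexp_abs_pathStarts_le (m : ℕ) : ∀ (C : ℝ) (r : ℕ) (ε : ℝ), 0 < ε → ∃ n₀ : ℕ,
    ∀ (V : Type) [Fintype V] [DecidableEq V] (q : ℝ) (A : Finset V), n₀ ≤ Fintype.card V →
      q ∈ Set.Icc (0 : ℝ) 1 → Fintype.card V * q ≤ C → A.card ≤ r →
      bexp (er q) (fun η => |((pathStarts η m A).card : ℝ) / Fintype.card V -
        survival (Fintype.card V * q) m|) ≤ ε := by
  induction m with
  | zero =>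
    intro C r ε hε
    obtain ⟨n₀, hn₀⟩ := exists_nat_gt (r / ε)
    refine ⟨n₀ + 1, fun V _ _ q A hn hq hC hA => ?_⟩
    have hn1 : ((n₀ + 1 : ℕ) : ℝ) ≤ Fintype.card V := by exact_mod_cast hn
    push_cast at hn1
    have hn' : (0 : ℝ) < Fintype.card V := lt_of_lt_of_le (by positivity) hn1
    have hAr : (A.card : ℝ) ≤ r := by exact_mod_cast hA
    refine (bexp_mono (g := fun _ => ε) (er_mem hq) fun η => ?_).trans_eq (bexp_const _)
    have h := card_pathStarts_add_card η 0 A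
    have h0 : ∑ v ∈ Aᶜ, (if v ∈ pathStarts η 0 A then (0 : ℝ) else 1) = 0 := by
      refine Finset.sum_eq_zero fun v hv => if_pos ?_
      rw [mem_pathStarts]
      exact ⟨Finset.mem_compl.1 hv, by simp [ends]⟩
    rw [h0] at h
    have h2 : ((pathStarts η 0 A).card : ℝ) / Fintype.card V - survival (Fintype.card V * q) 0 =
        -(A.card / Fintype.card V) := by
      simp only [survival]
      field_simp
      linarith
    rw [h2, abs_neg, abs_of_nonneg (by positivity), div_le_iff₀ hn']
    rw [div_lt_iff₀ hε] at hn₀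
    nlinarith
  | succ m ih =>
    intro C r ε hε
    by_cases hC0 : 0 ≤ C
    swap
    · refine ⟨0, fun V _ _ q A hn hq hC hA => absurd hC ?_⟩
      have : 0 ≤ (Fintype.card V : ℝ) * q := mul_nonneg (Nat.cast_nonneg _) hq.1
      linarith
    set δ := ε ^ 2 / (128 * (C + 1)) with hδ
    have hδ0 : 0 < δ := by positivity
    obtain ⟨n₁, hn₁⟩ := ih C (r + 2) δ hδ0
    obtain ⟨n₂, hn₂⟩ := exists_nat_gt ((1 + 2 * r + 4 * C ^ 2) / (ε ^ 2 / 32))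
    obtain ⟨n₃, hn₃⟩ := exists_nat_gt (r / (ε / 2))
    refine ⟨n₁ + n₂ + n₃ + 1, fun V _ _ q A hn hq hC hA => ?_⟩
    have hn' : 0 < Fintype.card V := by omega
    set n : ℝ := ((Fintype.card V : ℕ) : ℝ) with hndef
    have hn0 : 0 < n := by rw [hndef]; exact_mod_cast hn'
    have hn2 : (n₂ : ℝ) ≤ n := by rw [hndef]; exact_mod_cast (by omega : n₂ ≤ Fintype.card V)
    have hn3 : (n₃ : ℝ) ≤ n := by rw [hndef]; exact_mod_cast (by omega : n₃ ≤ Fintype.card V)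
    have hnq : 0 ≤ n * q := mul_nonneg hn0.le hq.1
    have hsq := bexp_sq_le hq hC m hA (survival_mem hnq m) hn'
      fun B hB => hn₁ V q B (by omega) hq hC hB
    rw [← hndef] at hsq
    have hb : (1 + 2 * r) / n + 4 * (C ^ 2 / n + C * δ) ≤ ε ^ 2 / 16 := by
      have h1 : (1 + 2 * r + 4 * C ^ 2) / n ≤ ε ^ 2 / 32 := by
        rw [div_le_iff₀ hn0]
        rw [div_lt_iff₀ (by positivity)] at hn₂
        have : (0 : ℝ) < ε ^ 2 / 32 := by positivity
        nlinarith
      have h2 : C * δ ≤ ε ^ 2 / 128 := by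
        rw [hδ, mul_div_assoc', div_le_div_iff₀ (by positivity) (by norm_num)]
        nlinarith [sq_nonneg ε]
      have h3 : (1 + 2 * r + 4 * C ^ 2) / n = (1 + 2 * r) / n + 4 * (C ^ 2 / n) := by ring
      linarith
    have hAr : (A.card : ℝ) ≤ r := by exact_mod_cast hA
    have hAn : (A.card : ℝ) / n ≤ ε / 2 := by
      rw [div_le_iff₀ hn0]
      rw [div_lt_iff₀ (by positivity)] at hn₃
      nlinarith
    -- `|z| ≤ z ^ 2 / a + a / 4` with `a = ε / 2` turns the second moment into a first moment
    refine (bexp_mono (er_mem hq) (g := fun η => 2 / ε *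
      ((∑ v ∈ Aᶜ, if v ∈ pathStarts η (m + 1) A then (0 : ℝ) else 1) / n -
        Real.exp (-(n * q * survival (n * q) m))) ^ 2 + (ε / 8 + ε / 2)) fun η => ?_).trans ?_
    · have h := card_pathStarts_add_card η (m + 1) A
      set Y := ∑ v ∈ Aᶜ, if v ∈ pathStarts η (m + 1) A then (0 : ℝ) else 1
      set x := Real.exp (-(n * q * survival (n * q) m)) with hx
      have h2 : ((pathStarts η (m + 1) A).card : ℝ) / n - survival (n * q) (m + 1) =
          -(Y / n - x) - A.card / n := by
        simp only [survival, ← hx]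
        field_simp
        linarith
      rw [h2]
      have h3 : |-(Y / n - x) - A.card / n| ≤ |Y / n - x| + A.card / n := by
        refine (abs_sub _ _).trans ?_
        rw [abs_neg, abs_of_nonneg (by positivity : 0 ≤ (A.card : ℝ) / n)]
      have h4 : |Y / n - x| ≤ 2 / ε * (Y / n - x) ^ 2 + ε / 8 := by
        rw [← sq_abs (Y / n - x)]
        have : 0 ≤ 2 / ε * (|Y / n - x| - ε / 4) ^ 2 := by positivity
        have h5 : 2 / ε * (|Y / n - x| - ε / 4) ^ 2 =
            2 / ε * |Y / n - x| ^ 2 + ε / 8 - |Y / n - x| := by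
          field_simp
          ring
        linarith
      linarith
    · rw [bexp_add, bexp_const_mul, bexp_const]
      have h6 := mul_le_mul_of_nonneg_left (hsq.trans hb) (by positivity : 0 ≤ 2 / ε)
      have h7 : 2 / ε * (ε ^ 2 / 16) = ε / 8 := by
        field_simp
        norm_num
      linarith

/-! ### Cluster sizes and paths -/

/-- The number of vertices of the connected component of `v`. -/
def compSize {V : Type*} (G : SimpleGraph V) (v : V) : ℕ := (G.connectedComponentMk v).supp.ncard

/-- The graph of the open edges. -/
def openGraph {V : Type*} (η : Sym2 V → Bool) : SimpleGraph V :=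
  SimpleGraph.fromEdgeSet {e | η e = true}

lemma openGraph_adj {V : Type*} {η : Sym2 V → Bool} {v w : V} :
    (openGraph η).Adj v w ↔ η s(v, w) = true ∧ v ≠ w := by
  simp [openGraph]

lemma openGraph_mono {V : Type*} {η ξ : Sym2 V → Bool} (h : η ≤ ξ) : openGraph η ≤ openGraph ξ := by
  intro v w hvw
  rw [openGraph_adj] at hvw ⊢
  exact ⟨Bool.eq_true_of_true_le (hvw.1 ▸ h s(v, w)), hvw.2⟩

section CompSize

variable {V : Type*} [Finite V]

omit [Finite V] in
lemma mem_supp_mk {G : SimpleGraph V} {v w : V} :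
    w ∈ (G.connectedComponentMk v).supp ↔ G.Reachable v w := by
  rw [SimpleGraph.ConnectedComponent.mem_supp_iff, SimpleGraph.ConnectedComponent.eq,
    SimpleGraph.reachable_comm]

lemma compSize_mono {G H : SimpleGraph V} (h : G ≤ H) (v : V) : compSize G v ≤ compSize H v := by
  refine Set.ncard_le_ncard (fun w hw => ?_) (Set.toFinite _)
  rw [mem_supp_mk] at hw ⊢
  exact hw.mono h

omit [Finite V] in
lemma compSize_eq_of_reachable {G : SimpleGraph V} {v w : V} (h : G.Reachable v w) :
    compSize G v = compSize G w := by
  unfold compSize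
  rw [SimpleGraph.ConnectedComponent.sound h]

lemma card_le_compSize {G : SimpleGraph V} {v : V} {S : Finset V}
    (h : ∀ w ∈ S, G.Reachable v w) : S.card ≤ compSize G v := by
  rw [← Set.ncard_coe_finset]
  refine Set.ncard_le_ncard (fun w hw => ?_) (Set.toFinite _)
  rw [mem_supp_mk]
  exact h w hw

lemma compSize_le_card {G : SimpleGraph V} {v : V} {S : Finset V}
    (h : ∀ w, G.Reachable v w → w ∈ S) : compSize G v ≤ S.card := by
  rw [← Set.ncard_coe_finset]
  refine Set.ncard_le_ncard (fun w hw => ?_) (Set.toFinite _)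
  rw [mem_supp_mk] at hw
  exact h w hw

end CompSize

section Paths

variable {V : Type*} [Fintype V] [DecidableEq V] {q : ℝ}

lemma mem_ends_of_isPath {η : Sym2 V → Bool} {v w : V} (p : (openGraph η).Walk v w)
    (hp : p.IsPath) : ∀ A : Finset V, (∀ x ∈ p.support, x ∉ A) → w ∈ ends η p.length A v := by
  induction p with
  | nil => intro A _; simp [ends]
  | @cons v u w h p ih =>
    intro A hA
    rw [SimpleGraph.Walk.cons_isPath_iff] at hp
    have hA' : ∀ x ∈ p.support, x ∉ insert v A := by
      intro x hx hxA
      rcases Finset.mem_insert.1 hxA with rfl | hxA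
      · exact hp.2 hx
      · exact hA x (by simp [hx]) hxA
    simp only [SimpleGraph.Walk.length_cons, ends, Finset.mem_biUnion, Finset.mem_filter,
      Finset.mem_univ, true_and]
    exact ⟨u, ⟨hA' u p.start_mem_support, (openGraph_adj.1 h).1⟩, ih hp.1 _ hA'⟩

lemma ends_nonempty_of_succ {η : Sym2 V → Bool} {m : ℕ} {A : Finset V} {v : V}
    (h : (ends η (m + 1) A v).Nonempty) : (ends η m A v).Nonempty := by
  induction m generalizing A v with
  | zero => simp [ends]
  | succ m ih =>
    obtain ⟨u, hu, hvu⟩ := ends_succ_nonempty.1 h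
    rw [mem_pathStarts] at hu
    exact ends_succ_nonempty.2 ⟨u, mem_pathStarts.2 ⟨hu.1, ih hu.2⟩, hvu⟩

lemma ends_nonempty_of_le {η : Sym2 V → Bool} {m l : ℕ} (hml : m ≤ l) {A : Finset V} {v : V}
    (h : (ends η l A v).Nonempty) : (ends η m A v).Nonempty := by
  induction l, hml using Nat.le_induction with
  | base => exact h
  | succ l _ ih => exact ih (ends_nonempty_of_succ h)

/-- If no path of length `m` starts at `v`, its cluster is exhausted by the shorter paths. -/
lemma compSize_le_sum_card_ends {η : Sym2 V → Bool} {m : ℕ} {v : V}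
    (h : ¬(ends η m ∅ v).Nonempty) :
    compSize (openGraph η) v ≤ ∑ i ∈ Finset.range m, (ends η i ∅ v).card := by
  refine (compSize_le_card (S := (Finset.range m).biUnion fun i => ends η i ∅ v)
    fun w hw => ?_).trans Finset.card_biUnion_le
  obtain ⟨p, hp⟩ := hw.exists_isPath
  have hmem := mem_ends_of_isPath p hp ∅ (by simp)
  rw [Finset.mem_biUnion]
  refine ⟨p.length, ?_, hmem⟩
  rw [Finset.mem_range]
  by_contra! hlen
  exact h (ends_nonempty_of_le hlen ⟨w, hmem⟩)

lemma succ_le_compSize {η : Sym2 V → Bool} {m : ℕ} {v : V} (h : (ends η m ∅ v).Nonempty) :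
    m + 1 ≤ compSize (openGraph η) v := by
  suffices H : ∀ (A : Finset V) (v : V), v ∉ A → (ends η m A v).Nonempty → ∃ S : Finset V,
      S.card = m + 1 ∧ (∀ x ∈ S, x ∉ A) ∧ ∀ x ∈ S, (openGraph η).Reachable v x by
    obtain ⟨S, hS, -, hr⟩ := H ∅ v (by simp) h
    rw [← hS]
    exact card_le_compSize hr
  clear h v
  induction m with
  | zero =>
    intro A v hv _
    exact ⟨{v}, by simp, by simpa using hv, by simp⟩
  | succ m ih =>
    intro A v hv h
    obtain ⟨u, hu, hvu⟩ := ends_succ_nonempty.1 h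
    rw [mem_pathStarts] at hu
    obtain ⟨S, hS, hSA, hr⟩ := ih (insert v A) u hu.1 hu.2
    have hvS : v ∉ S := fun hvS => hSA v hvS (Finset.mem_insert_self _ _)
    refine ⟨insert v S, by rw [Finset.card_insert_of_notMem hvS, hS], ?_, ?_⟩
    · intro x hx
      rcases Finset.mem_insert.1 hx with rfl | hx
      · exact hv
      · exact fun hxA => hSA x hx (Finset.mem_insert_of_mem hxA)
    · intro x hx
      rcases Finset.mem_insert.1 hx with rfl | hx
      · exact SimpleGraph.Reachable.refl _
      · have hne : v ≠ u := by
          rintro rfl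
          exact hu.1 (Finset.mem_insert_self _ _)
        exact (SimpleGraph.Adj.reachable (openGraph_adj.2 ⟨hvu, hne⟩)).trans (hr x hx)

lemma bexp_ite_open {E : Type*} [Fintype E] [DecidableEq E] (p : E → ℝ) (e : E)
    {f : (E → Bool) → ℝ} (hf : ∀ η b, f (Function.update η e b) = f η) :
    bexp p (fun η => if η e then f η else 0) = p e * bexp p f := by
  rw [← bexp_resample p e, ← bexp_const_mul]
  congr 1
  funext η
  simp [resample, hf]

/-- The mean number of paths of length `m` from a given vertex is at most `C ^ m`, by induction on
the first edge. -/
lemma bexp_card_ends_le (hq : q ∈ Set.Icc (0 : ℝ) 1) {C : ℝ} (hC : Fintype.card V * q ≤ C) (m : ℕ)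
    {A : Finset V} {v : V} (hv : v ∉ A) :
    bexp (er q) (fun η => ((ends η m A v).card : ℝ)) ≤ C ^ m := by
  have hC0 : 0 ≤ C := (mul_nonneg (Nat.cast_nonneg _) hq.1).trans hC
  induction m generalizing A v with
  | zero => simp [ends, bexp_const]
  | succ m ih =>
    have h1 : ∀ η : Sym2 V → Bool, ((ends η (m + 1) A v).card : ℝ) ≤
        ∑ u ∈ (insert v A)ᶜ, if η s(v, u) then ((ends η m (insert v A) u).card : ℝ) else 0 := by
      intro η
      refine (Nat.cast_le.2 Finset.card_biUnion_le).trans ?_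
      rw [← Finset.sum_filter]
      push_cast
      refine le_of_eq (Finset.sum_congr ?_ fun _ _ => rfl)
      ext u
      simp
    refine (bexp_mono (er_mem hq) h1).trans ?_
    rw [bexp_sum]
    have h2 : ∀ u ∈ (insert v A)ᶜ, bexp (er q) (fun η : Sym2 V → Bool =>
        if η s(v, u) then ((ends η m (insert v A) u).card : ℝ) else 0) ≤ q * C ^ m := by
      intro u hu
      rw [Finset.mem_compl] at hu
      rw [bexp_ite_open (er q) s(v, u) fun η b => by
        rw [ends_update m (Finset.mem_insert_self v A) (Sym2.mem_mk_left v u) hu]]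
      have hne : v ≠ u := by
        rintro rfl
        exact hu (Finset.mem_insert_self _ _)
      simp only [er, Sym2.mk_isDiag_iff, hne, if_false]
      exact mul_le_mul_of_nonneg_left (ih hu) hq.1
    refine (Finset.sum_le_sum h2).trans ?_
    rw [Finset.sum_const, nsmul_eq_mul]
    have h3 : (((insert v A)ᶜ : Finset V).card : ℝ) ≤ Fintype.card V := by
      exact_mod_cast Finset.card_le_univ _
    calc _ ≤ Fintype.card V * (q * C ^ m) :=
          mul_le_mul_of_nonneg_right h3 (mul_nonneg hq.1 (pow_nonneg hC0 m))
      _ = Fintype.card V * q * C ^ m := by ring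
      _ ≤ C * C ^ m := mul_le_mul_of_nonneg_right hC (pow_nonneg hC0 m)
      _ = C ^ (m + 1) := by ring

end Paths

/-- The vertices whose clusters have at least `x` vertices. -/
def largeSet {V : Type*} [Fintype V] (G : SimpleGraph V) (x : ℝ) : Finset V :=
  Finset.univ.filter fun v => x ≤ compSize G v

lemma mem_largeSet {V : Type*} [Fintype V] {G : SimpleGraph V} {x : ℝ} {v : V} :
    v ∈ largeSet G x ↔ x ≤ compSize G v := by
  simp [largeSet]

lemma largeSet_mono {V : Type*} [Fintype V] {G H : SimpleGraph V} (h : G ≤ H) (x : ℝ) :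
    largeSet G x ⊆ largeSet H x := fun v hv => by
  rw [mem_largeSet] at hv ⊢
  exact hv.trans (Nat.cast_le.2 (compSize_mono h v))

/-- **Upper bound for the large clusters.** With high probability, at most `(θ + ε) n` vertices of
`G(n, q)` are in clusters of at least `ε n` vertices, where `θ` is the survival probability of the
branching process with mean `n q`: if no path of length `m` starts at a vertex of such a cluster,
then there are many vertices that can be reached from it in fewer than `m` steps, and this is
improbable. -/
theorem exists_bprob_largeSet_le (C : ℝ) {ε : ℝ} (hε : 0 < ε) : ∃ n₀ : ℕ,
    ∀ (V : Type) [Fintype V] [DecidableEq V] (q : ℝ), n₀ ≤ Fintype.card V →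
      q ∈ Set.Icc (0 : ℝ) 1 → Fintype.card V * q ≤ C →
      bprob (er q) (fun η : Sym2 V → Bool => (survivalLim (Fintype.card V * q) + ε) *
        Fintype.card V ≤ (largeSet (openGraph η) (ε * Fintype.card V)).card) ≤ ε := by
  obtain ⟨m, hm⟩ := exists_survival_le C (half_pos hε)
  obtain ⟨n₁, hn₁⟩ := exists_bexp_abs_pathStarts_le m C 0 (ε ^ 2 / 4) (by positivity)
  set K := ∑ i ∈ Finset.range m, C ^ i with hK
  obtain ⟨n₂, hn₂⟩ := exists_nat_gt (K / ε / (ε ^ 2 / 4))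
  refine ⟨n₁ + n₂ + 1, fun V _ _ q hn hq hC => ?_⟩
  have hn' : 0 < Fintype.card V := by omega
  have hn2' : n₂ ≤ Fintype.card V := by omega
  have hM := hn₁ V q ∅ (by omega) hq hC (by simp)
  set n : ℝ := ((Fintype.card V : ℕ) : ℝ) with hndef
  have hn0 : 0 < n := by rw [hndef]; exact_mod_cast hn'
  have hn2 : (n₂ : ℝ) ≤ n := by rw [hndef]; exact_mod_cast hn2'
  have hnq : 0 ≤ n * q := mul_nonneg hn0.le hq.1
  set R : (Sym2 V → Bool) → ℝ := fun η =>
    ∑ v : V, ∑ i ∈ Finset.range m, ((ends η i ∅ v).card : ℝ) with hR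
  have hER : bexp (er q) R ≤ n * K := by
    rw [hR, bexp_sum]
    simp only [bexp_sum]
    refine (Finset.sum_le_sum fun v _ => Finset.sum_le_sum fun i _ =>
      bexp_card_ends_le hq hC i (Finset.notMem_empty v)).trans_eq ?_
    simp [hK, hndef]
  have hR0 : ∀ η, 0 ≤ R η := fun η =>
    Finset.sum_nonneg fun v _ => Finset.sum_nonneg fun i _ => Nat.cast_nonneg _
  -- the large clusters without long paths are in the balls of radius `m` of unusual size
  have hcard : ∀ η : Sym2 V → Bool, ((largeSet (openGraph η) (ε * n)).card : ℝ) ≤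
      (pathStarts η m ∅).card + R η / (ε * n) := by
    intro η
    set L := largeSet (openGraph η) (ε * n) with hL
    have h1 : (L.card : ℝ) ≤ (pathStarts η m ∅).card + (L \ pathStarts η m ∅).card := by
      exact_mod_cast Finset.card_le_card_sdiff_add_card.trans_eq (add_comm _ _)
    refine h1.trans (add_le_add_right ?_ _)
    rw [le_div_iff₀ (by positivity), ← nsmul_eq_mul, ← Finset.sum_const]
    refine (Finset.sum_le_sum fun v hv => ?_).trans (Finset.sum_le_sum_of_subset_of_nonneg
      (Finset.subset_univ _) fun v _ _ => Finset.sum_nonneg fun i _ => Nat.cast_nonneg _)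
    rw [Finset.mem_sdiff, mem_pathStarts] at hv
    have h2 := compSize_le_sum_card_ends (η := η) (m := m) (v := v)
      fun h => hv.2 ⟨Finset.notMem_empty _, h⟩
    refine (mem_largeSet.1 hv.1).trans ?_
    exact_mod_cast h2
  have hb : bexp (er q) (fun η => |((pathStarts η m ∅).card : ℝ) / n - survival (n * q) m| +
      1 / (ε * n * n) * R η) ≤ ε ^ 2 / 4 + ε ^ 2 / 4 := by
    rw [bexp_add, bexp_const_mul]
    refine add_le_add hM ?_
    calc _ ≤ 1 / (ε * n * n) * (n * K) := by gcongr
      _ = K / ε / n := by field_simp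
      _ ≤ ε ^ 2 / 4 := by
        rw [div_le_iff₀ hn0]
        rw [div_lt_iff₀ (by positivity)] at hn₂
        have : 0 < ε ^ 2 / 4 := by positivity
        nlinarith
  refine (bprob_le_div (er_mem hq) (half_pos hε) (f := fun η =>
    |((pathStarts η m ∅).card : ℝ) / n - survival (n * q) m| + 1 / (ε * n * n) * R η)
    (fun η => add_nonneg (abs_nonneg _) (mul_nonneg (by positivity) (hR0 η))) fun η hη => ?_).trans ?_
  · have h1 := hη.trans (hcard η)
    rw [← le_div_iff₀ hn0] at h1
    have h2 : ((pathStarts η m ∅).card + R η / (ε * n)) / n =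
        (pathStarts η m ∅).card / n + 1 / (ε * n * n) * R η := by
      field_simp
    rw [h2] at h1
    have h3 := hm (n * q) ⟨hnq, hC⟩
    have h4 := le_abs_self (((pathStarts η m ∅).card : ℝ) / n - survival (n * q) m)
    linarith
  · rw [div_le_iff₀ (half_pos hε)]
    refine hb.trans_eq ?_
    ring

/-! ### The giant cluster: sprinkling -/

/-- If no part of a finite partition is too large, some union of parts has at least a given size,
and so has its complement. -/
lemma exists_subset_sum_mem_Icc {ι : Type*} [Fintype ι] [DecidableEq ι] (w : ι → ℝ) (s : ℝ)
    (hs : 0 < s) (h3 : 3 * s ≤ ∑ i, w i) (h : ∀ i, w i ≤ ∑ i, w i - s) :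
    ∃ I : Finset ι, s ≤ ∑ i ∈ I, w i ∧ ∑ i ∈ I, w i ≤ ∑ i, w i - s := by
  by_cases hbig : ∃ i, s ≤ w i
  · obtain ⟨i, hi⟩ := hbig
    exact ⟨{i}, by simpa using hi, by simpa using h i⟩
  push Not at hbig
  obtain ⟨I, hI, hmax⟩ := Finset.exists_max_image
    (Finset.univ.filter fun I : Finset ι => ∑ i ∈ I, w i ≤ ∑ i, w i - s) Finset.card
    ⟨∅, by simp only [Finset.mem_filter, Finset.mem_univ, true_and, Finset.sum_empty]; linarith⟩
  simp only [Finset.mem_filter, Finset.mem_univ, true_and] at hI hmax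
  refine ⟨I, ?_, hI⟩
  by_contra! hlt
  have hne : I ≠ Finset.univ := by
    rintro rfl
    linarith
  obtain ⟨j, hj⟩ : ∃ j, j ∉ I := by
    by_contra! hall
    exact hne (Finset.eq_univ_iff_forall.2 hall)
  have h1 := hmax (insert j I) (by rw [Finset.sum_insert hj]; linarith [hbig j])
  rw [Finset.card_insert_of_notMem hj] at h1
  omega

section Sprinkling

variable {V : Type*} [Fintype V] [DecidableEq V] {q : ℝ}

open scoped Classical in
/-- The unions of clusters of `G` that are contained in `W`, when `W` is a union of clusters. -/
def clusterUnions (G : SimpleGraph V) (W : Finset V) : Finset (Finset V) :=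
  W.powerset.filter fun S => ∀ u ∈ S, ∀ v ∈ W, G.Reachable u v → v ∈ S

/-- There are at most `exp (n / k)` unions of clusters with at least `k` vertices. -/
lemma card_clusterUnions_le (G : SimpleGraph V) {k : ℕ} (hk : 0 < k) :
    ((clusterUnions G (largeSet G k)).card : ℝ) ≤ Real.exp (Fintype.card V / k) := by
  classical
  set K : Finset G.ConnectedComponent := Finset.univ.filter fun c => k ≤ c.supp.ncard with hK
  have h1 : (clusterUnions G (largeSet G k)).card ≤ K.powerset.card := by
    refine Finset.card_le_card_of_injOn (fun S => S.image G.connectedComponentMk) ?_ ?_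
    · intro S hS
      simp only [clusterUnions, Finset.coe_filter, Set.mem_ofPred_eq, Finset.mem_powerset] at hS
      simp only [Finset.coe_powerset, Set.mem_preimage, Set.mem_powerset_iff, Finset.coe_subset]
      intro c hc
      obtain ⟨u, hu, rfl⟩ := Finset.mem_image.1 hc
      have := mem_largeSet.1 (hS.1 hu)
      simp only [hK, Finset.mem_filter, Finset.mem_univ, true_and]
      exact_mod_cast this
    · have key : ∀ S ∈ clusterUnions G (largeSet G k), ∀ T ∈ clusterUnions G (largeSet G k),
          S.image G.connectedComponentMk = T.image G.connectedComponentMk → S ⊆ T := by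
        intro S hS T hT hST u hu
        simp only [clusterUnions, Finset.mem_filter, Finset.mem_powerset] at hS hT
        have h2 : G.connectedComponentMk u ∈ T.image G.connectedComponentMk :=
          hST ▸ Finset.mem_image_of_mem _ hu
        obtain ⟨x, hx, hxu⟩ := Finset.mem_image.1 h2
        exact hT.2 x hx u (hS.1 hu) (SimpleGraph.ConnectedComponent.exact hxu)
      intro S hS T hT hST
      exact (key S hS T hT hST).antisymm (key T hT S hS hST.symm)
  have h2 : K.card * k ≤ Fintype.card V := by
    calc K.card * k = ∑ c ∈ K, k := by simp
      _ ≤ ∑ c ∈ K, c.supp.toFinset.card := Finset.sum_le_sum fun c hc => by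
          rw [← Set.ncard_eq_toFinset_card']
          exact (Finset.mem_filter.1 hc).2
      _ = (K.biUnion fun c => c.supp.toFinset).card := by
          rw [Finset.card_biUnion]
          intro c _ d _ hcd
          refine Set.disjoint_toFinset.2 ?_
          exact SimpleGraph.pairwise_disjoint_supp_connectedComponent G hcd
      _ ≤ Fintype.card V := Finset.card_le_univ _
  have hk' : (0 : ℝ) < k := by exact_mod_cast hk
  calc ((clusterUnions G (largeSet G k)).card : ℝ) ≤ 2 ^ K.card := by
        rw [Finset.card_powerset] at h1
        exact_mod_cast h1
    _ ≤ Real.exp 1 ^ K.card := by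
        gcongr
        linarith [Real.add_one_le_exp (1 : ℝ)]
    _ = Real.exp K.card := by rw [← Real.exp_nat_mul, mul_one]
    _ ≤ _ := by
        refine Real.exp_le_exp.2 ?_
        rw [le_div_iff₀ hk']
        exact_mod_cast h2

/-- If no cluster of the larger graph `H` meets `W` in more than `#W - s` vertices, then `W` is the
union of two sets of at least `s` vertices that are not connected in `H`. -/
lemma exists_split {G H : SimpleGraph V} (hGH : G ≤ H) {W : Finset V} {s : ℝ} (hs : 0 < s)
    (h3 : 3 * s ≤ W.card) (h : ∀ v, (compSize H v : ℝ) ≤ W.card - s) :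
    ∃ S ∈ clusterUnions G W, s ≤ S.card ∧ s ≤ (W.card : ℝ) - S.card ∧
      ∀ u ∈ S, ∀ v ∈ W, v ∉ S → ¬H.Reachable u v := by
  classical
  set w : H.ConnectedComponent → ℝ := fun c =>
    ((W.filter fun v => H.connectedComponentMk v = c).card : ℝ) with hw
  have hsum : ∀ I : Finset H.ConnectedComponent,
      ∑ c ∈ I, w c = ((W.filter fun v => H.connectedComponentMk v ∈ I).card : ℝ) := by
    intro I
    rw [Finset.card_eq_sum_card_fiberwise (t := I) (f := H.connectedComponentMk)
      (fun v hv => by simpa using (Finset.mem_filter.1 hv).2)]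
    push_cast
    refine Finset.sum_congr rfl fun c hc => ?_
    simp only [hw]
    congr 2
    ext v
    simp only [Finset.mem_filter]
    constructor
    · rintro ⟨h1, rfl⟩
      exact ⟨⟨h1, hc⟩, rfl⟩
    · rintro ⟨⟨h1, _⟩, h2⟩
      exact ⟨h1, h2⟩
  have htot : ∑ c, w c = W.card := by
    rw [hsum]
    simp
  have hle : ∀ c, w c ≤ W.card - s := by
    intro c
    induction c using SimpleGraph.ConnectedComponent.ind with
    | h v =>
      refine le_trans ?_ (h v)
      refine Nat.cast_le.2 (card_le_compSize fun u hu => ?_)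
      exact (SimpleGraph.ConnectedComponent.exact (Finset.mem_filter.1 hu).2).symm
  obtain ⟨I, hI1, hI2⟩ := exists_subset_sum_mem_Icc w s hs (by rw [htot]; exact h3)
    (by rw [htot]; exact hle)
  rw [hsum] at hI1 hI2
  rw [htot] at hI2
  refine ⟨W.filter fun v => H.connectedComponentMk v ∈ I, ?_, hI1, by linarith, ?_⟩
  · simp only [clusterUnions, Finset.mem_filter, Finset.mem_powerset, Finset.filter_subset,
      true_and]
    intro u hu v hv huv
    refine ⟨hv, ?_⟩
    rw [← SimpleGraph.ConnectedComponent.sound (huv.mono hGH)]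
    exact hu.2
  · intro u hu v hv hvS huv
    refine hvS (Finset.mem_filter.2 ⟨hv, ?_⟩)
    rw [← SimpleGraph.ConnectedComponent.sound huv]
    exact (Finset.mem_filter.1 hu).2

/-- The probability that no edge between the disjoint sets `S` and `T` is open. -/
lemma bprob_no_edge_le (hq : q ∈ Set.Icc (0 : ℝ) 1) {S T : Finset V} (hST : Disjoint S T) {s : ℝ}
    (hs : 0 ≤ s) (hS : s ≤ S.card) (hT : s ≤ T.card) :
    bprob (er q) (fun η : Sym2 V → Bool => ∀ u ∈ S, ∀ v ∈ T, η s(u, v) = false) ≤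
      Real.exp (-(q * s ^ 2)) := by
  have h := bprob_closed (er q) (fun _ => (S ×ˢ T).image fun x => s(x.1, x.2))
    fun _ _ _ _ _ => rfl
  rw [bexp_const] at h
  have h1 : bprob (er q) (fun η : Sym2 V → Bool => ∀ u ∈ S, ∀ v ∈ T, η s(u, v) = false) =
      bprob (er q) (fun η : Sym2 V → Bool => ∀ e ∈ (S ×ˢ T).image fun x => s(x.1, x.2),
        η e = false) := by
    congr 1
    funext η
    refine propext ?_
    simp only [Finset.forall_mem_image, Finset.mem_product, Prod.forall, and_imp]
    exact ⟨fun h a b ha hb => h a ha b hb, fun h a ha b hb => h a b ha hb⟩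
  have hinj : Set.InjOn (fun x : V × V => s(x.1, x.2)) (S ×ˢ T : Finset (V × V)) := by
    rintro ⟨a, b⟩ hab ⟨c, d⟩ hcd heq
    simp only [Finset.coe_product, Set.mem_prod, Finset.mem_coe] at hab hcd
    rcases Sym2.eq_iff.1 heq with ⟨h1, h2⟩ | ⟨h1, h2⟩
    · simp only at h1 h2
      rw [h1, h2]
    · simp only at h1 h2
      exact absurd (h1 ▸ hab.1) (Finset.disjoint_right.1 hST hcd.2)
  rw [h1, h, Finset.prod_image hinj]
  have h2 : ∀ x : V × V, x ∈ S ×ˢ T → 1 - er q s(x.1, x.2) = 1 - q := by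
    rintro ⟨a, b⟩ hab
    rw [Finset.mem_product] at hab
    have : a ≠ b := by
      rintro rfl
      exact Finset.disjoint_left.1 hST hab.1 hab.2
    simp [er, this]
  rw [Finset.prod_congr rfl h2, Finset.prod_const, Finset.card_product]
  calc (1 - q) ^ (S.card * T.card) ≤ Real.exp (-q) ^ (S.card * T.card) := by
        gcongr
        · linarith [hq.2]
        · exact Real.one_sub_le_exp_neg q
    _ = Real.exp (-(q * (S.card * T.card))) := by
        rw [← Real.exp_nat_mul]
        push_cast
        ring_nf
    _ ≤ Real.exp (-(q * s ^ 2)) := by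
        have : s ^ 2 ≤ S.card * T.card := by rw [sq]; gcongr
        have := mul_le_mul_of_nonneg_left this hq.1
        gcongr

/-- If the clusters of at least `k` vertices have many vertices in total, then opening a few more
edges connects most of these vertices: there are not many ways to split these clusters in
two groups. -/
lemma bprob_not_connected_le (hq : q ∈ Set.Icc (0 : ℝ) 1) (η : Sym2 V → Bool) {k : ℕ} (hk : 0 < k)
    {s y : ℝ} (hs : 0 < s) (h3 : 3 * s ≤ (largeSet (openGraph η) k).card)
    (hy : y ≤ (largeSet (openGraph η) k).card - s) :
    bprob (er q) (fun ξ => ¬∃ v, y ≤ compSize (openGraph (η ⊔ ξ)) v) ≤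
      Real.exp (Fintype.card V / k) * Real.exp (-(q * s ^ 2)) := by
  classical
  set G := openGraph η with hG
  set W := largeSet G k with hW
  set 𝒮 := (clusterUnions G W).filter fun S => s ≤ S.card ∧ s ≤ (W.card : ℝ) - S.card with h𝒮
  refine (bprob_mono (er_mem hq) (B := fun ξ => ∃ S ∈ 𝒮, ∀ u ∈ S, ∀ v ∈ W \ S, ξ s(u, v) = false)
    fun ξ hξ => ?_).trans ?_
  · simp only [not_exists, not_le] at hξ
    obtain ⟨S, hS, hS1, hS2, hS3⟩ := exists_split (openGraph_mono (le_sup_left : η ≤ η ⊔ ξ)) hs h3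
      fun v => (hξ v).le.trans hy
    refine ⟨S, Finset.mem_filter.2 ⟨hS, hS1, hS2⟩, fun u hu v hv => ?_⟩
    rw [Finset.mem_sdiff] at hv
    by_contra hne
    have huv : u ≠ v := by
      rintro rfl
      exact hv.2 hu
    refine hS3 u hu v hv.1 hv.2 (SimpleGraph.Adj.reachable (openGraph_adj.2 ⟨?_, huv⟩))
    simp only [Bool.not_eq_false] at hne
    simp [hne]
  · refine (bprob_exists_le (er_mem hq) 𝒮 _).trans ?_
    have h1 : ∀ S ∈ 𝒮, bprob (er q) (fun ξ : Sym2 V → Bool =>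
        ∀ u ∈ S, ∀ v ∈ W \ S, ξ s(u, v) = false) ≤ Real.exp (-(q * s ^ 2)) := by
      intro S hS
      obtain ⟨hS0, hS1, hS2⟩ := Finset.mem_filter.1 hS
      refine bprob_no_edge_le hq Finset.disjoint_sdiff hs.le hS1 ?_
      have hsub : S ⊆ W := Finset.mem_powerset.1 (Finset.mem_filter.1 hS0).1
      rw [Finset.cast_card_sdiff hsub]
      exact hS2
    refine (Finset.sum_le_sum h1).trans ?_
    rw [Finset.sum_const, nsmul_eq_mul]
    refine mul_le_mul_of_nonneg_right ?_ (Real.exp_pos _).le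
    exact (Nat.cast_le.2 (Finset.card_filter_le _ _)).trans (card_clusterUnions_le G hk)

end Sprinkling

/-- **Lower bound for the giant cluster.** With high probability, `G(n, q)` has a cluster of at
least `(θ - ε) n` vertices, where `θ` is the survival probability of the branching process with
mean `n q`. -/
theorem exists_le_bprob_compSize (C : ℝ) {ε : ℝ} (hε : 0 < ε) : ∃ n₀ : ℕ,
    ∀ (V : Type) [Fintype V] [DecidableEq V] (q : ℝ), n₀ ≤ Fintype.card V →
      q ∈ Set.Icc (0 : ℝ) 1 → Fintype.card V * q ≤ C →
      1 - ε ≤ bprob (er q) (fun η : Sym2 V → Bool => ∃ v,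
        (survivalLim (Fintype.card V * q) - ε) * Fintype.card V ≤ compSize (openGraph η) v) := by
  obtain ⟨δ₀, hδ₀, hcont⟩ := exists_survivalLim_near C (ε := ε / 4) (by positivity)
  set δ := min (δ₀ / 2) 1 with hδ
  have hδ0 : 0 < δ := by positivity
  have hδ1 : δ ≤ 1 := min_le_right _ _
  have hδ2 : δ < δ₀ := (min_le_left _ _).trans_lt (by linarith)
  obtain ⟨m, hm⟩ := exists_nat_gt (72 / (δ * ε ^ 2))
  obtain ⟨n₁, hn₁⟩ := exists_bexp_abs_pathStarts_le m C 0 (ε ^ 2 / 8) (by positivity)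
  obtain ⟨n₂, hn₂⟩ := exists_nat_gt (144 / (δ * ε ^ 3))
  refine ⟨n₁ + n₂ + 1, fun V _ _ q hn hq hC => ?_⟩
  have hn' : 0 < Fintype.card V := by omega
  have hn1' : n₁ ≤ Fintype.card V := by omega
  have hn2' : n₂ ≤ Fintype.card V := by omega
  have hn3' : 1 ≤ Fintype.card V := by omega
  obtain ⟨v₀⟩ : Nonempty V := Fintype.card_pos_iff.1 hn'
  have hM := fun q => hn₁ V q ∅ hn1'
  set n : ℝ := ((Fintype.card V : ℕ) : ℝ) with hndef
  have hn0 : 0 < n := by rw [hndef]; exact_mod_cast hn'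
  have hn1 : 1 ≤ n := by rw [hndef]; exact_mod_cast hn3'
  have hn2 : (n₂ : ℝ) ≤ n := by rw [hndef]; exact_mod_cast hn2'
  have hnq : 0 ≤ n * q := mul_nonneg hn0.le hq.1
  by_cases hθ : survivalLim (n * q) ≤ ε
  · rw [bprob_true]
    · linarith
    · intro η
      exact ⟨v₀, (mul_nonpos_of_nonpos_of_nonneg (by linarith) hn0.le).trans (Nat.cast_nonneg _)⟩
  push Not at hθ
  have hδq : δ ≤ n * q := by
    by_contra! hlt
    have h0 : survivalLim 0 = 0 := by simpa using survivalLim_eq (le_refl (0 : ℝ))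
    have := hcont (n * q) ⟨hnq, hC⟩ 0 ⟨le_rfl, hnq.trans hC⟩
      (by rw [sub_zero, abs_of_nonneg hnq]; linarith)
    rw [h0, sub_zero, abs_lt] at this
    linarith
  set q₁ := q - δ / n with hq₁
  set q₂ := δ / n with hq₂
  have hq₂0 : 0 ≤ q₂ := by positivity
  have hq₂1 : q₂ ∈ Set.Icc (0 : ℝ) 1 := ⟨hq₂0, by rw [hq₂, div_le_one hn0]; linarith⟩
  have hq₂q : q₂ ≤ q := by rw [hq₂, div_le_iff₀ hn0]; linarith
  have hq₁1 : q₁ ∈ Set.Icc (0 : ℝ) 1 := ⟨by linarith, by linarith [hq.2]⟩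
  have hnq₁ : n * q₁ = n * q - δ := by rw [hq₁, hq₂]; field_simp
  have hnq₁C : n * q₁ ≤ C := by linarith
  have hnq₁0 : 0 ≤ n * q₁ := mul_nonneg hn0.le hq₁1.1
  have hθ₁ : survivalLim (n * q) - ε / 4 ≤ survivalLim (n * q₁) := by
    have := hcont (n * q) ⟨hnq, hC⟩ (n * q₁) ⟨hnq₁0, hnq₁C⟩
      (by rw [hnq₁, sub_sub_cancel, abs_of_pos hδ0]; exact hδ2)
    rw [abs_lt] at this
    linarith
  set y := (survivalLim (n * q) - ε) * n with hy
  set good : (Sym2 V → Bool) → Prop := fun η => ∃ v, y ≤ compSize (openGraph η) v with hgood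
  -- the clusters before sprinkling
  set few : (Sym2 V → Bool) → Prop := fun η =>
    ((largeSet (openGraph η) (m + 1 : ℕ)).card : ℝ) < (survivalLim (n * q₁) - ε / 4) * n with hfew
  have hfewP : bprob (er q₁) few ≤ ε / 2 := by
    refine (bprob_le_div (er_mem hq₁1) (a := ε / 4) (by positivity) (fun η => abs_nonneg _)
      fun η hη => ?_).trans ((div_le_div_of_nonneg_right (hM q₁ hq₁1 hnq₁C (by simp))
        (by positivity)).trans_eq (by field_simp; norm_num))
    have h1 : ((pathStarts η m ∅).card : ℝ) ≤ (largeSet (openGraph η) (m + 1 : ℕ)).card := by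
      refine Nat.cast_le.2 (Finset.card_le_card fun v hv => ?_)
      rw [mem_largeSet]
      exact Nat.cast_le.2 (succ_le_compSize (mem_pathStarts.1 hv).2)
    have h2 := h1.trans_lt hη
    rw [← div_lt_iff₀ hn0] at h2
    have h3 := survivalLim_le hnq₁0 m
    have h4 := neg_abs_le (((pathStarts η m ∅).card : ℝ) / n - survival (n * q₁) m)
    linarith
  have hsprinkle : ∀ η : Sym2 V → Bool, ¬few η →
      bprob (er q₂) (fun ξ => ¬good (η ⊔ ξ)) ≤ ε / 2 := by
    intro η hη
    simp only [hfew, not_lt] at hη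
    have hW : (survivalLim (n * q) - ε / 2) * n ≤ (largeSet (openGraph η) (m + 1 : ℕ)).card := by
      exact le_trans (mul_le_mul_of_nonneg_right (by linarith) hn0.le) hη
    have hεn : 0 < ε * n := by positivity
    have hW2 : ε / 2 * n ≤ (largeSet (openGraph η) (m + 1 : ℕ)).card := by
      refine le_trans ?_ hW
      gcongr
      linarith
    refine (bprob_not_connected_le hq₂1 η (Nat.succ_pos m) (s := ε * n / 6) (y := y)
      (by positivity) (by linarith) (by rw [hy]; linarith)).trans ?_
    rw [← Real.exp_add]
    have h1 : n / (m + 1 : ℕ) ≤ δ * ε ^ 2 * n / 72 := by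
      rw [div_le_div_iff₀ (by positivity) (by norm_num)]
      rw [div_lt_iff₀ (by positivity)] at hm
      push_cast
      have : 72 ≤ (m + 1) * (δ * ε ^ 2) := by
        have : 0 < δ * ε ^ 2 := by positivity
        linarith
      nlinarith
    have h2 : q₂ * (ε * n / 6) ^ 2 = δ * ε ^ 2 * n / 36 := by
      rw [hq₂]
      field_simp
      norm_num
    rw [h2]
    have h3 : 0 < δ * ε ^ 2 * n / 72 := by positivity
    calc Real.exp (n / (m + 1 : ℕ) + -(δ * ε ^ 2 * n / 36))
        ≤ Real.exp (-(δ * ε ^ 2 * n / 72)) := Real.exp_le_exp.2 (by linarith)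
      _ ≤ 1 / (δ * ε ^ 2 * n / 72) := by
          rw [Real.exp_neg, ← one_div]
          gcongr
          linarith [Real.add_one_le_exp (δ * ε ^ 2 * n / 72)]
      _ ≤ ε / 2 := by
          rw [div_le_div_iff₀ h3 (by norm_num)]
          rw [div_lt_iff₀ (by positivity)] at hn₂
          have : 144 ≤ n * (δ * ε ^ 3) := hn₂.le.trans (by gcongr)
          linarith
  have hgood_mono : ∀ η ξ : Sym2 V → Bool, η ≤ ξ → good η → good ξ := by
    rintro η ξ h ⟨v, hv⟩
    exact ⟨v, hv.trans (Nat.cast_le.2 (compSize_mono (openGraph_mono h) v))⟩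
  refine le_trans ?_ (bprob_sup_le (er_mem hq₁1) (er_mem hq₂1) (er_mem hq) (fun e => ?_) hgood_mono)
  · have h1 : ∀ η : Sym2 V → Bool, 1 - ε / 2 - (open scoped Classical in if few η then 1 else 0) ≤
        bprob (er q₂) fun ξ => good (η ⊔ ξ) := by
      intro η
      have h2 := bprob_not (p := er q₂) fun ξ => good (η ⊔ ξ)
      split_ifs with hη
      · have := bprob_le_one (er_mem hq₂1) fun ξ => ¬good (η ⊔ ξ)
        linarith
      · linarith [hsprinkle η hη]
    have h2 := bexp_mono (er_mem hq₁1) h1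
    rw [bexp_sub, bexp_const] at h2
    change 1 - ε / 2 - bprob (er q₁) few ≤ _ at h2
    linarith
  · unfold er
    split_ifs
    · simp
    · have := mul_nonneg hq₁1.1 hq₂0
      linarith

/-! ### The asymptotic density of the largest cluster -/

section ClusterSize

variable {V : Type*} [Finite V] {G : SimpleGraph V}

/-- The `k`-th largest cluster has at least `m` vertices if and only if there are `k` vertices in
different clusters of at least `m` vertices. -/
lemma le_clusterSize_iff {k m : ℕ} (hk : 0 < k) (hm : 0 < m) :
    m ≤ clusterSize G k ↔ ∃ S : Finset V, S.card = k ∧ (∀ u ∈ S, m ≤ compSize G u) ∧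
      ∀ u ∈ S, ∀ v ∈ S, G.Reachable u v → u = v := by
  classical
  have hfin : ∀ m, {C : G.ConnectedComponent | m ≤ C.supp.ncard}.Finite := fun m => Set.toFinite _
  have hbdd : BddAbove {m : ℕ | k ≤ {C : G.ConnectedComponent | m ≤ C.supp.ncard}.ncard} := by
    refine ⟨Nat.card V, fun m hm => ?_⟩
    obtain ⟨C, hC⟩ := (Set.ncard_pos (hfin m)).1 (hk.trans_le hm)
    exact le_trans hC (Set.ncard_le_card _)
  have h1 : m ≤ clusterSize G k ↔ k ≤ {C : G.ConnectedComponent | m ≤ C.supp.ncard}.ncard := by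
    refine ⟨fun h => ?_, fun h => le_csSup hbdd h⟩
    have hne : {m : ℕ | k ≤ {C : G.ConnectedComponent | m ≤ C.supp.ncard}.ncard}.Nonempty := by
      by_contra hne
      rw [Set.not_nonempty_iff_eq_empty] at hne
      rw [clusterSize, hne, csSup_empty] at h
      exact absurd h (by simpa [Nat.pos_iff_ne_zero] using hm)
    refine (Nat.sSup_mem hne hbdd).trans (Set.ncard_le_ncard (fun C hC => ?_) (hfin m))
    exact h.trans hC
  rw [h1]
  constructor
  · intro h
    obtain ⟨T, hT, hTk⟩ := Set.exists_subset_card_eq h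
    have hTfin : T.Finite := (hfin m).subset hT
    obtain ⟨rep, hrep⟩ : ∃ rep : G.ConnectedComponent → V,
        ∀ C, G.connectedComponentMk (rep C) = C := ⟨fun C => Quot.out C, fun C => Quot.out_eq C⟩
    refine ⟨hTfin.toFinset.image rep, ?_, ?_, ?_⟩
    · rw [Finset.card_image_of_injective _ (Function.LeftInverse.injective hrep),
        ← Set.ncard_eq_toFinset_card _ hTfin, hTk]
    · intro u hu
      obtain ⟨C, hC, rfl⟩ := Finset.mem_image.1 hu
      rw [compSize, hrep]
      exact hT (hTfin.mem_toFinset.1 hC)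
    · intro u hu v hv huv
      obtain ⟨C, hC, rfl⟩ := Finset.mem_image.1 hu
      obtain ⟨D, hD, rfl⟩ := Finset.mem_image.1 hv
      rw [← SimpleGraph.ConnectedComponent.eq, hrep, hrep] at huv
      rw [huv]
  · rintro ⟨S, hS, hS1, hS2⟩
    rw [← hS, ← Finset.card_image_of_injOn (f := G.connectedComponentMk) (s := S)
      fun u hu v hv huv => hS2 u hu v hv (SimpleGraph.ConnectedComponent.exact huv),
      ← Set.ncard_coe_finset]
    refine Set.ncard_le_ncard (fun C hC => ?_) (hfin m)
    obtain ⟨u, hu, rfl⟩ := Finset.mem_image.1 hC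
    exact hS1 u hu

lemma compSize_le_clusterSize_one (v : V) : compSize G v ≤ clusterSize G 1 := by
  rcases Nat.eq_zero_or_pos (compSize G v) with h | h
  · rw [h]
    exact Nat.zero_le _
  · exact (le_clusterSize_iff one_pos h).2 ⟨{v}, by simp⟩

lemma compSize_le_card_largeSet {V : Type*} [Fintype V] {G : SimpleGraph V} {x : ℝ} {v : V}
    (h : x ≤ compSize G v) : compSize G v ≤ (largeSet G x).card := by
  refine compSize_le_card fun w hw => ?_
  rw [mem_largeSet, ← compSize_eq_of_reachable hw]
  exact h

end ClusterSize

section BinomialRandom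

variable {V : Type*} [Fintype V] [DecidableEq V]

lemma setBernoulli_singleton_eq (p : unitInterval) (η : Sym2 V → Bool) :
    setBernoulli (Sym2.diagSet (α := V))ᶜ p {{e | η e = true}} =
      ENNReal.ofReal (∏ e, if η e then er (p : ℝ) e else 1 - er (p : ℝ) e) := by
  classical
  have hp := er_mem (V := V) (q := p) ⟨p.2.1, p.2.2⟩
  rw [setBernoulli_apply, Set.image_singleton, Measure.infinitePi_eq_pi, Measure.pi_singleton,
    ENNReal.ofReal_prod_of_nonneg]
  · refine Finset.prod_congr rfl fun e _ => ?_
    by_cases hd : e.IsDiag <;> cases hη : η e <;>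
      simp [hd, hη, er, Set.indicator]
    · rw [← ENNReal.coe_add, ENNReal.coe_eq_one]
      exact NNReal.eq (by simp)
    · exact (ENNReal.ofReal_eq_coe_nnreal (unitInterval.symm p).2.1).symm
    · exact (ENNReal.ofReal_eq_coe_nnreal p.2.1).symm
  · intro e _
    split_ifs
    · exact (hp e).1
    · linarith [(hp e).2]

/-- The random graph `G(V, p)` of Mathlib is the graph of independent open edges. -/
lemma binomialRandom_eq_bprob (p : unitInterval) (A : SimpleGraph V → Prop) :
    SimpleGraph.binomialRandom V p {G | A G} =
      ENNReal.ofReal (bprob (er (p : ℝ)) fun η => A (openGraph η)) := by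
  classical
  have hp := er_mem (V := V) (q := p) ⟨p.2.1, p.2.2⟩
  have hmeas : MeasurableSet {G : SimpleGraph V | A G} :=
    SimpleGraph.measurableEmbedding_edgeSet.measurableSet_image.1 .of_discrete
  rw [SimpleGraph.binomialRandom_eq_map, Measure.map_apply (by fun_prop) hmeas]
  set φ : (Sym2 V → Bool) ≃ Set (Sym2 V) := Equiv.arrowCongr (Equiv.refl _) Equiv.propEquivBool.symm
  have hφ : ∀ η, φ η = {e | η e = true} := fun η => rfl
  have hset : SimpleGraph.fromEdgeSet ⁻¹' {G : SimpleGraph V | A G} =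
      (((Finset.univ.filter fun η => A (openGraph η)).map φ.toEmbedding :
        Finset (Set (Sym2 V))) : Set (Set (Sym2 V))) := by
    ext s
    obtain ⟨η, rfl⟩ := φ.surjective s
    simp only [Finset.coe_map, Equiv.coe_toEmbedding, Function.Injective.mem_set_image φ.injective]
    rw [hφ]
    simp only [Set.mem_preimage, Finset.coe_filter, Finset.mem_univ, true_and]
    exact Iff.rfl
  rw [hset, ← sum_measure_singleton, Finset.sum_map, bprob, bexp,
    ENNReal.ofReal_sum_of_nonneg, Finset.sum_filter]
  · refine Finset.sum_congr rfl fun η _ => ?_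
    split_ifs
    · rw [mul_one]
      exact setBernoulli_singleton_eq p η
    · simp
  · intro η _
    refine mul_nonneg (Finset.prod_nonneg fun e _ => ?_) (by split_ifs <;> simp)
    have := hp e
    split_ifs
    · exact this.1
    · linarith [this.2]

end BinomialRandom

/-- With the estimates from both sides, the largest cluster of `G(n, c / n)` has density tending to
the survival probability. -/
theorem isGiantDensity_survivalLim {c : ℝ} (hc : 0 ≤ c) : IsGiantDensity c (survivalLim c) := by
  intro ε hε
  rw [ENNReal.tendsto_nhds_zero]
  intro δ hδ
  obtain ⟨r, hr0, hrδ⟩ : ∃ r : ℝ, 0 < r ∧ ENNReal.ofReal r ≤ δ := by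
    rcases eq_or_ne δ ⊤ with rfl | hδt
    · exact ⟨1, one_pos, le_top⟩
    · exact ⟨δ.toReal, ENNReal.toReal_pos hδ.ne' hδt, ENNReal.ofReal_toReal_le⟩
  set a := min ε (r / 2) with ha
  have ha0 : 0 < a := by positivity
  have haε : a ≤ ε := min_le_left _ _
  have har : a ≤ r / 2 := min_le_right _ _
  obtain ⟨n₁, hn₁⟩ := exists_bprob_largeSet_le c ha0
  obtain ⟨n₂, hn₂⟩ := exists_le_bprob_compSize c ha0
  obtain ⟨n₃, hn₃⟩ := exists_nat_ge c
  filter_upwards [eventually_ge_atTop (n₁ + n₂ + n₃ + 1)] with N hN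
  have hN0 : (0 : ℝ) < N := by exact_mod_cast (by omega : 0 < N)
  have hcN : c ≤ N := hn₃.trans (by exact_mod_cast (by omega : n₃ ≤ N))
  have hp : (edgeProb c N : ℝ) = c / N := by
    rw [edgeProb, Set.projIcc_of_mem zero_le_one ⟨by positivity, by rwa [div_le_one hN0]⟩]
  have hNp : (Fintype.card (Fin N) : ℝ) * (edgeProb c N : ℝ) = c := by
    rw [hp, Fintype.card_fin]
    field_simp
  have hpI : (edgeProb c N : ℝ) ∈ Set.Icc (0 : ℝ) 1 := (edgeProb c N).2
  have h1 := hn₁ (Fin N) _ (by rw [Fintype.card_fin]; omega) hpI hNp.le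
  have h2 := hn₂ (Fin N) _ (by rw [Fintype.card_fin]; omega) hpI hNp.le
  rw [hNp, Fintype.card_fin] at h1 h2
  refine le_trans ?_ hrδ
  rw [binomialRandom_eq_bprob (edgeProb c N) fun G => ε < |clusterDensity G 1 - survivalLim c|]
  refine ENNReal.ofReal_le_ofReal ?_
  have h3 := bprob_not (p := er (edgeProb c N : ℝ)) fun η : Sym2 (Fin N) → Bool =>
    ∃ v, (survivalLim c - a) * N ≤ compSize (openGraph η) v
  refine (bprob_mono (er_mem hpI) (B := fun η : Sym2 (Fin N) → Bool =>
    (survivalLim c + a) * N ≤ (largeSet (openGraph η) (a * N)).card ∨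
    ¬∃ v, (survivalLim c - a) * N ≤ compSize (openGraph η) v) fun η hη => ?_).trans
      ((bprob_or_le (er_mem hpI) _ _).trans (by linarith))
  by_contra! hgood
  obtain ⟨hg1, v, hv⟩ := hgood
  have hθ := survivalLim_mem hc
  refine absurd hη (not_lt.2 ((abs_le.2 ⟨?_, ?_⟩).trans haε))
  · have h4 : (compSize (openGraph η) v : ℝ) ≤ clusterSize (openGraph η) 1 :=
      Nat.cast_le.2 (compSize_le_clusterSize_one v)
    have h5 : survivalLim c - a ≤ clusterDensity (openGraph η) 1 := by
      rw [clusterDensity, le_div_iff₀ hN0]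
      exact hv.trans h4
    linarith
  · have h5 : clusterDensity (openGraph η) 1 ≤ survivalLim c + a := by
      rw [clusterDensity, div_le_iff₀ hN0]
      rcases Nat.eq_zero_or_pos (clusterSize (openGraph η) 1) with h0 | h0
      · rw [h0, Nat.cast_zero]
        exact mul_nonneg (by linarith [hθ.1]) hN0.le
      obtain ⟨S, hS, hS1, -⟩ := (le_clusterSize_iff (G := openGraph η) one_pos h0).1 le_rfl
      obtain ⟨u, rfl⟩ := Finset.card_eq_one.1 hS
      have hu : (clusterSize (openGraph η) 1 : ℝ) ≤ compSize (openGraph η) u :=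
        Nat.cast_le.2 (hS1 u (by simp))
      by_cases hua : a * N ≤ compSize (openGraph η) u
      · have h6 : (compSize (openGraph η) u : ℝ) ≤ (largeSet (openGraph η) (a * N)).card :=
          Nat.cast_le.2 (compSize_le_card_largeSet hua)
        linarith
      · nlinarith [hθ.1]
    linarith

/-- The limit that defines the order parameter is unique. -/
lemma IsGiantDensity.unique {c t t' : ℝ} (h : IsGiantDensity c t) (h' : IsGiantDensity c t') :
    t = t' := by
  by_contra hne
  have hd : 0 < |t - t'| / 3 := by
    have := abs_pos.2 (sub_ne_zero.2 hne)
    positivity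
  have hsum := (h _ hd).add (h' _ hd)
  rw [add_zero] at hsum
  obtain ⟨N, hN⟩ := (hsum.eventually (gt_mem_nhds zero_lt_one)).exists
  refine absurd hN (not_lt.2 ?_)
  rw [← measure_univ (μ := SimpleGraph.binomialRandom (Fin N) (edgeProb c N))]
  refine (measure_mono fun G _ => ?_).trans (measure_union_le _ _)
  by_contra hG
  simp only [Set.mem_union, Set.mem_ofPred_eq, not_or, not_lt] at hG
  have h1 := abs_sub_le t (clusterDensity G 1) t'
  rw [abs_sub_comm t (clusterDensity G 1)] at h1
  linarith [hG.1, hG.2]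

/-- The order parameter of the random graph is the survival probability. -/
theorem theta_eq_survivalLim {c : ℝ} (hc : 0 ≤ c) : theta c = survivalLim c := by
  have hex : ∃ t, IsGiantDensity c t := ⟨_, isGiantDensity_survivalLim hc⟩
  rw [theta, dif_pos hex]
  exact hex.choose_spec.unique (isGiantDensity_survivalLim hc)

/-! ### Graphs with two groups of vertices -/

section OneGiant

variable {V : Type*} [Fintype V] {G : SimpleGraph V} {x e : ℝ}

lemma compSize_add_compSize_le {y : ℝ} {u v : V} (huv : ¬G.Reachable u v)
    (hu : y ≤ compSize G u) (hv : y ≤ compSize G v) :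
    (compSize G u : ℝ) + compSize G v ≤ (largeSet G y).card := by
  classical
  have hdisj : Disjoint (G.connectedComponentMk u).supp.toFinset
      (G.connectedComponentMk v).supp.toFinset := by
    refine Finset.disjoint_left.2 fun w hw hw' => huv ?_
    rw [Set.mem_toFinset, mem_supp_mk] at hw hw'
    exact hw.trans hw'.symm
  have hsub : (G.connectedComponentMk u).supp.toFinset ∪ (G.connectedComponentMk v).supp.toFinset ⊆
      largeSet G y := by
    intro w hw
    rw [mem_largeSet]
    rcases Finset.mem_union.1 hw with hw | hw <;> rw [Set.mem_toFinset, mem_supp_mk] at hw <;>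
      rwa [← compSize_eq_of_reachable hw]
  have h := Finset.card_le_card hsub
  rw [Finset.card_union_of_disjoint hdisj, ← Set.ncard_eq_toFinset_card',
    ← Set.ncard_eq_toFinset_card'] at h
  exact_mod_cast h

lemma compSize_le_of_card_largeSet_le (hx : 0 ≤ x) (h : (largeSet G e).card ≤ x + e) (v : V) :
    (compSize G v : ℝ) ≤ x + e := by
  by_cases hv : e ≤ compSize G v
  · exact (Nat.cast_le.2 (compSize_le_card_largeSet hv)).trans h
  · linarith

/-- If the vertices in large clusters are hardly more numerous than those of one cluster, there is
no second large cluster. -/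
lemma reachable_of_card_largeSet_le (he : 0 < e) (h : (largeSet G e).card ≤ x + e)
    (hgiant : x - e ≤ 0 ∨ ∃ v, x - e ≤ compSize G v) {u v : V} (hu : 3 * e < compSize G u)
    (hv : 3 * e < compSize G v) : G.Reachable u v := by
  by_contra huv
  have h1 := compSize_add_compSize_le (y := e) huv (by linarith) (by linarith)
  obtain ⟨g, hg⟩ := hgiant.resolve_left (by linarith)
  have key : ∀ w, 3 * e < compSize G w → G.Reachable g w := by
    intro w hw
    by_contra hgw
    have := compSize_add_compSize_le (y := e) hgw (by linarith) (by linarith)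
    linarith
  exact huv ((key u hu).symm.trans (key v hv))

end OneGiant

section TwoGroups

variable {V : Type*} [Fintype V] {G : SimpleGraph V} {T : V → Bool} {x : Bool → ℝ} {e : ℝ}

omit [Fintype V] in
lemma eq_of_reachable (hT : ∀ v w, G.Adj v w → T v = T w) {v w : V} (h : G.Reachable v w) :
    T v = T w := by
  obtain ⟨p⟩ := h
  induction p with
  | nil => rfl
  | cons h _ ih => exact (hT _ _ h).trans ih

omit [Fintype V] in
lemma reachable_comap_iff (hT : ∀ v w, G.Adj v w → T v = T w) {b : Bool} {v w : {v // T v = b}} :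
    (G.comap Subtype.val).Reachable v w ↔ G.Reachable v.1 w.1 := by
  refine ⟨fun h => h.map (SimpleGraph.Hom.comap Subtype.val G), fun h => ?_⟩
  obtain ⟨v, hv⟩ := v
  obtain ⟨w, hw⟩ := w
  obtain ⟨p⟩ := h
  simp only at p
  induction p with
  | nil => exact SimpleGraph.Reachable.refl _
  | @cons v u w h p ih =>
    have hu : T u = b := (hT _ _ h).symm.trans hv
    refine SimpleGraph.Reachable.trans (SimpleGraph.Adj.reachable ?_) (ih hu hw)
    exact h

omit [Fintype V] in
lemma compSize_comap (hT : ∀ v w, G.Adj v w → T v = T w) {b : Bool} (v : {v // T v = b}) :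
    compSize (G.comap Subtype.val) v = compSize G v.1 := by
  unfold compSize
  rw [← Set.ncard_image_of_injective _ Subtype.val_injective]
  congr 1
  ext w
  simp only [Set.mem_image, mem_supp_mk]
  constructor
  · rintro ⟨w, hw, rfl⟩
    exact (reachable_comap_iff hT).1 hw
  · intro hw
    have hb : T w = b := (eq_of_reachable hT hw).symm.trans v.2
    exact ⟨⟨w, hb⟩, (reachable_comap_iff hT).2 hw, rfl⟩

/-- If no edge joins the two groups, and in each group `b` there is a cluster of about `x b`
vertices while hardly more vertices are in large clusters, then the sizes of the three largest
clusters are about `max`, `min` and `0`. -/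
theorem clusterSize_of_two_groups (hT : ∀ v w, G.Adj v w → T v = T w) (he : 0 < e)
    (hx : ∀ b, 0 ≤ x b)
    (hup : ∀ b, ((largeSet (G.comap (Subtype.val : {v // T v = b} → V)) e).card : ℝ) ≤ x b + e)
    (hlow : ∀ b, x b - e ≤ 0 ∨ ∃ v : {v // T v = b}, x b - e ≤ compSize (G.comap Subtype.val) v) :
    |(clusterSize G 1 : ℝ) - max (x true) (x false)| ≤ 3 * e ∧
      |(clusterSize G 2 : ℝ) - min (x true) (x false)| ≤ 3 * e ∧
      (clusterSize G 3 : ℝ) ≤ 3 * e := by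
  classical
  have hsize : ∀ v, (compSize G v : ℝ) ≤ x (T v) + e := fun v => by
    rw [← compSize_comap hT (b := T v) ⟨v, rfl⟩]
    exact compSize_le_of_card_largeSet_le (hx _) (hup _) _
  have huniq : ∀ u v, T u = T v → 3 * e < compSize G u → 3 * e < compSize G v →
      G.Reachable u v := by
    intro u v huv hu hv
    rw [← compSize_comap hT (b := T v) ⟨u, huv⟩] at hu
    rw [← compSize_comap hT (b := T v) ⟨v, rfl⟩] at hv
    exact (reachable_comap_iff hT).1 (reachable_of_card_largeSet_le he (hup _) (hlow _) hu hv)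
  have hgiant : ∀ b, x b - e ≤ 0 ∨ ∃ v, T v = b ∧ x b - e ≤ compSize G v := fun b => by
    refine (hlow b).imp_right ?_
    rintro ⟨v, hv⟩
    rw [compSize_comap hT] at hv
    exact ⟨v.1, v.2, hv⟩
  have hmin0 : 0 ≤ min (x true) (x false) := le_min (hx _) (hx _)
  have hmax0 : 0 ≤ max (x true) (x false) := (hx true).trans (le_max_left _ _)
  refine ⟨abs_le.2 ⟨?_, ?_⟩, abs_le.2 ⟨?_, ?_⟩, ?_⟩
  · obtain ⟨b, hb⟩ : ∃ b, max (x true) (x false) = x b := by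
      rcases max_choice (x true) (x false) with h | h
      · exact ⟨_, h⟩
      · exact ⟨_, h⟩
    have h0 : (0 : ℝ) ≤ clusterSize G 1 := Nat.cast_nonneg _
    rcases hgiant b with h | ⟨v, -, hv⟩
    · linarith
    · have : (compSize G v : ℝ) ≤ clusterSize G 1 := Nat.cast_le.2 (compSize_le_clusterSize_one v)
      linarith
  · rcases Nat.eq_zero_or_pos (clusterSize G 1) with h0 | h0
    · rw [h0, Nat.cast_zero]
      linarith
    obtain ⟨S, hS, hS1, -⟩ := (le_clusterSize_iff (G := G) one_pos h0).1 le_rfl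
    obtain ⟨u, rfl⟩ := Finset.card_eq_one.1 hS
    have hu : (clusterSize G 1 : ℝ) ≤ compSize G u := Nat.cast_le.2 (hS1 u (by simp))
    have hxm : x (T u) ≤ max (x true) (x false) := by
      cases T u
      · exact le_max_right _ _
      · exact le_max_left _ _
    linarith [hsize u]
  · have h0 : (0 : ℝ) ≤ clusterSize G 2 := Nat.cast_nonneg _
    by_cases hm : min (x true) (x false) ≤ e
    · linarith
    push Not at hm
    have hm' := lt_min_iff.1 hm
    obtain ⟨u, hu, hu'⟩ := (hgiant true).resolve_left (by linarith)
    obtain ⟨v, hv, hv'⟩ := (hgiant false).resolve_left (by linarith)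
    have hnr : ¬G.Reachable u v := fun h => by
      have := eq_of_reachable hT h
      simp [hu, hv] at this
    have hne : u ≠ v := by
      rintro rfl
      exact hnr (SimpleGraph.Reachable.refl _)
    have hpu : (0 : ℝ) < compSize G u := by linarith
    have hpv : (0 : ℝ) < compSize G v := by linarith
    have h2 : min (compSize G u) (compSize G v) ≤ clusterSize G 2 := by
      refine (le_clusterSize_iff two_pos (lt_min (by exact_mod_cast hpu)
        (by exact_mod_cast hpv))).2 ⟨{u, v}, Finset.card_pair hne, ?_, ?_⟩
      · simp
      · have hnr' : ¬G.Reachable v u := fun h => hnr h.symm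
        simp [hnr, hnr']
    have h3 : min (compSize G u : ℝ) (compSize G v) ≤ clusterSize G 2 := by exact_mod_cast h2
    have h4 : min (x true) (x false) - e ≤ min (compSize G u : ℝ) (compSize G v) :=
      le_min (by linarith [min_le_left (x true) (x false)])
        (by linarith [min_le_right (x true) (x false)])
    linarith
  · by_contra! hlt
    have h0 : 0 < clusterSize G 2 := by
      by_contra h0
      have h0' : clusterSize G 2 = 0 := by omega
      rw [h0', Nat.cast_zero] at hlt
      linarith
    obtain ⟨S, hS, hS1, hS2⟩ := (le_clusterSize_iff (G := G) two_pos h0).1 le_rfl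
    obtain ⟨u, v, huv, rfl⟩ := Finset.card_eq_two.1 hS
    have hu : (clusterSize G 2 : ℝ) ≤ compSize G u := Nat.cast_le.2 (hS1 u (by simp))
    have hv : (clusterSize G 2 : ℝ) ≤ compSize G v := Nat.cast_le.2 (hS1 v (by simp))
    by_cases hTuv : T u = T v
    · exact huv (hS2 u (by simp) v (by simp) (huniq u v hTuv (by linarith) (by linarith)))
    · have hu2 := hsize u
      have hv2 := hsize v
      have h5 : min (x true) (x false) = min (x (T u)) (x (T v)) := by
        cases hTu : T u <;> cases hTv : T v <;> simp_all [min_comm]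
      have h6 : (clusterSize G 2 : ℝ) - e ≤ min (x (T u)) (x (T v)) :=
        le_min (by linarith) (by linarith)
      linarith
  · by_contra! hlt
    have h0 : 0 < clusterSize G 3 := by
      by_contra h0
      have h0' : clusterSize G 3 = 0 := by omega
      rw [h0', Nat.cast_zero] at hlt
      linarith
    obtain ⟨S, hS, hS1, hS2⟩ := (le_clusterSize_iff (G := G) three_pos h0).1 le_rfl
    obtain ⟨u, hu, v, hv, huv, hTuv⟩ := Finset.exists_ne_map_eq_of_card_lt_of_maps_to
      (s := S) (t := Finset.univ) (f := T) (by simp [hS]) fun _ _ => Finset.mem_coe.2 (Finset.mem_univ _)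
    have hu' : (clusterSize G 3 : ℝ) ≤ compSize G u := Nat.cast_le.2 (hS1 u hu)
    have hv' : (clusterSize G 3 : ℝ) ≤ compSize G v := Nat.cast_le.2 (hS1 v hv)
    exact huv (hS2 u hu v hv (huniq u v hTuv (by linarith) (by linarith)))

end TwoGroups

/-! ### Product measures -/

section Product

variable {ι : Type*} [Fintype ι] [DecidableEq ι]

/-- Independent events are independent open edges. -/
lemma pi_eq_bprob {X : ι → Type*} [∀ i, MeasurableSpace (X i)] (μ : ∀ i, Measure (X i))
    [∀ i, IsProbabilityMeasure (μ i)] {S : ∀ i, Set (X i)} (hS : ∀ i, MeasurableSet (S i))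
    [∀ i x, Decidable (x ∈ S i)] (A : (ι → Bool) → Prop) :
    Measure.pi μ {x | A fun i => decide (x i ∈ S i)} =
      ENNReal.ofReal (bprob (fun i => (μ i).real (S i)) A) := by
  classical
  have hcell : ∀ η : ι → Bool, Measure.pi μ
      (Set.univ.pi fun i => if η i then S i else (S i)ᶜ) =
      ENNReal.ofReal (∏ i, if η i then (μ i).real (S i) else 1 - (μ i).real (S i)) := by
    intro η
    rw [Measure.pi_pi, ENNReal.ofReal_prod_of_nonneg]
    · refine Finset.prod_congr rfl fun i _ => ?_
      split_ifs
      · rw [ofReal_measureReal]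
      · rw [← probReal_compl_eq_one_sub (hS i), ofReal_measureReal]
    · intro i _
      split_ifs
      · exact measureReal_nonneg
      · rw [sub_nonneg]
        exact measureReal_le_one
  have hset : {x : ∀ i, X i | A fun i => decide (x i ∈ S i)} =
      ⋃ η ∈ Finset.univ.filter A, Set.univ.pi fun i => if η i then S i else (S i)ᶜ := by
    ext x
    simp only [Set.mem_iUnion, Finset.mem_filter, Finset.mem_univ, true_and, Set.mem_pi,
      Set.mem_univ, true_implies, exists_prop]
    constructor
    · intro h
      refine ⟨_, h, fun i => ?_⟩
      by_cases hi : x i ∈ S i <;> simp [hi]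
    · rintro ⟨η, hη, h⟩
      have : (fun i => decide (x i ∈ S i)) = η := by
        funext i
        have := h i
        cases hi : η i <;> simp_all
      change A _
      rwa [this]
  rw [hset, measure_biUnion_finset, bprob, bexp, ENNReal.ofReal_sum_of_nonneg, Finset.sum_filter]
  · refine Finset.sum_congr rfl fun η _ => ?_
    split_ifs
    · rw [hcell, mul_one]
    · simp
  · intro η _
    refine mul_nonneg (Finset.prod_nonneg fun i _ => ?_) (by split_ifs <;> simp)
    split_ifs
    · exact measureReal_nonneg
    · rw [sub_nonneg]
      exact measureReal_le_one
  · intro η _ η' _ hne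
    obtain ⟨i, hi⟩ := Function.ne_iff.1 hne
    refine Set.disjoint_left.2 fun x hx hx' => ?_
    have h1 := hx i trivial
    have h2 := hx' i trivial
    cases h : η i <;> cases h' : η' i <;> simp_all
  · intro η _
    refine MeasurableSet.univ_pi fun i => ?_
    split_ifs
    · exact hS i
    · exact (hS i).compl

variable {X : Type*} [MeasurableSpace X] (ρ : Measure X) [IsProbabilityMeasure ρ]

/-- Replacing one coordinate by an independent copy preserves a product measure. -/
lemma measurePreserving_update (e : ι) :
    MeasurePreserving (fun z : (ι → X) × X => Function.update z.1 e z.2)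
      ((Measure.pi fun _ => ρ).prod ρ) (Measure.pi fun _ => ρ) := by
  have hm : Measurable fun z : (ι → X) × X => Function.update z.1 e z.2 := by
    refine measurable_pi_iff.2 fun i => ?_
    by_cases hi : i = e
    · subst hi
      simpa using measurable_snd
    · simpa [Function.update_of_ne hi, Function.comp_def] using
        (measurable_pi_apply (X := fun _ : ι => X) i).comp measurable_fst
  refine ⟨hm, (Measure.pi_eq fun s hs => ?_).symm⟩
  rw [Measure.map_apply hm (MeasurableSet.univ_pi hs)]
  have : (fun z : (ι → X) × X => Function.update z.1 e z.2) ⁻¹' Set.univ.pi s =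
      (Set.univ.pi (Function.update s e Set.univ)) ×ˢ s e := by
    ext ⟨K, x⟩
    simp only [Set.mem_preimage, Set.mem_pi, Set.mem_univ, true_implies, Set.mem_prod]
    constructor
    · intro h
      refine ⟨fun i => ?_, by simpa using h e⟩
      by_cases hi : i = e
      · subst hi
        simp
      · simpa [Function.update_of_ne hi] using h i
    · rintro ⟨h, hx⟩ i
      by_cases hi : i = e
      · subst hi
        simpa using hx
      · simpa [Function.update_of_ne hi] using h i
  rw [this, Measure.prod_prod, Measure.pi_pi, ← Finset.mul_prod_erase _ _ (Finset.mem_univ e),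
    ← Finset.mul_prod_erase Finset.univ (fun i => ρ (s i)) (Finset.mem_univ e), Function.update_self,
    measure_univ, one_mul, mul_comm]
  congr 1
  exact Finset.prod_congr rfl fun i hi => by
    rw [Function.update_of_ne (Finset.ne_of_mem_erase hi)]

lemma integral_pi_nonpos (e : ι) {F : (ι → X) → ℝ} (hF : Integrable F (Measure.pi fun _ => ρ))
    (h : ∀ K, ∫ x, F (Function.update K e x) ∂ρ ≤ 0) : ∫ K, F K ∂(Measure.pi fun _ => ρ) ≤ 0 := by
  have hmp := measurePreserving_update (ι := ι) ρ e
  rw [← hmp.map_eq, integral_map hmp.measurable.aemeasurable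
    (by rw [hmp.map_eq]; exact hF.aestronglyMeasurable)]
  have hint := hmp.integrable_comp_of_integrable hF
  rw [Function.comp_def] at hint
  rw [integral_prod _ hint]
  exact integral_nonpos h

end Product

/-! ### The conditional law of the doubly occupied bonds -/

/-- The Gibbs probability of a spin configuration. -/
def gibbsProb {N : ℕ} (β : ℝ) (K : Couplings N) (s : Spins N) : ℝ :=
  boltzmann β K s / partitionFunction β K

/-- The sign of the bond `e` in the spin configuration `s`. -/
def bondSign {N : ℕ} (s : Spins N) (e : Bond N) : ℝ := spin s e.1.1 * spin s e.1.2

/-- The conditional probability, given the spins and the coupling `k`, that the bond `e` is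
FK-occupied in a replica in the configuration `s`. -/
def fkProb {N : ℕ} (β : ℝ) (s : Spins N) (e : Bond N) (k : ℝ) : ℝ :=
  if 0 ≤ k / √N * bondSign s e then 1 - Real.exp (-(2 * β * |k / √N|)) else 0

/-- The conditional probability, given the spins and the coupling `k`, that the bond `e` is
FK-occupied in both replicas. -/
def occProb {N : ℕ} (β : ℝ) (s t : Spins N) (e : Bond N) (k : ℝ) : ℝ :=
  fkProb β s e k * fkProb β t e k

open scoped Classical in
/-- The indicator of the bonds that are FK-occupied in both replicas. -/
def occupied {N : ℕ} (β : ℝ) (ω : Sample N) (e : Bond N) : Bool :=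
  decide (∀ ℓ : Fin 2, FKOccupied β ω ℓ e)

section Law

variable {N : ℕ} {β : ℝ}

lemma fkProb_mem (hβ : 0 < β) (s : Spins N) (e : Bond N) (k : ℝ) :
    fkProb β s e k ∈ Set.Icc (0 : ℝ) 1 := by
  unfold fkProb
  split_ifs
  · have h1 : Real.exp (-(2 * β * |k / √N|)) ≤ 1 := Real.exp_le_one_iff.2 (by
      have : 0 ≤ 2 * β * |k / √N| := by positivity
      linarith)
    have h2 := Real.exp_pos (-(2 * β * |k / √N|))
    constructor <;> linarith
  · simp

lemma occProb_mem (hβ : 0 < β) (s t : Spins N) (e : Bond N) (k : ℝ) :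
    occProb β s t e k ∈ Set.Icc (0 : ℝ) 1 :=
  ⟨mul_nonneg (fkProb_mem hβ s e k).1 (fkProb_mem hβ t e k).1,
    mul_le_one₀ (fkProb_mem hβ s e k).2 (fkProb_mem hβ t e k).1 (fkProb_mem hβ t e k).2⟩

lemma measurable_occProb (s t : Spins N) (e : Bond N) : Measurable (occProb β s t e) := by
  have h : ∀ s : Spins N, Measurable (fkProb β s e) := fun s => by
    unfold fkProb
    refine Measurable.ite (measurableSet_le measurable_const (by fun_prop)) ?_ measurable_const
    fun_prop
  exact (h s).mul (h t)

lemma gibbsProb_nonneg (K : Couplings N) (s : Spins N) : 0 ≤ gibbsProb β K s :=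
  div_nonneg (Real.exp_pos _).le (partitionFunction_pos β K).le

lemma sum_gibbsProb (K : Couplings N) : ∑ s, gibbsProb β K s = 1 := by
  unfold gibbsProb
  rw [← Finset.sum_div]
  exact div_self (partitionFunction_pos β K).ne'

lemma gibbsProb_le_one (K : Couplings N) (s : Spins N) : gibbsProb β K s ≤ 1 := by
  rw [← sum_gibbsProb K]
  exact Finset.single_le_sum (fun s _ => gibbsProb_nonneg K s) (Finset.mem_univ s)

lemma measurable_gibbsProb (s : Spins N) : Measurable fun K : Couplings N => gibbsProb β K s :=
  (measurable_boltzmann β s).div (Finset.measurable_fun_sum _ fun s _ => measurable_boltzmann β s)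

lemma measurable_bexp {E Ω : Type*} [Fintype E] [DecidableEq E] [MeasurableSpace Ω] {p : Ω → E → ℝ}
    (hp : ∀ e, Measurable fun ω => p ω e) (f : (E → Bool) → ℝ) :
    Measurable fun ω => bexp (p ω) f := by
  unfold bexp
  refine Finset.measurable_fun_sum _ fun η _ => Measurable.mul_const ?_ _
  refine Finset.measurable_fun_prod _ fun e _ => ?_
  split_ifs
  · exact hp e
  · exact measurable_const.sub (hp e)

lemma gibbs_singleton (K : Couplings N) (s : Spins N) :
    gibbs N β K {s} = ENNReal.ofReal (gibbsProb β K s) := by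
  change (∑ t : Spins N, ENNReal.ofReal (boltzmann β K t / partitionFunction β K) •
    Measure.dirac t) {s} = _
  simp only [Measure.coe_finsetSum, Finset.sum_apply, Measure.smul_apply, smul_eq_mul]
  rw [Finset.sum_eq_single s]
  · simp [gibbsProb]
  · intro t _ hts
    simp [hts]
  · simp

lemma expMeasure_real_Iic {x : ℝ} (hx : 0 ≤ x) :
    (expMeasure 1).real (Set.Iic x) = 1 - Real.exp (-x) := by
  have := isProbabilityMeasure_expMeasure one_pos
  rw [← cdf_eq_real, cdf_expMeasure_eq one_pos, if_pos hx, one_mul]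

/-- Given the couplings and the spins, the bonds are doubly occupied independently of each
other. -/
lemma expMeasure_pi_occupied (hβ : 0 < β) (K : Couplings N) (s t : Spins N)
    (A : (Bond N → Bool) → Prop) :
    (Measure.pi fun _ : Bond N × Fin 2 => expMeasure 1)
        {U | A (occupied β ((K, (s, t)), U))} =
      ENNReal.ofReal (bprob (fun e => occProb β s t e (K e)) A) := by
  classical
  have := isProbabilityMeasure_expMeasure one_pos
  set rep : Fin 2 → Spins N := ![s, t] with hrep
  set S : Bond N × Fin 2 → Set ℝ := fun i =>
    if 0 ≤ K i.1 / √N * bondSign (rep i.2) i.1 then Set.Iic (2 * β * |K i.1 / √N|) else ∅ with hS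
  have hSm : ∀ i, MeasurableSet (S i) := fun i => by
    simp only [hS]
    split_ifs
    · exact measurableSet_Iic
    · exact MeasurableSet.empty
  have hSp : ∀ i, (expMeasure 1).real (S i) = fkProb β (rep i.2) i.1 (K i.1) := fun i => by
    simp only [hS, fkProb]
    split_ifs
    · exact expMeasure_real_Iic (by positivity)
    · simp
  have h := pi_eq_bprob (fun _ : Bond N × Fin 2 => expMeasure 1) hSm
    fun η => A fun e => η (e, 0) && η (e, 1)
  have hocc : ∀ U : Bond N × Fin 2 → ℝ, occupied β ((K, (s, t)), U) =
      fun e => decide (U (e, 0) ∈ S (e, 0)) && decide (U (e, 1) ∈ S (e, 1)) := by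
    intro U
    funext e
    have hl : ∀ ℓ : Fin 2, FKOccupied β ((K, (s, t)), U) ℓ e ↔ U (e, ℓ) ∈ S (e, ℓ) := by
      intro ℓ
      have hr : replica (((K, (s, t)), U) : Sample N) ℓ = rep ℓ := by
        fin_cases ℓ <;> simp [replica, hrep]
      simp only [FKOccupied, hr, hS, coupling, bondSign]
      split_ifs with h0
      · simp [h0]
      · simp [h0]
    simp only [occupied, Fin.forall_fin_two, hl, Bool.decide_and]
  simp only [hocc]
  rw [h]
  congr 1
  simp only [hSp]
  exact bexp_and (fun i => fkProb β (rep i.2) i.1 (K i.1)) fun η => if A η then 1 else 0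

lemma measurable_spin_replica (ℓ : Fin 2) (i : Fin N) :
    Measurable fun ω : Sample N => spin (replica ω ℓ) i := by
  have h : Measurable fun s : Spins N => spin s i := .of_discrete
  unfold replica
  split_ifs
  · exact h.comp (by fun_prop)
  · exact h.comp (by fun_prop)

lemma measurable_occupied : Measurable (occupied β : Sample N → Bond N → Bool) := by
  classical
  refine measurable_pi_iff.2 fun e => ?_
  have hset : MeasurableSet {ω : Sample N | ∀ ℓ : Fin 2, FKOccupied β ω ℓ e} := by
    have : {ω : Sample N | ∀ ℓ : Fin 2, FKOccupied β ω ℓ e} =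
        ⋂ ℓ : Fin 2, {ω : Sample N | FKOccupied β ω ℓ e} := by
      ext ω
      simp
    rw [this]
    refine MeasurableSet.iInter fun ℓ => ?_
    have hs1 := measurable_spin_replica (N := N) ℓ e.1.1
    have hs2 := measurable_spin_replica (N := N) ℓ e.1.2
    have h1 : MeasurableSet {ω : Sample N | 0 ≤ coupling ω.1.1 e *
        (spin (replica ω ℓ) e.1.1 * spin (replica ω ℓ) e.1.2)} := by
      unfold coupling
      exact measurableSet_le measurable_const (Measurable.mul (by fun_prop) (hs1.mul hs2))
    have h2 : MeasurableSet {ω : Sample N | ω.2 (e, ℓ) ≤ 2 * β * |coupling ω.1.1 e|} := by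
      unfold coupling
      exact measurableSet_le (by fun_prop) (by fun_prop)
    exact h1.inter h2
  refine measurable_to_bool ?_
  convert hset using 1
  ext ω
  simp [occupied]

/-- The law of the spins and the doubly occupied bonds, with the auxiliary exponential variables
integrated out. -/
theorem law_eq {ρ : Measure ℝ} [IsProbabilityMeasure ρ] (hβ : 0 < β)
    (B : Spins N → Spins N → (Bond N → Bool) → Prop) :
    law ρ β N {ω | B ω.1.2.1 ω.1.2.2 (occupied β ω)} =
      ENNReal.ofReal (∑ s, ∑ t, ∫ K, gibbsProb β K s * gibbsProb β K t *
        bprob (fun e => occProb β s t e (K e)) (B s t) ∂(Measure.pi fun _ : Bond N => ρ)) := by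
  have := isProbabilityMeasure_expMeasure one_pos
  have hmeas : MeasurableSet {ω : Sample N | B ω.1.2.1 ω.1.2.2 (occupied β ω)} := by
    have h1 : Measurable fun ω : Sample N => (ω.1.2, occupied β ω) :=
      (by fun_prop : Measurable fun ω : Sample N => ω.1.2).prodMk measurable_occupied
    exact h1 (MeasurableSet.of_discrete
      (s := {z : (Spins N × Spins N) × (Bond N → Bool) | B z.1.1 z.1.2 z.2}))
  have hbm : ∀ s t, Measurable fun K : Couplings N =>
      bprob (fun e => occProb β s t e (K e)) (B s t) := fun s t =>
    measurable_bexp (fun e => (measurable_occProb s t e).comp (measurable_pi_apply e)) _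
  have hb0 : ∀ s t (K : Couplings N), bprob (fun e => occProb β s t e (K e)) (B s t) ∈
      Set.Icc (0 : ℝ) 1 := fun s t K =>
    ⟨bexp_nonneg (fun e => occProb_mem hβ s t e _) fun η => by split_ifs <;> simp,
      bprob_le_one (fun e => occProb_mem hβ s t e _) _⟩
  have hF0 : ∀ s t (K : Couplings N), 0 ≤ gibbsProb β K s * gibbsProb β K t *
      bprob (fun e => occProb β s t e (K e)) (B s t) := fun s t K =>
    mul_nonneg (mul_nonneg (gibbsProb_nonneg K s) (gibbsProb_nonneg K t)) (hb0 s t K).1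
  have hFm : ∀ s t, Measurable fun K : Couplings N => gibbsProb β K s * gibbsProb β K t *
      bprob (fun e => occProb β s t e (K e)) (B s t) := fun s t =>
    ((measurable_gibbsProb s).mul (measurable_gibbsProb t)).mul (hbm s t)
  rw [law, Measure.prod_apply hmeas, Measure.lintegral_compProd
    (measurable_measure_prodMk_left hmeas)]
  have hinner : ∀ K : Couplings N, ∫⁻ st, (Measure.pi fun _ : Bond N × Fin 2 => expMeasure 1)
      (Prod.mk (K, st) ⁻¹' {ω : Sample N | B ω.1.2.1 ω.1.2.2 (occupied β ω)})
        ∂((gibbs N β ×ₖ gibbs N β) K) =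
      ∑ s, ∑ t, ENNReal.ofReal (gibbsProb β K s * gibbsProb β K t *
        bprob (fun e => occProb β s t e (K e)) (B s t)) := by
    intro K
    rw [lintegral_fintype, Fintype.sum_prod_type]
    refine Finset.sum_congr rfl fun s _ => Finset.sum_congr rfl fun t _ => ?_
    rw [Kernel.prod_apply, ← Set.singleton_prod_singleton, Measure.prod_prod, gibbs_singleton,
      gibbs_singleton, ENNReal.ofReal_mul (mul_nonneg (gibbsProb_nonneg K s)
        (gibbsProb_nonneg K t)), ENNReal.ofReal_mul (gibbsProb_nonneg K s), mul_comm]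
    congr 1
    exact expMeasure_pi_occupied hβ K s t (B s t)
  simp only [hinner]
  rw [lintegral_finsetSum _ fun s _ => Finset.measurable_fun_sum _ fun t _ => (hFm s t).ennreal_ofReal,
    ENNReal.ofReal_sum_of_nonneg fun s _ => Finset.sum_nonneg fun t _ =>
      integral_nonneg fun K => hF0 s t K]
  refine Finset.sum_congr rfl fun s _ => ?_
  rw [lintegral_finsetSum _ fun t _ => (hFm s t).ennreal_ofReal,
    ENNReal.ofReal_sum_of_nonneg fun t _ => integral_nonneg fun K => hF0 s t K]
  refine Finset.sum_congr rfl fun t _ => ?_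
  rw [ofReal_integral_eq_lintegral_ofReal _ (Filter.Eventually.of_forall fun K => hF0 s t K)]
  refine Integrable.of_bound (hFm s t).aestronglyMeasurable 1 (Filter.Eventually.of_forall fun K => ?_)
  rw [Real.norm_of_nonneg (hF0 s t K)]
  exact mul_le_one₀ (mul_le_one₀ (gibbsProb_le_one K s) (gibbsProb_nonneg K t)
    (gibbsProb_le_one K t)) (hb0 s t K).1 (hb0 s t K).2

end Law

/-! ### The influence of one coupling -/

section OneCoupling

variable {N : ℕ} {β : ℝ}

/-- The exponent `β |x| / √N` that bounds the contribution of one bond to the energy. -/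
def bondEnergy (N : ℕ) (β x : ℝ) : ℝ := β * |x / √N|

lemma bondEnergy_nonneg (hβ : 0 < β) (x : ℝ) : 0 ≤ bondEnergy N β x := by
  unfold bondEnergy
  positivity

lemma bondEnergy_neg (x : ℝ) : bondEnergy N β (-x) = bondEnergy N β x := by
  rw [bondEnergy, neg_div, abs_neg, bondEnergy]

lemma bondSign_eq (s : Spins N) (e : Bond N) : bondSign s e = 1 ∨ bondSign s e = -1 := by
  unfold bondSign spin
  split_ifs <;> simp

lemma boltzmann_update (K : Couplings N) (e : Bond N) (x : ℝ) (s : Spins N) :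
    boltzmann β (Function.update K e x) s =
      boltzmann β (Function.update K e 0) s * Real.exp (β * (x / √N * bondSign s e)) := by
  unfold boltzmann
  rw [← Real.exp_add, ← mul_add]
  congr 2
  rw [← Finset.add_sum_erase _ _ (Finset.mem_univ e),
    ← Finset.add_sum_erase Finset.univ (fun b => coupling (Function.update K e 0) b *
      (spin s b.1.1 * spin s b.1.2)) (Finset.mem_univ e)]
  have h : ∀ b ∈ Finset.univ.erase e, coupling (Function.update K e x) b *
      (spin s b.1.1 * spin s b.1.2) = coupling (Function.update K e 0) b *
      (spin s b.1.1 * spin s b.1.2) := fun b hb => by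
    simp only [coupling, Function.update_of_ne (Finset.ne_of_mem_erase hb)]
  rw [Finset.sum_congr rfl h]
  simp only [coupling, Function.update_self, bondSign]
  ring

lemma abs_mul_bondSign_le (hβ : 0 < β) (x : ℝ) (s : Spins N) (e : Bond N) :
    |β * (x / √N * bondSign s e)| = bondEnergy N β x := by
  have h : |bondSign s e| = 1 := by
    rcases bondSign_eq s e with h | h <;> simp [h]
  rw [abs_mul, abs_mul, h, mul_one, abs_of_pos hβ, bondEnergy]

lemma boltzmann_update_le (hβ : 0 < β) (K : Couplings N) (e : Bond N) (x : ℝ) (s : Spins N) :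
    boltzmann β (Function.update K e x) s ≤
      boltzmann β (Function.update K e 0) s * Real.exp (bondEnergy N β x) := by
  rw [boltzmann_update]
  refine mul_le_mul_of_nonneg_left (Real.exp_le_exp.2 ?_) (Real.exp_pos _).le
  exact (le_abs_self _).trans_eq (abs_mul_bondSign_le hβ x s e)

lemma le_boltzmann_update (hβ : 0 < β) (K : Couplings N) (e : Bond N) (x : ℝ) (s : Spins N) :
    boltzmann β (Function.update K e 0) s * Real.exp (-bondEnergy N β x) ≤
      boltzmann β (Function.update K e x) s := by
  rw [boltzmann_update K e x]
  refine mul_le_mul_of_nonneg_left (Real.exp_le_exp.2 ?_) (Real.exp_pos _).le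
  rw [← abs_mul_bondSign_le hβ x s e]
  exact neg_abs_le _

lemma gibbsProb_update_le (hβ : 0 < β) (K : Couplings N) (e : Bond N) (x : ℝ) (s : Spins N) :
    gibbsProb β (Function.update K e x) s ≤
      gibbsProb β (Function.update K e 0) s * Real.exp (2 * bondEnergy N β x) := by
  have hZ0 := partitionFunction_pos β (Function.update K e 0)
  have hZ : partitionFunction β (Function.update K e 0) * Real.exp (-bondEnergy N β x) ≤
      partitionFunction β (Function.update K e x) := by
    rw [partitionFunction, Finset.sum_mul]
    exact Finset.sum_le_sum fun s _ => le_boltzmann_update hβ K e x s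
  have hb0 : 0 < boltzmann β (Function.update K e 0) s := Real.exp_pos _
  unfold gibbsProb
  calc _ ≤ (boltzmann β (Function.update K e 0) s * Real.exp (bondEnergy N β x)) /
        (partitionFunction β (Function.update K e 0) * Real.exp (-bondEnergy N β x)) :=
        div_le_div₀ (by positivity) (boltzmann_update_le hβ K e x s) (by positivity) hZ
    _ = _ := by
        rw [Real.exp_neg, two_mul, Real.exp_add]
        field_simp

lemma le_gibbsProb_update (hβ : 0 < β) (K : Couplings N) (e : Bond N) (x : ℝ) (s : Spins N) :
    gibbsProb β (Function.update K e 0) s * Real.exp (-(2 * bondEnergy N β x)) ≤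
      gibbsProb β (Function.update K e x) s := by
  have hZ0 := partitionFunction_pos β (Function.update K e 0)
  have hZ1 := partitionFunction_pos β (Function.update K e x)
  have hZ : partitionFunction β (Function.update K e x) ≤
      partitionFunction β (Function.update K e 0) * Real.exp (bondEnergy N β x) := by
    rw [partitionFunction, partitionFunction, Finset.sum_mul]
    exact Finset.sum_le_sum fun s _ => boltzmann_update_le hβ K e x s
  have hb0 : 0 < boltzmann β (Function.update K e 0) s := Real.exp_pos _
  have hb1 : 0 < boltzmann β (Function.update K e x) s := Real.exp_pos _
  unfold gibbsProb
  calc _ = (boltzmann β (Function.update K e 0) s * Real.exp (-bondEnergy N β x)) /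
        (partitionFunction β (Function.update K e 0) * Real.exp (bondEnergy N β x)) := by
        rw [Real.exp_neg, Real.exp_neg, two_mul, Real.exp_add]
        field_simp
    _ ≤ _ := div_le_div₀ hb1.le (le_boltzmann_update hβ K e x s) hZ1 hZ

/-- The Gibbs probability of a pair of spin configurations. -/
def pairProb (β : ℝ) (s t : Spins N) (K : Couplings N) : ℝ := gibbsProb β K s * gibbsProb β K t

lemma pairProb_nonneg (s t : Spins N) (K : Couplings N) : 0 ≤ pairProb β s t K :=
  mul_nonneg (gibbsProb_nonneg K s) (gibbsProb_nonneg K t)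

lemma pairProb_le_one (s t : Spins N) (K : Couplings N) : pairProb β s t K ≤ 1 :=
  mul_le_one₀ (gibbsProb_le_one K s) (gibbsProb_nonneg K t) (gibbsProb_le_one K t)

lemma measurable_pairProb (s t : Spins N) : Measurable (pairProb β s t) :=
  (measurable_gibbsProb s).mul (measurable_gibbsProb t)

/-- Changing one coupling changes the probabilities of the spin configurations only by a factor
close to `1`. -/
lemma pairProb_update_le (hβ : 0 < β) (K : Couplings N) (e : Bond N) (x : ℝ) (s t : Spins N) :
    pairProb β s t (Function.update K e x) ≤
      pairProb β s t (Function.update K e 0) * Real.exp (4 * bondEnergy N β x) := by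
  refine (mul_le_mul (gibbsProb_update_le hβ K e x s) (gibbsProb_update_le hβ K e x t)
    (gibbsProb_nonneg _ _) (mul_nonneg (gibbsProb_nonneg _ _) (Real.exp_pos _).le)).trans_eq ?_
  rw [pairProb, show 4 * bondEnergy N β x = 2 * bondEnergy N β x + 2 * bondEnergy N β x by ring,
    Real.exp_add]
  ring

lemma le_pairProb_update (hβ : 0 < β) (K : Couplings N) (e : Bond N) (x : ℝ) (s t : Spins N) :
    pairProb β s t (Function.update K e 0) * Real.exp (-(4 * bondEnergy N β x)) ≤
      pairProb β s t (Function.update K e x) := by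
  refine le_trans (le_of_eq ?_) (mul_le_mul (le_gibbsProb_update hβ K e x s)
    (le_gibbsProb_update hβ K e x t)
    (mul_nonneg (gibbsProb_nonneg _ _) (Real.exp_pos _).le) (gibbsProb_nonneg _ _))
  rw [pairProb, show -(4 * bondEnergy N β x) =
    -(2 * bondEnergy N β x) + -(2 * bondEnergy N β x) by ring, Real.exp_add]
  ring

/-- The conditional probability of double occupation of a bond with coupling `x`, provided that
the bond is satisfied in both replicas. -/
def doubleProb (N : ℕ) (β x : ℝ) : ℝ := (1 - Real.exp (-(2 * bondEnergy N β x))) ^ 2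

lemma doubleProb_mem (hβ : 0 < β) (x : ℝ) : doubleProb N β x ∈ Set.Icc (0 : ℝ) 1 := by
  have h0 := bondEnergy_nonneg (N := N) hβ x
  have h1 : Real.exp (-(2 * bondEnergy N β x)) ≤ 1 := Real.exp_le_one_iff.2 (by linarith)
  have h2 := Real.exp_pos (-(2 * bondEnergy N β x))
  exact ⟨sq_nonneg _, pow_le_one₀ (by linarith) (by linarith)⟩

lemma doubleProb_le (hβ : 0 < β) (x : ℝ) : doubleProb N β x ≤ (2 * bondEnergy N β x) ^ 2 := by
  have h0 := bondEnergy_nonneg (N := N) hβ x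
  have h1 : Real.exp (-(2 * bondEnergy N β x)) ≤ 1 := Real.exp_le_one_iff.2 (by linarith)
  have h2 := Real.one_sub_le_exp_neg (2 * bondEnergy N β x)
  exact pow_le_pow_left₀ (by linarith) (by linarith) 2

lemma occProb_of_eq {s t : Spins N} {e : Bond N} (h : bondSign s e = bondSign t e) (x : ℝ) :
    occProb β s t e x = if 0 ≤ x / √N * bondSign s e then doubleProb N β x else 0 := by
  unfold occProb fkProb doubleProb bondEnergy
  rw [← h]
  split_ifs
  · ring_nf
  · ring

/-- A bond whose sign differs in the two replicas is satisfied in both of them only if its coupling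
is `0`, and then it is not occupied. -/
lemma occProb_of_ne {s t : Spins N} {e : Bond N} (h : bondSign s e ≠ bondSign t e) (x : ℝ) :
    occProb β s t e x = 0 := by
  have hneg : bondSign t e = -bondSign s e := by
    rcases bondSign_eq s e with h1 | h1 <;> rcases bondSign_eq t e with h2 | h2 <;>
      simp_all
  unfold occProb fkProb
  rw [hneg]
  split_ifs with h1 h2
  · have h0 : x / √N * bondSign s e = 0 := by linarith
    have hx : x / √N = 0 := by
      rcases mul_eq_zero.1 h0 with h3 | h3
      · exact h3
      · rcases bondSign_eq s e with h4 | h4 <;> rw [h3] at h4 <;> norm_num at h4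
    simp [hx]
  all_goals simp

end OneCoupling

section Moments

variable {ρ : Measure ℝ} {β : ℝ}

lemma integrable_exp_mul_abs (hρ : IsCouplingLaw ρ) (b : ℝ) :
    Integrable (fun x => Real.exp (b * |x|)) ρ := by
  refine ((hρ.exp_integrable b).add (hρ.exp_integrable (-b))).mono'
    (by fun_prop) (Filter.Eventually.of_forall fun x => ?_)
  rw [Real.norm_of_nonneg (Real.exp_pos _).le]
  have h1 := Real.exp_pos (b * x)
  have h2 := Real.exp_pos (-b * x)
  rcases abs_choice x with h | h <;> rw [h] <;> simp only [Pi.add_apply]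
  · linarith
  · rw [mul_neg, ← neg_mul]
    linarith

lemma integrable_sq_mul_exp_mul_abs (hρ : IsCouplingLaw ρ) (b : ℝ) :
    Integrable (fun x => x ^ 2 * Real.exp (b * |x|)) ρ := by
  refine ((integrable_exp_mul_abs hρ (b + 1)).const_mul 2).mono'
    (by fun_prop) (Filter.Eventually.of_forall fun x => ?_)
  rw [Real.norm_of_nonneg (by positivity)]
  have h1 : x ^ 2 ≤ 2 * Real.exp |x| := by
    have := Real.quadratic_le_exp_of_nonneg (abs_nonneg x)
    rw [sq_abs] at this
    have := abs_nonneg x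
    linarith
  calc x ^ 2 * Real.exp (b * |x|) ≤ 2 * Real.exp |x| * Real.exp (b * |x|) := by gcongr
    _ = 2 * Real.exp ((b + 1) * |x|) := by
      rw [add_mul, one_mul, Real.exp_add]
      ring

/-- Exactly one of the couplings `x` and `-x`, for `x ≠ 0`, satisfies a given bond, so the satisfied
couplings carry half of the integral of an even function. -/
lemma integral_ite_satisfied (hρ : IsCouplingLaw ρ) {N : ℕ} (hN : 0 < N) {h : ℝ → ℝ}
    (hh : Integrable h ρ) (heven : ∀ x, h (-x) = h x) (h0 : h 0 = 0) (s : Spins N) (e : Bond N) :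
    ∫ x, (if 0 ≤ x / √N * bondSign s e then h x else 0) ∂ρ = (∫ x, h x ∂ρ) / 2 := by
  set g : ℝ → ℝ := fun x => if 0 ≤ x / √N * bondSign s e then h x else 0 with hg
  have hmp : MeasurePreserving (fun x : ℝ => -x) ρ ρ := ⟨measurable_neg, hρ.even⟩
  have hset : MeasurableSet {x : ℝ | 0 ≤ x / √N * bondSign s e} :=
    measurableSet_le measurable_const (by fun_prop)
  have hgint : Integrable g ρ := by
    have := hh.indicator hset
    refine this.congr (Filter.Eventually.of_forall fun x => ?_)
    simp [hg, Set.indicator_apply]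
  have hneg : ∫ x, g (-x) ∂ρ = ∫ x, g x ∂ρ := by
    have := hmp.integral_comp (measurableEmbedding_neg) g
    exact this
  have hsum : ∀ x, g x + g (-x) = h x := by
    intro x
    have hsq : 0 < √(N : ℝ) := Real.sqrt_pos.2 (by exact_mod_cast hN)
    have hc : x / √N * bondSign s e = x * (bondSign s e / √N) := by ring
    have hc' : -x / √N * bondSign s e = -(x * (bondSign s e / √N)) := by ring
    have hne : bondSign s e / √N ≠ 0 := by
      refine div_ne_zero ?_ hsq.ne'
      rcases bondSign_eq s e with h1 | h1 <;> rw [h1] <;> norm_num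
    simp only [hg, hc, hc', heven]
    rcases eq_or_ne x 0 with rfl | hx
    · simp [h0]
    · have hxne : x * (bondSign s e / √N) ≠ 0 := mul_ne_zero hx hne
      rcases lt_or_gt_of_ne hxne with h1 | h1
      · rw [if_neg (not_le.2 h1), if_pos (by linarith), zero_add]
      · rw [if_pos h1.le, if_neg (by linarith), add_zero]
  have hgn : Integrable (fun x => g (-x)) ρ := hmp.integrable_comp_of_integrable hgint
  have h2 : ∫ x, h x ∂ρ = ∫ x, g x ∂ρ + ∫ x, g (-x) ∂ρ := by
    rw [← integral_add hgint hgn]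
    exact integral_congr_ae (Filter.Eventually.of_forall fun x => (hsum x).symm)
  rw [h2, hneg]
  ring

/-- An upper bound for the conditional probability that a given bond is doubly occupied, given the
spins and all other bonds. -/
def upProb (ρ : Measure ℝ) (β : ℝ) (N : ℕ) : ℝ :=
  (∫ x, Real.exp (4 * bondEnergy N β x) * doubleProb N β x ∂ρ) / 2 /
    ∫ x, Real.exp (-(4 * bondEnergy N β x)) ∂ρ

/-- A lower bound for the conditional probability that a given bond within one group is doubly
occupied, given the spins and all other bonds. -/
def lowProb (ρ : Measure ℝ) (β : ℝ) (N : ℕ) : ℝ :=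
  (∫ x, Real.exp (-(4 * bondEnergy N β x)) * doubleProb N β x ∂ρ) / 2 /
    ∫ x, Real.exp (4 * bondEnergy N β x) ∂ρ

lemma bondEnergy_eq (N : ℕ) (β x : ℝ) : bondEnergy N β x = β / √N * |x| := by
  rw [bondEnergy, abs_div, abs_of_nonneg (Real.sqrt_nonneg _)]
  ring

lemma measurable_bondEnergy (N : ℕ) (β : ℝ) : Measurable (bondEnergy N β) := by
  unfold bondEnergy
  fun_prop

lemma measurable_doubleProb (N : ℕ) (β : ℝ) : Measurable (doubleProb N β) := by
  have := measurable_bondEnergy N β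
  unfold doubleProb
  fun_prop

lemma integrable_exp_bondEnergy (hρ : IsCouplingLaw ρ) (N : ℕ) (b : ℝ) :
    Integrable (fun x => Real.exp (b * bondEnergy N β x)) ρ := by
  refine (integrable_exp_mul_abs hρ (b * (β / √N))).congr (Filter.Eventually.of_forall fun x => ?_)
  simp only [bondEnergy_eq]
  ring_nf

lemma integrable_exp_mul_doubleProb (hρ : IsCouplingLaw ρ) (hβ : 0 < β) (N : ℕ) (b : ℝ) :
    Integrable (fun x => Real.exp (b * bondEnergy N β x) * doubleProb N β x) ρ := by
  have := measurable_doubleProb N β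
  have := measurable_bondEnergy N β
  refine (integrable_exp_bondEnergy (β := β) hρ N b).mono' (by fun_prop)
    (Filter.Eventually.of_forall fun x => ?_)
  have h := doubleProb_mem (N := N) hβ x
  rw [Real.norm_of_nonneg (mul_nonneg (Real.exp_pos _).le h.1)]
  exact mul_le_of_le_one_right (Real.exp_pos _).le h.2

lemma integral_exp_bondEnergy_pos (hρ : IsCouplingLaw ρ) (N : ℕ) (b : ℝ) :
    0 < ∫ x, Real.exp (b * bondEnergy N β x) ∂ρ := by
  have := hρ.prob
  exact integral_exp_pos (integrable_exp_bondEnergy hρ N b)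

lemma upProb_nonneg (hβ : 0 < β) (N : ℕ) : 0 ≤ upProb ρ β N := by
  refine div_nonneg (div_nonneg (integral_nonneg fun x => ?_) zero_le_two)
    (integral_nonneg fun x => (Real.exp_pos _).le)
  exact mul_nonneg (Real.exp_pos _).le (doubleProb_mem hβ x).1

lemma lowProb_nonneg (hβ : 0 < β) (N : ℕ) : 0 ≤ lowProb ρ β N := by
  refine div_nonneg (div_nonneg (integral_nonneg fun x => ?_) zero_le_two)
    (integral_nonneg fun x => (Real.exp_pos _).le)
  exact mul_nonneg (Real.exp_pos _).le (doubleProb_mem hβ x).1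

variable {N : ℕ} {s t : Spins N} {e : Bond N}

lemma integrable_pairProb_update [IsProbabilityMeasure ρ] (K : Couplings N) {f : ℝ → ℝ}
    (hf : Measurable f) (hf1 : ∀ x, f x ∈ Set.Icc (0 : ℝ) 1) :
    Integrable (fun x => pairProb β s t (Function.update K e x) * f x) ρ := by
  refine Integrable.of_bound (((measurable_pairProb s t).comp
    (measurable_update K)).mul hf).aestronglyMeasurable 1 (Filter.Eventually.of_forall fun x => ?_)
  rw [Real.norm_of_nonneg (mul_nonneg (pairProb_nonneg _ _ _) (hf1 x).1)]
  exact mul_le_one₀ (pairProb_le_one _ _ _) (hf1 x).1 (hf1 x).2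

/-- Averaging over one coupling, with the Gibbs weights: the conditional probability of double
occupation is at most `upProb`. -/
lemma integral_occProb_le (hρ : IsCouplingLaw ρ) (hβ : 0 < β) (h : bondSign s e = bondSign t e)
    (K : Couplings N) :
    ∫ x, pairProb β s t (Function.update K e x) * occProb β s t e x ∂ρ ≤
      upProb ρ β N * ∫ x, pairProb β s t (Function.update K e x) ∂ρ := by
  have := hρ.prob
  have hN : 0 < N := e.1.1.pos
  set W₀ := pairProb β s t (Function.update K e 0) with hW₀
  have hW₀0 : 0 ≤ W₀ := pairProb_nonneg _ _ _
  have hint := integrable_exp_mul_doubleProb hρ hβ N 4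
  have h1 := integral_ite_satisfied hρ hN hint (fun x => by simp [doubleProb, bondEnergy_neg])
    (by simp [doubleProb, bondEnergy]) s e
  have hset : MeasurableSet {x : ℝ | 0 ≤ x / √N * bondSign s e} :=
    measurableSet_le measurable_const (by fun_prop)
  have hint' : Integrable (fun x => if 0 ≤ x / √N * bondSign s e then
      Real.exp (4 * bondEnergy N β x) * doubleProb N β x else 0) ρ := by
    refine (hint.indicator hset).congr (Filter.Eventually.of_forall fun x => ?_)
    simp [Set.indicator_apply]
  have h2 : ∫ x, pairProb β s t (Function.update K e x) * occProb β s t e x ∂ρ ≤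
      W₀ * ((∫ x, Real.exp (4 * bondEnergy N β x) * doubleProb N β x ∂ρ) / 2) := by
    rw [← h1, ← integral_const_mul]
    refine integral_mono (integrable_pairProb_update K (measurable_occProb s t e)
      (occProb_mem hβ s t e)) (hint'.const_mul _) fun x => ?_
    simp only [occProb_of_eq h]
    split_ifs
    · rw [← mul_assoc]
      exact mul_le_mul_of_nonneg_right (pairProb_update_le hβ K e x s t) (doubleProb_mem hβ x).1
    · simp
  have h3 : W₀ * ∫ x, Real.exp (-(4 * bondEnergy N β x)) ∂ρ ≤
      ∫ x, pairProb β s t (Function.update K e x) ∂ρ := by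
    rw [← integral_const_mul]
    have hi := integrable_exp_bondEnergy (β := β) hρ N (-4)
    simp only [neg_mul] at hi
    refine integral_mono (hi.const_mul _) ?_ fun x => le_pairProb_update hβ K e x s t
    simpa using integrable_pairProb_update (β := β) (s := s) (t := t) (e := e) (ρ := ρ) K
      (f := fun _ => 1) measurable_const (by simp)
  have hpos : 0 < ∫ x, Real.exp (-(4 * bondEnergy N β x)) ∂ρ := by
    have := integral_exp_bondEnergy_pos (β := β) hρ N (-4)
    simpa only [neg_mul] using this
  refine h2.trans (le_trans (le_of_eq ?_) (mul_le_mul_of_nonneg_left h3 (upProb_nonneg hβ N)))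
  rw [upProb]
  field_simp

/-- The bound from below which corresponds to `integral_occProb_le`. -/
lemma le_integral_occProb (hρ : IsCouplingLaw ρ) (hβ : 0 < β) (h : bondSign s e = bondSign t e)
    (K : Couplings N) :
    lowProb ρ β N * ∫ x, pairProb β s t (Function.update K e x) ∂ρ ≤
      ∫ x, pairProb β s t (Function.update K e x) * occProb β s t e x ∂ρ := by
  have := hρ.prob
  have hN : 0 < N := e.1.1.pos
  set W₀ := pairProb β s t (Function.update K e 0) with hW₀
  have hW₀0 : 0 ≤ W₀ := pairProb_nonneg _ _ _
  have hint := integrable_exp_mul_doubleProb hρ hβ N (-4)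
  simp only [neg_mul] at hint
  have h1 := integral_ite_satisfied hρ hN hint (fun x => by simp [doubleProb, bondEnergy_neg])
    (by simp [doubleProb, bondEnergy]) s e
  have hset : MeasurableSet {x : ℝ | 0 ≤ x / √N * bondSign s e} :=
    measurableSet_le measurable_const (by fun_prop)
  have hint' : Integrable (fun x => if 0 ≤ x / √N * bondSign s e then
      Real.exp (-(4 * bondEnergy N β x)) * doubleProb N β x else 0) ρ := by
    refine (hint.indicator hset).congr (Filter.Eventually.of_forall fun x => ?_)
    simp [Set.indicator_apply]
  have h2 : W₀ * ((∫ x, Real.exp (-(4 * bondEnergy N β x)) * doubleProb N β x ∂ρ) / 2) ≤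
      ∫ x, pairProb β s t (Function.update K e x) * occProb β s t e x ∂ρ := by
    rw [← h1, ← integral_const_mul]
    refine integral_mono (hint'.const_mul _) (integrable_pairProb_update K
      (measurable_occProb s t e) (occProb_mem hβ s t e)) fun x => ?_
    simp only [occProb_of_eq h]
    split_ifs
    · rw [← mul_assoc]
      exact mul_le_mul_of_nonneg_right (le_pairProb_update hβ K e x s t) (doubleProb_mem hβ x).1
    · simp
  have h3 : ∫ x, pairProb β s t (Function.update K e x) ∂ρ ≤
      W₀ * ∫ x, Real.exp (4 * bondEnergy N β x) ∂ρ := by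
    rw [← integral_const_mul]
    have hi := integrable_exp_bondEnergy (β := β) hρ N 4
    refine integral_mono ?_ (hi.const_mul _) fun x => pairProb_update_le hβ K e x s t
    simpa using integrable_pairProb_update (β := β) (s := s) (t := t) (e := e) (ρ := ρ) K
      (f := fun _ => 1) measurable_const (by simp)
  have hpos := integral_exp_bondEnergy_pos (β := β) hρ N 4
  refine le_trans (mul_le_mul_of_nonneg_left h3 (lowProb_nonneg hβ N)) (le_trans (le_of_eq ?_) h2)
  rw [lowProb]
  field_simp

lemma tendsto_bondEnergy (β x : ℝ) : Tendsto (fun N : ℕ => bondEnergy N β x) atTop (𝓝 0) := by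
  have h : Tendsto (fun N : ℕ => √(N : ℝ)) atTop atTop :=
    Real.tendsto_sqrt_atTop.comp tendsto_natCast_atTop_atTop
  have h2 := (h.const_div_atTop β).mul_const |x|
  rw [zero_mul] at h2
  exact h2.congr fun N => (bondEnergy_eq N β x).symm

lemma bondEnergy_le (hβ : 0 < β) {N : ℕ} (hN : 0 < N) (x : ℝ) : bondEnergy N β x ≤ β * |x| := by
  rw [bondEnergy_eq]
  have : 1 ≤ √(N : ℝ) := Real.one_le_sqrt.2 (by exact_mod_cast hN)
  gcongr
  exact div_le_self hβ.le this

lemma tendsto_integral_exp_bondEnergy (hρ : IsCouplingLaw ρ) (hβ : 0 < β) (b : ℝ) :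
    Tendsto (fun N : ℕ => ∫ x, Real.exp (b * bondEnergy N β x) ∂ρ) atTop (𝓝 1) := by
  have := hρ.prob
  have h1 : (1 : ℝ) = ∫ _, (1 : ℝ) ∂ρ := by simp
  rw [h1]
  refine tendsto_integral_filter_of_dominated_convergence (fun x => Real.exp (|b| * β * |x|)) ?_ ?_
    (integrable_exp_mul_abs hρ _) (Filter.Eventually.of_forall fun x => ?_)
  · refine Filter.Eventually.of_forall fun N => ?_
    have := measurable_bondEnergy N β
    fun_prop
  · filter_upwards [eventually_gt_atTop 0] with N hN
    refine Filter.Eventually.of_forall fun x => ?_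
    rw [Real.norm_of_nonneg (Real.exp_pos _).le, mul_assoc]
    refine Real.exp_le_exp.2 (mul_le_mul (le_abs_self b) (bondEnergy_le hβ hN x)
      (bondEnergy_nonneg hβ x) (abs_nonneg b))
  · have h2 := ((tendsto_bondEnergy β x).const_mul b)
    rw [mul_zero] at h2
    have h3 := (Real.continuous_exp.tendsto 0).comp h2
    rw [Real.exp_zero] at h3
    exact h3

lemma tendsto_mul_doubleProb (β x : ℝ) :
    Tendsto (fun N : ℕ => N * doubleProb N β x) atTop (𝓝 (4 * β ^ 2 * x ^ 2)) := by
  -- `(1 - exp (-y)) / y → 1` as `y → 0`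
  have hder : HasDerivAt (fun y : ℝ => 1 - Real.exp (-y)) 1 0 := by
    have h := ((hasDerivAt_neg (0 : ℝ)).exp.const_sub 1)
    simpa using h
  by_cases hz : β * |x| = 0
  · have h1 : ∀ N : ℕ, doubleProb N β x = 0 := fun N => by
      have : bondEnergy N β x = 0 := by
        rw [bondEnergy_eq, div_mul_eq_mul_div, hz, zero_div]
      simp [doubleProb, this]
    have h2 : 4 * β ^ 2 * x ^ 2 = 0 := by
      rw [← sq_abs x, mul_assoc, ← mul_pow, hz]
      ring
    simp only [h1, mul_zero, h2]
    exact tendsto_const_nhds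
  have hy : Tendsto (fun N : ℕ => 2 * bondEnergy N β x) atTop (𝓝[≠] 0) := by
    refine tendsto_nhdsWithin_iff.2 ⟨?_, ?_⟩
    · simpa using (tendsto_bondEnergy β x).const_mul 2
    · filter_upwards [eventually_gt_atTop 0] with N hN
      have hsq : 0 < √(N : ℝ) := Real.sqrt_pos.2 (by exact_mod_cast hN)
      rw [Set.mem_compl_singleton_iff, bondEnergy_eq, div_mul_eq_mul_div]
      exact mul_ne_zero two_ne_zero (div_ne_zero hz hsq.ne')
  have h1 := (hasDerivAt_iff_tendsto_slope.1 hder).comp hy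
  have h2 := (h1.pow 2).const_mul (4 * β ^ 2 * x ^ 2)
  rw [one_pow, mul_one] at h2
  refine h2.congr' ?_
  filter_upwards [eventually_gt_atTop 0] with N hN
  have hN0 : (0 : ℝ) < N := by exact_mod_cast hN
  have hsq : 0 < √(N : ℝ) := Real.sqrt_pos.2 hN0
  have hsq2 : √(N : ℝ) ^ 2 = N := Real.sq_sqrt hN0.le
  have hE : bondEnergy N β x ≠ 0 := by
    rw [bondEnergy_eq, div_mul_eq_mul_div]
    exact div_ne_zero hz hsq.ne'
  have h3 : 4 * β ^ 2 * x ^ 2 = N * (2 * bondEnergy N β x) ^ 2 := by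
    rw [bondEnergy_eq, ← sq_abs x, mul_pow, mul_pow, div_pow, hsq2]
    field_simp
    ring
  simp only [Function.comp_apply, slope_def_field, doubleProb, h3]
  simp only [neg_zero, Real.exp_zero, sub_self, sub_zero]
  field_simp

lemma tendsto_integral_exp_mul_doubleProb (hρ : IsCouplingLaw ρ) (hβ : 0 < β) (b : ℝ) :
    Tendsto (fun N : ℕ => N * ∫ x, Real.exp (b * bondEnergy N β x) * doubleProb N β x ∂ρ) atTop
      (𝓝 (4 * β ^ 2)) := by
  have h1 : 4 * β ^ 2 = ∫ x, 4 * β ^ 2 * x ^ 2 ∂ρ := by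
    rw [integral_const_mul, hρ.variance, mul_one]
  rw [h1]
  simp only [← integral_const_mul]
  refine tendsto_integral_filter_of_dominated_convergence
    (fun x => 4 * β ^ 2 * (x ^ 2 * Real.exp (|b| * β * |x|))) ?_ ?_
    ((integrable_sq_mul_exp_mul_abs hρ _).const_mul _) (Filter.Eventually.of_forall fun x => ?_)
  · refine Filter.Eventually.of_forall fun N => ?_
    have := measurable_bondEnergy N β
    have := measurable_doubleProb N β
    fun_prop
  · filter_upwards [eventually_gt_atTop 0] with N hN
    refine Filter.Eventually.of_forall fun x => ?_
    have hN0 : (0 : ℝ) < N := by exact_mod_cast hN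
    have h2 := doubleProb_mem (N := N) hβ x
    have h3 : N * doubleProb N β x ≤ 4 * β ^ 2 * x ^ 2 := by
      calc N * doubleProb N β x ≤ N * (2 * bondEnergy N β x) ^ 2 := by
            gcongr
            exact doubleProb_le hβ x
        _ = 4 * β ^ 2 * x ^ 2 := by
            rw [bondEnergy_eq, ← sq_abs x, mul_pow, mul_pow, div_pow, Real.sq_sqrt hN0.le]
            field_simp
            ring
    have h4 : Real.exp (b * bondEnergy N β x) ≤ Real.exp (|b| * β * |x|) := by
      rw [mul_assoc]
      exact Real.exp_le_exp.2 (mul_le_mul (le_abs_self b) (bondEnergy_le hβ hN x)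
        (bondEnergy_nonneg hβ x) (abs_nonneg b))
    rw [Real.norm_of_nonneg (mul_nonneg hN0.le (mul_nonneg (Real.exp_pos _).le h2.1))]
    calc _ = N * doubleProb N β x * Real.exp (b * bondEnergy N β x) := by ring
      _ ≤ 4 * β ^ 2 * x ^ 2 * Real.exp (|b| * β * |x|) := by
          gcongr
      _ = _ := by ring
  · have h2 := ((tendsto_bondEnergy β x).const_mul b)
    rw [mul_zero] at h2
    have h3 := (Real.continuous_exp.tendsto 0).comp h2
    rw [Real.exp_zero] at h3
    have h4 := h3.mul (tendsto_mul_doubleProb β x)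
    rw [one_mul] at h4
    exact h4.congr fun N => by simp only [Function.comp_apply]; ring

/-- The probability of double occupation is asymptotically `(1 / 2) (2 β |J|) ^ 2` in the mean, where
`J ^ 2` has mean `1 / N`; the factor `1 / 2` is the probability that the bond is satisfied. -/
lemma tendsto_mul_upProb (hρ : IsCouplingLaw ρ) (hβ : 0 < β) :
    Tendsto (fun N : ℕ => N * upProb ρ β N) atTop (𝓝 (2 * β ^ 2)) := by
  have h := ((tendsto_integral_exp_mul_doubleProb hρ hβ 4).div_const 2).div
    (tendsto_integral_exp_bondEnergy hρ hβ (-4)) one_ne_zero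
  rw [show 4 * β ^ 2 / 2 / 1 = 2 * β ^ 2 by ring] at h
  refine h.congr fun N => ?_
  simp only [upProb, neg_mul, Pi.div_apply]
  ring

lemma tendsto_mul_lowProb (hρ : IsCouplingLaw ρ) (hβ : 0 < β) :
    Tendsto (fun N : ℕ => N * lowProb ρ β N) atTop (𝓝 (2 * β ^ 2)) := by
  have h := ((tendsto_integral_exp_mul_doubleProb hρ hβ (-4)).div_const 2).div
    (tendsto_integral_exp_bondEnergy hρ hβ 4) one_ne_zero
  rw [show 4 * β ^ 2 / 2 / 1 = 2 * β ^ 2 by ring] at h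
  refine h.congr fun N => ?_
  simp only [lowProb, neg_mul, Pi.div_apply]
  ring

end Moments

/-! ### Comparison of the doubly occupied bonds with independent edges -/

section Comparison

variable {B E : Type*} [Fintype B] [DecidableEq B] [Fintype E] [DecidableEq E]
  {ρ : Measure ℝ} [IsProbabilityMeasure ρ] {W : (B → ℝ) → ℝ} {o : B → ℝ → ℝ} {p : E → ℝ}

lemma integrable_mul_bexp (hW : Measurable W) (hW1 : ∀ K, W K ∈ Set.Icc (0 : ℝ) 1)
    (ho : ∀ b, Measurable (o b)) (ho1 : ∀ b x, o b x ∈ Set.Icc (0 : ℝ) 1) (h : (B → Bool) → ℝ) :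
    Integrable (fun K => W K * bexp (fun b => o b (K b)) h) (Measure.pi fun _ : B => ρ) := by
  set M : ℝ := ∑ η, |h η| with hM
  have hM0 : ∀ η, |h η| ≤ M := fun η =>
    Finset.single_le_sum (f := fun η => |h η|) (fun _ _ => abs_nonneg _) (Finset.mem_univ η)
  have hb : ∀ K : B → ℝ, |bexp (fun b => o b (K b)) h| ≤ M := fun K => by
    have hp := fun b => ho1 b (K b)
    rw [abs_le]
    constructor
    · rw [← bexp_const (p := fun b => o b (K b)) (-M)]
      exact bexp_mono hp fun η => (neg_le_neg (hM0 η)).trans (neg_abs_le _)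
    · rw [← bexp_const (p := fun b => o b (K b)) M]
      exact bexp_mono hp fun η => (le_abs_self _).trans (hM0 η)
  have hm : Measurable fun K : B → ℝ => bexp (fun b => o b (K b)) h :=
    measurable_bexp (fun b => (ho b).comp (measurable_pi_apply b)) h
  refine Integrable.of_bound (hW.mul hm).aestronglyMeasurable M
    (Filter.Eventually.of_forall fun K => ?_)
  rw [norm_mul, Real.norm_of_nonneg (hW1 K).1]
  exact (mul_le_of_le_one_left (norm_nonneg _) (hW1 K).2).trans (hb K)

variable {r : (B → Bool) → E → Bool} {e : E} {b : B}

omit [Fintype E] in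
/-- Replacing the state of the edge `e` by an independent one changes the conditional expectation
of an observable by the product of a factor which depends only on the coupling of that edge, and of
one which does not depend on it. -/
lemma bexp_comp_sub_bexp_resample (K : B → ℝ) (hr : ∀ κ c, r (Function.update κ b c) =
      Function.update (r κ) e c) (g : (E → Bool) → ℝ) :
    bexp (fun b => o b (K b)) (fun κ => g (r κ)) -
        bexp (fun b => o b (K b)) (fun κ => resample p e g (r κ)) =
      (o b (K b) - p e) * bexp (fun b => o b (K b)) fun κ =>
        g (Function.update (r κ) e true) - g (Function.update (r κ) e false) := by
  rw [← bexp_resample _ b, ← bexp_sub, ← bexp_const_mul]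
  congr 1
  funext κ
  simp only [resample, hr]
  ring

omit [Fintype E] [IsProbabilityMeasure ρ] in
lemma integral_update_comp_sub (K : B → ℝ) (hr : ∀ κ c, r (Function.update κ b c) =
      Function.update (r κ) e c) (g : (E → Bool) → ℝ)
    (h1 : Integrable (fun x => W (Function.update K b x) * o b x) ρ)
    (h2 : Integrable (fun x => W (Function.update K b x)) ρ) :
    ∫ x, (W (Function.update K b x) *
          bexp (fun a => o a (Function.update K b x a)) (fun κ => g (r κ)) -
        W (Function.update K b x) *
          bexp (fun a => o a (Function.update K b x a)) (fun κ => resample p e g (r κ))) ∂ρ =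
      (∫ x, W (Function.update K b x) * o b x ∂ρ - p e * ∫ x, W (Function.update K b x) ∂ρ) *
        bexp (fun b => o b (K b)) fun κ =>
          g (Function.update (r κ) e true) - g (Function.update (r κ) e false) := by
  rw [← integral_const_mul, ← integral_sub h1 (h2.const_mul _), ← integral_mul_const]
  congr 1
  funext x
  have hD : (bexp (fun a => o a (Function.update K b x a)) fun κ =>
      g (Function.update (r κ) e true) - g (Function.update (r κ) e false)) =
      bexp (fun b => o b (K b)) fun κ =>
        g (Function.update (r κ) e true) - g (Function.update (r κ) e false) := by
    refine bexp_congr_of_update (a := b) (fun a ha => ?_) fun κ c => ?_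
    · rw [Function.update_of_ne ha]
    · simp only [hr, Function.update_idem]
  rw [← mul_sub, bexp_comp_sub_bexp_resample _ hr, hD, Function.update_self]
  ring

variable (hW : Measurable W) (hW1 : ∀ K, W K ∈ Set.Icc (0 : ℝ) 1)
  (ho : ∀ b, Measurable (o b)) (ho1 : ∀ b x, o b x ∈ Set.Icc (0 : ℝ) 1)
  (hp : ∀ e, p e ∈ Set.Icc (0 : ℝ) 1)

include hW hW1 ho ho1

omit [Fintype B] in
lemma integrable_update_mul (K : B → ℝ) :
    Integrable (fun x => W (Function.update K b x) * o b x) ρ ∧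
      Integrable (fun x => W (Function.update K b x)) ρ := by
  have hWm : Measurable fun x => W (Function.update K b x) := hW.comp (measurable_update K)
  constructor
  · refine Integrable.of_bound (hWm.mul (ho b)).aestronglyMeasurable 1
      (Filter.Eventually.of_forall fun x => ?_)
    rw [Real.norm_of_nonneg (mul_nonneg (hW1 _).1 (ho1 b x).1)]
    exact mul_le_one₀ (hW1 _).2 (ho1 b x).1 (ho1 b x).2
  · refine Integrable.of_bound hWm.aestronglyMeasurable 1 (Filter.Eventually.of_forall fun x => ?_)
    rw [Real.norm_of_nonneg (hW1 _).1]
    exact (hW1 _).2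

include hp

/-- The weighted law `W` of the bonds is dominated by independent edges if this is so for each edge
conditionally on the other ones. -/
theorem integral_mul_bexp_le {f : (E → Bool) → ℝ} (hf : Monotone f)
    (h : ∀ e, (p e = 0 ∧ ∀ κ, r κ e = false) ∨
      ∃ b, (∀ κ c, r (Function.update κ b c) = Function.update (r κ) e c) ∧
        ∀ K, ∫ x, W (Function.update K b x) * o b x ∂ρ ≤
          p e * ∫ x, W (Function.update K b x) ∂ρ) :
    ∫ K, W K * bexp (fun b => o b (K b)) (fun κ => f (r κ)) ∂(Measure.pi fun _ : B => ρ) ≤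
      (∫ K, W K ∂(Measure.pi fun _ : B => ρ)) * bexp p f := by
  refine le_bexp_of_le_resample (Φ := fun f =>
    ∫ K, W K * bexp (fun b => o b (K b)) (fun κ => f (r κ)) ∂(Measure.pi fun _ : B => ρ)) hp
    (fun c => by simp only [bexp_const, integral_mul_const]) (fun e g hg => ?_) hf
  rcases h e with ⟨hpe, hre⟩ | ⟨b, hr, hb⟩
  · refine le_of_eq ?_
    have : ∀ κ, resample p e g (r κ) = g (r κ) := fun κ => by
      rw [resample, hpe, ← hre κ, Function.update_eq_self]
      ring
    simp only [this]
  · -- integrate first over the coupling of the bond `b`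
    have h1 := integrable_mul_bexp (ρ := ρ) hW hW1 ho ho1 fun κ => g (r κ)
    have h2 := integrable_mul_bexp (ρ := ρ) hW hW1 ho ho1 fun κ => resample p e g (r κ)
    rw [← sub_nonpos, ← integral_sub h1 h2]
    refine integral_pi_nonpos ρ b (h1.sub h2) fun K => ?_
    obtain ⟨h3, h4⟩ := integrable_update_mul (ρ := ρ) (b := b) hW hW1 ho ho1 K
    refine (integral_update_comp_sub K hr g h3 h4).trans_le ?_
    refine mul_nonpos_of_nonpos_of_nonneg (sub_nonpos.2 (hb K))
      (bexp_nonneg (fun b => ho1 b (K b)) fun κ => sub_nonneg.2 (hg ?_))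
    exact update_le_update_iff.2 ⟨Bool.false_le _, fun _ _ => le_rfl⟩

/-- The version of `integral_mul_bexp_le` for bounds from below. -/
theorem le_integral_mul_bexp {f : (E → Bool) → ℝ} (hf : Monotone f)
    (h : ∀ e, (p e = 0 ∧ ∀ κ, r κ e = false) ∨
      ∃ b, (∀ κ c, r (Function.update κ b c) = Function.update (r κ) e c) ∧
        ∀ K, p e * ∫ x, W (Function.update K b x) ∂ρ ≤
          ∫ x, W (Function.update K b x) * o b x ∂ρ) :
    (∫ K, W K ∂(Measure.pi fun _ : B => ρ)) * bexp p f ≤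
      ∫ K, W K * bexp (fun b => o b (K b)) (fun κ => f (r κ)) ∂(Measure.pi fun _ : B => ρ) := by
  refine bexp_le_of_resample_le (Φ := fun f =>
    ∫ K, W K * bexp (fun b => o b (K b)) (fun κ => f (r κ)) ∂(Measure.pi fun _ : B => ρ)) hp
    (fun c => by simp only [bexp_const, integral_mul_const]) (fun e g hg => ?_) hf
  rcases h e with ⟨hpe, hre⟩ | ⟨b, hr, hb⟩
  · refine le_of_eq ?_
    have : ∀ κ, resample p e g (r κ) = g (r κ) := fun κ => by
      rw [resample, hpe, ← hre κ, Function.update_eq_self]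
      ring
    simp only [this]
  · have h1 := integrable_mul_bexp (ρ := ρ) hW hW1 ho ho1 fun κ => g (r κ)
    have h2 := integrable_mul_bexp (ρ := ρ) hW hW1 ho ho1 fun κ => resample p e g (r κ)
    rw [← sub_nonneg, ← integral_sub h1 h2, ← neg_nonpos, ← integral_neg]
    refine integral_pi_nonpos ρ b (h1.sub h2).neg fun K => ?_
    obtain ⟨h3, h4⟩ := integrable_update_mul (ρ := ρ) (b := b) hW hW1 ho ho1 K
    rw [integral_neg, neg_nonpos]
    refine le_of_le_of_eq ?_ (integral_update_comp_sub K hr g h3 h4).symm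
    refine mul_nonneg (sub_nonneg.2 (hb K))
      (bexp_nonneg (fun b => ho1 b (K b)) fun κ => sub_nonneg.2 (hg ?_))
    exact update_le_update_iff.2 ⟨Bool.false_le _, fun _ _ => le_rfl⟩

end Comparison

/-! ### The doubly occupied bonds within one group of sites -/

section Groups

variable {N : ℕ}

/-- The bonds in the configuration `κ`, as a set of edges of the complete graph. -/
def edgeState (κ : Bond N → Bool) (e : Sym2 (Fin N)) : Bool :=
  decide (∃ b : Bond N, s(b.1.1, b.1.2) = e ∧ κ b = true)

lemma edgeState_mk {i j : Fin N} (hij : i < j) (κ : Bond N → Bool) :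
    edgeState κ s(i, j) = κ ⟨(i, j), hij⟩ := by
  rw [Bool.eq_iff_iff, edgeState, decide_eq_true_iff]
  constructor
  · rintro ⟨⟨⟨a, b⟩, hab⟩, h, hκ⟩
    rcases Sym2.eq_iff.1 h with ⟨rfl, rfl⟩ | ⟨rfl, rfl⟩
    · exact hκ
    · exact absurd hab (not_lt.2 hij.le)
  · exact fun h => ⟨_, rfl, h⟩

lemma edgeState_of_isDiag {e : Sym2 (Fin N)} (he : e.IsDiag) (κ : Bond N → Bool) :
    edgeState κ e = false := by
  rw [edgeState, decide_eq_false_iff_not]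
  rintro ⟨b, rfl, -⟩
  exact b.2.ne he

lemma trfkGraph_eq (β : ℝ) (ω : Sample N) : trfkGraph β ω = openGraph (edgeState (occupied β ω)) := by
  classical
  have key : ∀ i j : Fin N, (∃ h : i < j, ∀ ℓ : Fin 2, FKOccupied β ω ℓ ⟨(i, j), h⟩) →
      edgeState (occupied β ω) s(i, j) = true := by
    rintro i j ⟨h, hocc⟩
    rw [edgeState_mk h, occupied, decide_eq_true_iff]
    exact hocc
  ext i j
  rw [trfkGraph, SimpleGraph.fromRel_adj, openGraph_adj, and_comm]
  refine and_congr_left fun hne => ⟨?_, fun h => ?_⟩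
  · rintro (h | h)
    · exact key i j h
    · rw [Sym2.eq_swap]
      exact key j i h
  · rcases lt_or_gt_of_ne hne with hlt | hlt
    · rw [edgeState_mk hlt, occupied, decide_eq_true_iff] at h
      exact Or.inl ⟨hlt, h⟩
    · rw [Sym2.eq_swap, edgeState_mk hlt, occupied, decide_eq_true_iff] at h
      exact Or.inr ⟨hlt, h⟩

/-- The indicator of the sites where the two replicas agree; its two level sets are the two groups of
sites. -/
def agree (s t : Spins N) (i : Fin N) : Bool := s i == t i

/-- The bonds of the configuration `κ` between sites of the group `T = c`. -/
def restrict (T : Fin N → Bool) (c : Bool) (κ : Bond N → Bool) (e : Sym2 {v // T v = c}) : Bool :=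
  edgeState κ (e.map Subtype.val)

lemma openGraph_restrict (T : Fin N → Bool) (c : Bool) (κ : Bond N → Bool) :
    (openGraph (edgeState κ)).comap (Subtype.val : {v // T v = c} → Fin N) =
      openGraph (restrict T c κ) := by
  ext v w
  rw [SimpleGraph.comap_adj, openGraph_adj, openGraph_adj, restrict, Sym2.map_mk, ne_eq, ne_eq,
    Subtype.ext_iff]

lemma restrict_of_isDiag {T : Fin N → Bool} {c : Bool} {e : Sym2 {v // T v = c}} (he : e.IsDiag)
    (κ : Bond N → Bool) : restrict T c κ e = false := by
  refine edgeState_of_isDiag ?_ κ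
  induction e with | _ v w => ?_
  rw [Sym2.mk_isDiag_iff] at he
  rw [Sym2.map_mk, Sym2.mk_isDiag_iff, he]

lemma edgeState_update (κ : Bond N → Bool) (b : Bond N) (x : Bool) :
    edgeState (Function.update κ b x) = Function.update (edgeState κ) s(b.1.1, b.1.2) x := by
  funext e
  induction e with | _ i j => ?_
  wlog hij : i ≤ j generalizing i j
  · rw [Sym2.eq_swap]
    exact this j i (le_of_not_ge hij)
  rcases hij.eq_or_lt with rfl | hlt
  · have hne : s(i, i) ≠ s(b.1.1, b.1.2) := fun h => by
      have h2 : (s(b.1.1, b.1.2)).IsDiag := h ▸ (Sym2.mk_isDiag_iff.2 rfl)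
      exact b.2.ne (Sym2.mk_isDiag_iff.1 h2)
    rw [Function.update_of_ne hne, edgeState_of_isDiag (Sym2.mk_isDiag_iff.2 rfl),
      edgeState_of_isDiag (Sym2.mk_isDiag_iff.2 rfl)]
  · by_cases hb : b = ⟨(i, j), hlt⟩
    · subst hb
      rw [edgeState_mk hlt, Function.update_self, Function.update_self]
    · have hne : s(i, j) ≠ s(b.1.1, b.1.2) := fun h => by
        rcases Sym2.eq_iff.1 h with ⟨h1, h2⟩ | ⟨h1, h2⟩
        · exact hb (Subtype.ext (Prod.ext h1.symm h2.symm))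
        · have := b.2
          rw [← h1, ← h2] at this
          exact absurd this (not_lt.2 hlt.le)
      rw [edgeState_mk hlt, Function.update_of_ne hne, Function.update_of_ne (Ne.symm hb),
        edgeState_mk hlt]

/-- Each edge of a group is a bond whose two ends are in this group; changing the state of this bond
changes the state of the edge, and of no other edge. -/
lemma exists_bond_of_not_isDiag {T : Fin N → Bool} {c : Bool} {e : Sym2 {v // T v = c}}
    (he : ¬ e.IsDiag) : ∃ b : Bond N, T b.1.1 = T b.1.2 ∧
      ∀ κ x, restrict T c (Function.update κ b x) = Function.update (restrict T c κ) e x := by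
  have key : ∃ b : Bond N, T b.1.1 = T b.1.2 ∧ e.map Subtype.val = s(b.1.1, b.1.2) := by
    induction e with | _ v w => ?_
    rw [Sym2.mk_isDiag_iff] at he
    have hne : v.1 ≠ w.1 := fun h => he (Subtype.ext h)
    rcases lt_or_gt_of_ne hne with hlt | hlt
    · exact ⟨⟨(v.1, w.1), hlt⟩, v.2.trans w.2.symm, rfl⟩
    · exact ⟨⟨(w.1, v.1), hlt⟩, w.2.trans v.2.symm, Sym2.eq_swap⟩
  obtain ⟨b, hT, hb⟩ := key
  refine ⟨b, hT, fun κ x => ?_⟩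
  funext e'
  rw [restrict, edgeState_update, ← hb]
  by_cases h : e' = e
  · rw [h, Function.update_self, Function.update_self]
  · rw [Function.update_of_ne h, Function.update_of_ne
      (fun h' => h (Sym2.map.injective Subtype.val_injective h')), restrict]

/-- A bond has the same sign in both replicas if and only if it does not join the two groups. -/
lemma bondSign_eq_iff (s t : Spins N) (b : Bond N) :
    bondSign s b = bondSign t b ↔ agree s t b.1.1 = agree s t b.1.2 := by
  unfold bondSign spin agree
  cases s b.1.1 <;> cases s b.1.2 <;> cases t b.1.1 <;> cases t b.1.2 <;> norm_num

variable {ρ : Measure ℝ} {β : ℝ} {s t : Spins N}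

/-- Given the spins, an increasing event within one group is at most as likely as for the random
graph with edge probability `upProb`. -/
theorem integral_bprob_restrict_le (hρ : IsCouplingLaw ρ) (hβ : 0 < β) (c : Bool)
    (hq : upProb ρ β N ∈ Set.Icc (0 : ℝ) 1) {A : (Sym2 {v // agree s t v = c} → Bool) → Prop}
    (hA : ∀ η ξ, η ≤ ξ → A η → A ξ) :
    ∫ K, pairProb β s t K * bprob (fun b => occProb β s t b (K b))
        (fun κ => A (restrict (agree s t) c κ)) ∂(Measure.pi fun _ : Bond N => ρ) ≤
      (∫ K, pairProb β s t K ∂(Measure.pi fun _ : Bond N => ρ)) *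
        bprob (er (upProb ρ β N)) A := by
  classical
  have := hρ.prob
  refine integral_mul_bexp_le (measurable_pairProb s t)
    (fun K => ⟨pairProb_nonneg s t K, pairProb_le_one s t K⟩) (measurable_occProb s t)
    (occProb_mem hβ s t) (er_mem hq) (monotone_ite hA) fun e => ?_
  by_cases he : e.IsDiag
  · exact Or.inl ⟨if_pos he, restrict_of_isDiag he⟩
  · obtain ⟨b, hT, hb⟩ := exists_bond_of_not_isDiag he
    refine Or.inr ⟨b, hb, fun K => ?_⟩
    rw [er, if_neg he]
    exact integral_occProb_le hρ hβ ((bondSign_eq_iff s t b).2 hT) K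

/-- Given the spins, an increasing event within one group is at least as likely as for the random
graph with edge probability `lowProb`. -/
theorem le_integral_bprob_restrict (hρ : IsCouplingLaw ρ) (hβ : 0 < β) (c : Bool)
    (hq : lowProb ρ β N ∈ Set.Icc (0 : ℝ) 1) {A : (Sym2 {v // agree s t v = c} → Bool) → Prop}
    (hA : ∀ η ξ, η ≤ ξ → A η → A ξ) :
    (∫ K, pairProb β s t K ∂(Measure.pi fun _ : Bond N => ρ)) *
        bprob (er (lowProb ρ β N)) A ≤
      ∫ K, pairProb β s t K * bprob (fun b => occProb β s t b (K b))
        (fun κ => A (restrict (agree s t) c κ)) ∂(Measure.pi fun _ : Bond N => ρ) := by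
  classical
  have := hρ.prob
  refine le_integral_mul_bexp (measurable_pairProb s t)
    (fun K => ⟨pairProb_nonneg s t K, pairProb_le_one s t K⟩) (measurable_occProb s t)
    (occProb_mem hβ s t) (er_mem hq) (monotone_ite hA) fun e => ?_
  by_cases he : e.IsDiag
  · exact Or.inl ⟨if_pos he, restrict_of_isDiag he⟩
  · obtain ⟨b, hT, hb⟩ := exists_bond_of_not_isDiag he
    refine Or.inr ⟨b, hb, fun K => ?_⟩
    rw [er, if_neg he]
    exact le_integral_occProb hρ hβ ((bondSign_eq_iff s t b).2 hT) K

end Groups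

/-! ### Random graphs on a part of the sites -/

section Part

/-- The asymptotic size of the largest cluster among `n` of `N` sites, if the edges have probability
about `c / N`. -/
def giantSize (c : ℝ) (N n : ℕ) : ℝ := survivalLim (c * (n / N)) * n

lemma giantSize_mem {c : ℝ} (hc : 0 ≤ c) (N n : ℕ) : giantSize c N n ∈ Set.Icc (0 : ℝ) n := by
  have h := survivalLim_mem (c := c * (n / N)) (by positivity)
  exact ⟨mul_nonneg h.1 n.cast_nonneg, mul_le_of_le_one_left n.cast_nonneg h.2⟩

lemma giantSize_mono {c : ℝ} (hc : 0 ≤ c) (N : ℕ) : Monotone (giantSize c N) := by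
  intro n m h
  have h' : (n : ℝ) ≤ m := Nat.cast_le.2 h
  have h2 := survivalLim_mem (c := c * (n / N)) (by positivity)
  have h3 := survivalLim_mem (c := c * (m / N)) (by positivity)
  refine mul_le_mul (survivalLim_mono (by positivity) ?_) h' n.cast_nonneg h3.1
  gcongr

/-- If `N q` is close to `c`, then the survival probabilities at `n q` and `c n / N` are close. -/
lemma exists_abs_survivalLim_sub_giantSize_lt {c ε : ℝ} (hc : 0 ≤ c) (hε : 0 < ε) :
    ∃ δ ∈ Set.Ioc (0 : ℝ) 1, ∀ (N n : ℕ) (q : ℝ), 0 < N → n ≤ N → 0 ≤ q → |N * q - c| < δ →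
      n * q ≤ c + 1 ∧ |survivalLim (n * q) - survivalLim (c * (n / N))| < ε := by
  obtain ⟨δ, hδ, h⟩ := exists_survivalLim_near (c + 1) hε
  refine ⟨min δ 1, ⟨lt_min hδ one_pos, min_le_right _ _⟩, fun N n q hN hn hq hNq => ?_⟩
  have hN' : (0 : ℝ) < N := Nat.cast_pos.2 hN
  have hn' : (n : ℝ) ≤ N := Nat.cast_le.2 hn
  have hfrac : (n : ℝ) / N ≤ 1 := (div_le_one hN').2 hn'
  have h1 := (abs_lt.1 (hNq.trans_le (min_le_right _ _))).2
  have h2 : n * q ≤ c + 1 := (mul_le_mul_of_nonneg_right hn' hq).trans (by linarith)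
  have h3 : c * (n / N) ≤ c + 1 := (mul_le_of_le_one_right hc hfrac).trans (by linarith)
  refine ⟨h2, h _ ⟨by positivity, h2⟩ _ ⟨by positivity, h3⟩ ?_⟩
  have h4 : n * q - c * (n / N) = n / N * (N * q - c) := by
    field_simp
  rw [h4, abs_mul, abs_of_nonneg (by positivity)]
  exact (mul_le_of_le_one_left (abs_nonneg _) hfrac).trans_lt (hNq.trans_le (min_le_left _ _))

/-- The upper bound `exists_bprob_largeSet_le` on a part of the sites, with errors relative to the
total number `N` of sites; this covers parts of any size. -/
theorem exists_bprob_largeSet_part_le {c ε : ℝ} (hc : 0 ≤ c) (hε : 0 < ε) :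
    ∃ δ > 0, ∃ N₀ : ℕ, ∀ N ≥ N₀, ∀ (V : Type) [Fintype V] [DecidableEq V] (q : ℝ),
      Fintype.card V ≤ N → q ∈ Set.Icc (0 : ℝ) 1 → |N * q - c| < δ →
      bprob (er q) (fun η : Sym2 V → Bool => giantSize c N (Fintype.card V) + ε * N <
        (largeSet (openGraph η) (ε * N)).card) ≤ ε := by
  obtain ⟨δ, hδ, hnear⟩ := exists_abs_survivalLim_sub_giantSize_lt hc (half_pos hε)
  obtain ⟨n₀, hn₀⟩ := exists_bprob_largeSet_le (c + 1) (half_pos hε)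
  obtain ⟨N₀, hN₀⟩ := exists_nat_gt (n₀ / ε)
  refine ⟨δ, hδ.1, N₀ + 1, fun N hN V _ _ q hV hq hNq => ?_⟩
  have hN1 : (N₀ : ℝ) + 1 ≤ N := by exact_mod_cast hN
  have hV' : (Fintype.card V : ℝ) ≤ N := Nat.cast_le.2 hV
  have hg := giantSize_mem hc N (Fintype.card V)
  rcases lt_or_ge (Fintype.card V) n₀ with hlt | hge
  · -- a small part has no large clusters at all
    refine le_of_eq_of_le ?_ hε.le
    have hno : ∀ η : Sym2 V → Bool, ¬ giantSize c N (Fintype.card V) + ε * N <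
        (largeSet (openGraph η) (ε * N)).card := fun η => by
      have h1 : ((largeSet (openGraph η) (ε * N)).card : ℝ) ≤ Fintype.card V :=
        Nat.cast_le.2 (Finset.card_le_univ _)
      have h2 : (Fintype.card V : ℝ) < n₀ := Nat.cast_lt.2 hlt
      have h3 := (div_lt_iff₀' hε).1 hN₀
      have h4 : ε * N₀ ≤ ε * N := mul_le_mul_of_nonneg_left (by linarith) hε.le
      linarith [hg.1]
    simp [bprob, hno, bexp_const]
  · obtain ⟨h1, h2⟩ := hnear N (Fintype.card V) q (by omega) hV hq.1 hNq
    refine (bprob_mono (er_mem hq) fun η h => ?_).trans ((hn₀ V q hge hq h1).trans (by linarith))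
    have h3 : ε / 2 * Fintype.card V ≤ ε * N := by
      refine mul_le_mul (by linarith) hV' (Nat.cast_nonneg _) hε.le
    have h4 : largeSet (openGraph η) (ε * N) ⊆ largeSet (openGraph η) (ε / 2 * Fintype.card V) :=
      fun v hv => mem_largeSet.2 (h3.trans (mem_largeSet.1 hv))
    have h5 : ((largeSet (openGraph η) (ε * N)).card : ℝ) ≤
        (largeSet (openGraph η) (ε / 2 * Fintype.card V)).card :=
      Nat.cast_le.2 (Finset.card_le_card h4)
    have h6 : (survivalLim (Fintype.card V * q) + ε / 2) * Fintype.card V ≤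
        (survivalLim (c * (Fintype.card V / N)) + ε) * Fintype.card V :=
      mul_le_mul_of_nonneg_right (by linarith [(abs_lt.1 h2).2]) (Nat.cast_nonneg _)
    have h7 : ε * Fintype.card V ≤ ε * N := mul_le_mul_of_nonneg_left hV' hε.le
    rw [giantSize] at h
    linarith

/-- The lower bound `exists_le_bprob_compSize` on a part of the sites, with errors relative to the
total number `N` of sites; this covers parts of any size. -/
theorem exists_le_bprob_compSize_part {c ε : ℝ} (hc : 0 ≤ c) (hε : 0 < ε) :
    ∃ δ > 0, ∃ N₀ : ℕ, ∀ N ≥ N₀, ∀ (V : Type) [Fintype V] [DecidableEq V] (q : ℝ),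
      Fintype.card V ≤ N → q ∈ Set.Icc (0 : ℝ) 1 → |N * q - c| < δ →
      1 - ε ≤ bprob (er q) (fun η : Sym2 V → Bool => giantSize c N (Fintype.card V) - ε * N ≤ 0 ∨
        ∃ v, giantSize c N (Fintype.card V) - ε * N ≤ compSize (openGraph η) v) := by
  obtain ⟨δ, hδ, hnear⟩ := exists_abs_survivalLim_sub_giantSize_lt hc (half_pos hε)
  obtain ⟨n₀, hn₀⟩ := exists_le_bprob_compSize (c + 1) (half_pos hε)
  obtain ⟨N₀, hN₀⟩ := exists_nat_gt (n₀ / ε)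
  refine ⟨δ, hδ.1, N₀ + 1, fun N hN V _ _ q hV hq hNq => ?_⟩
  have hN1 : (N₀ : ℝ) + 1 ≤ N := by exact_mod_cast hN
  have hV' : (Fintype.card V : ℝ) ≤ N := Nat.cast_le.2 hV
  have hg := giantSize_mem hc N (Fintype.card V)
  rcases lt_or_ge (Fintype.card V) n₀ with hlt | hge
  · -- the cluster sought in a small part is not larger than the error
    have h2 : (Fintype.card V : ℝ) < n₀ := Nat.cast_lt.2 hlt
    have h3 := (div_lt_iff₀' hε).1 hN₀
    have h4 : ε * N₀ ≤ ε * N := mul_le_mul_of_nonneg_left (by linarith) hε.le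
    rw [bprob_true fun η => Or.inl (by linarith [hg.2])]
    linarith
  · obtain ⟨h1, h2⟩ := hnear N (Fintype.card V) q (by omega) hV hq.1 hNq
    refine le_trans (by linarith) ((hn₀ V q hge hq h1).trans (bprob_mono (er_mem hq) fun η h => ?_))
    obtain ⟨v, hv⟩ := h
    refine Or.inr ⟨v, le_trans ?_ hv⟩
    have h6 : (survivalLim (c * (Fintype.card V / N)) - ε) * Fintype.card V ≤
        (survivalLim (Fintype.card V * q) - ε / 2) * Fintype.card V :=
      mul_le_mul_of_nonneg_right (by linarith [(abs_lt.1 h2).1]) (Nat.cast_nonneg _)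
    have h7 : ε * Fintype.card V ≤ ε * N := mul_le_mul_of_nonneg_left hV' hε.le
    rw [giantSize]
    linarith

end Part

/-! ### The clusters of the two-replica graph -/

section TwoReplicas

variable {ρ : Measure ℝ} {β : ℝ} {N : ℕ}

/-- The probability that the replicas are in the configurations `s` and `t`, and that `A` holds for
the doubly occupied bonds. -/
def jointProb (ρ : Measure ℝ) (β : ℝ) (s t : Spins N) (A : (Bond N → Bool) → Prop) : ℝ :=
  ∫ K, pairProb β s t K * bprob (fun b => occProb β s t b (K b)) A
    ∂(Measure.pi fun _ : Bond N => ρ)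

/-- The probability that the replicas are in the configurations `s` and `t`. -/
def spinsProb (ρ : Measure ℝ) (β : ℝ) (s t : Spins N) : ℝ :=
  ∫ K, pairProb β s t K ∂(Measure.pi fun _ : Bond N => ρ)

lemma spinsProb_nonneg (s t : Spins N) : 0 ≤ spinsProb ρ β s t :=
  integral_nonneg fun K => pairProb_nonneg s t K

lemma integrable_pairProb [IsProbabilityMeasure ρ] (s t : Spins N) :
    Integrable (pairProb β s t) (Measure.pi fun _ : Bond N => ρ) := by
  refine Integrable.of_bound (measurable_pairProb s t).aestronglyMeasurable 1
    (Filter.Eventually.of_forall fun K => ?_)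
  rw [Real.norm_of_nonneg (pairProb_nonneg s t K)]
  exact pairProb_le_one s t K

lemma sum_spinsProb [IsProbabilityMeasure ρ] : ∑ s : Spins N, ∑ t, spinsProb ρ β s t = 1 := by
  unfold spinsProb
  have h : ∀ s : Spins N, ∑ t, ∫ K, pairProb β s t K ∂(Measure.pi fun _ : Bond N => ρ) =
      ∫ K, ∑ t, pairProb β s t K ∂(Measure.pi fun _ : Bond N => ρ) := fun s =>
    (integral_finsetSum _ fun t _ => integrable_pairProb s t).symm
  simp only [h]
  rw [← integral_finsetSum _ fun s _ => integrable_finsetSum _ fun t _ => integrable_pairProb s t]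
  have h1 : ∀ K : Couplings N, ∑ s, ∑ t, pairProb β s t K = 1 := fun K => by
    simp only [pairProb, ← Finset.mul_sum, sum_gibbsProb, mul_one]
  simp [h1]

variable [IsProbabilityMeasure ρ] (hβ : 0 < β) {s t : Spins N}

include hβ

lemma integrable_pairProb_mul_bprob (A : (Bond N → Bool) → Prop) :
    Integrable (fun K => pairProb β s t K * bprob (fun b => occProb β s t b (K b)) A)
      (Measure.pi fun _ : Bond N => ρ) :=
  integrable_mul_bexp (measurable_pairProb s t)
    (fun K => ⟨pairProb_nonneg s t K, pairProb_le_one s t K⟩) (measurable_occProb s t)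
    (occProb_mem hβ s t) _

lemma jointProb_mono {A A' : (Bond N → Bool) → Prop} (h : ∀ κ, A κ → A' κ) :
    jointProb ρ β s t A ≤ jointProb ρ β s t A' :=
  integral_mono (integrable_pairProb_mul_bprob hβ A) (integrable_pairProb_mul_bprob hβ A') fun K =>
    mul_le_mul_of_nonneg_left (bprob_mono (fun b => occProb_mem hβ s t b _) h)
      (pairProb_nonneg s t K)

lemma jointProb_or_le (A A' : (Bond N → Bool) → Prop) :
    jointProb ρ β s t (fun κ => A κ ∨ A' κ) ≤ jointProb ρ β s t A + jointProb ρ β s t A' := by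
  unfold jointProb
  rw [← integral_add (integrable_pairProb_mul_bprob hβ A) (integrable_pairProb_mul_bprob hβ A')]
  refine integral_mono (integrable_pairProb_mul_bprob hβ _)
    ((integrable_pairProb_mul_bprob hβ A).add (integrable_pairProb_mul_bprob hβ A')) fun K => ?_
  simp only [← mul_add]
  exact mul_le_mul_of_nonneg_left (bprob_or_le (fun b => occProb_mem hβ s t b _) A A')
    (pairProb_nonneg s t K)

lemma jointProb_not (A : (Bond N → Bool) → Prop) :
    jointProb ρ β s t (fun κ => ¬A κ) = spinsProb ρ β s t - jointProb ρ β s t A := by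
  unfold jointProb spinsProb
  rw [← integral_sub (integrable_pairProb s t) (integrable_pairProb_mul_bprob hβ A)]
  simp only [bprob_not, mul_sub, mul_one]

omit [IsProbabilityMeasure ρ] in
/-- No bond between the two groups is doubly occupied. -/
lemma jointProb_cross : jointProb ρ β s t (fun κ => ∃ b ∈ Finset.univ.filter
    (fun b : Bond N => agree s t b.1.1 ≠ agree s t b.1.2), κ b = true) = 0 := by
  unfold jointProb
  have h : ∀ K : Couplings N, bprob (fun b => occProb β s t b (K b)) (fun κ => ∃ b ∈
      Finset.univ.filter (fun b : Bond N => agree s t b.1.1 ≠ agree s t b.1.2), κ b = true) = 0 := by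
    intro K
    have hp : ∀ b : Bond N, occProb β s t b (K b) ∈ Set.Icc (0 : ℝ) 1 :=
      fun b => occProb_mem hβ s t b _
    refine le_antisymm ((bprob_exists_le hp _ _).trans (le_of_eq (Finset.sum_eq_zero fun b hb => ?_)))
      (bexp_nonneg hp fun κ => by split_ifs <;> simp)
    have hne : bondSign s b ≠ bondSign t b := fun h =>
      (Finset.mem_filter.1 hb).2 ((bondSign_eq_iff s t b).1 h)
    rw [bprob, ← bexp_resample _ b]
    have : ∀ κ : Bond N → Bool, resample (fun b => occProb β s t b (K b)) b
        (fun κ => if κ b = true then (1 : ℝ) else 0) κ = 0 := fun κ => by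
      simp [resample, occProb_of_ne hne]
    refine (congrArg _ (funext fun κ => ?_)).trans (bexp_const 0)
    convert this κ
  simp only [h, mul_zero, integral_zero]

/-- There is no bond between the two groups, and the clusters in each group have the sizes of those
of a random graph with edge probability `c / N`, up to `ε N`. -/
def HasTypicalClusters (ε c : ℝ) (s t : Spins N) (κ : Bond N → Bool) : Prop :=
  (¬ ∃ b ∈ Finset.univ.filter
    (fun b : Bond N => agree s t b.1.1 ≠ agree s t b.1.2), κ b = true) ∧
  ∀ x : Bool, ¬ (giantSize c N (Fintype.card {v // agree s t v = x}) + ε * N <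
      (largeSet (openGraph (restrict (agree s t) x κ)) (ε * N)).card) ∧
    (giantSize c N (Fintype.card {v // agree s t v = x}) - ε * N ≤ 0 ∨
      ∃ v, giantSize c N (Fintype.card {v // agree s t v = x}) - ε * N ≤
        compSize (openGraph (restrict (agree s t) x κ)) v)

end TwoReplicas

section Typical

variable {ρ : Measure ℝ} {β : ℝ}

lemma eventually_mem_Icc {q : ℕ → ℝ} {c : ℝ} (hq : ∀ N, 0 ≤ q N)
    (h : Tendsto (fun N : ℕ => N * q N) atTop (𝓝 c)) :
    ∀ᶠ N in atTop, q N ∈ Set.Icc (0 : ℝ) 1 := by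
  obtain ⟨M, hM⟩ := exists_nat_gt (c + 1)
  filter_upwards [h.eventually_lt_const (lt_add_one c), eventually_ge_atTop (M + 1)] with N h1 h2
  have h3 : (M : ℝ) + 1 ≤ N := by exact_mod_cast h2
  have h4 : (0 : ℝ) < N := by linarith [M.cast_nonneg (α := ℝ)]
  refine ⟨hq N, ?_⟩
  by_contra! h5
  have : (N : ℝ) * 1 ≤ N * q N := mul_le_mul_of_nonneg_left h5.le h4.le
  linarith

/-- Uniformly in the spins, the clusters are typical with high conditional probability. -/
lemma eventually_jointProb_not_typical_le (hρ : IsCouplingLaw ρ) (hβ : 0 < β) {ε : ℝ}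
    (hε : 0 < ε) : ∀ᶠ N : ℕ in atTop, ∀ s t : Spins N,
      jointProb ρ β s t (fun κ => ¬ HasTypicalClusters ε (2 * β ^ 2) s t κ) ≤
        spinsProb ρ β s t * (4 * ε) := by
  have := hρ.prob
  have hc : 0 ≤ 2 * β ^ 2 := by positivity
  obtain ⟨δ₁, hδ₁, N₁, h₁⟩ := exists_bprob_largeSet_part_le hc hε
  obtain ⟨δ₂, hδ₂, N₂, h₂⟩ := exists_le_bprob_compSize_part hc hε
  have hup := tendsto_mul_upProb hρ hβ
  have hlow := tendsto_mul_lowProb hρ hβ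
  filter_upwards [eventually_ge_atTop N₁, eventually_ge_atTop N₂,
    eventually_mem_Icc (upProb_nonneg hβ) hup, eventually_mem_Icc (lowProb_nonneg hβ) hlow,
    Metric.tendsto_nhds.1 hup δ₁ hδ₁, Metric.tendsto_nhds.1 hlow δ₂ hδ₂] with N hN₁ hN₂ hq₁ hq₂ hd₁ hd₂
  intro s t
  have hm := spinsProb_nonneg (ρ := ρ) (β := β) s t
  have hcard : ∀ x : Bool, Fintype.card {v // agree s t v = x} ≤ N := fun x =>
    (Fintype.card_subtype_le _).trans_eq (Fintype.card_fin N)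
  have hU : ∀ x : Bool, jointProb ρ β s t (fun κ =>
      giantSize (2 * β ^ 2) N (Fintype.card {v // agree s t v = x}) + ε * N <
        (largeSet (openGraph (restrict (agree s t) x κ)) (ε * N)).card) ≤
      spinsProb ρ β s t * ε := fun x => by
    refine (integral_bprob_restrict_le hρ hβ x hq₁ (A := fun η =>
      giantSize (2 * β ^ 2) N (Fintype.card {v // agree s t v = x}) + ε * N <
        (largeSet (openGraph η) (ε * N)).card) fun η ξ h hη => ?_).trans
      (mul_le_mul_of_nonneg_left (h₁ N hN₁ _ _ (hcard x) hq₁ hd₁) hm)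
    exact hη.trans_le (Nat.cast_le.2 (Finset.card_le_card (largeSet_mono (openGraph_mono h) _)))
  have hL : ∀ x : Bool, jointProb ρ β s t (fun κ =>
      ¬ (giantSize (2 * β ^ 2) N (Fintype.card {v // agree s t v = x}) - ε * N ≤ 0 ∨
        ∃ v, giantSize (2 * β ^ 2) N (Fintype.card {v // agree s t v = x}) - ε * N ≤
          compSize (openGraph (restrict (agree s t) x κ)) v)) ≤
      spinsProb ρ β s t * ε := fun x => by
    rw [jointProb_not hβ]
    have h := le_integral_bprob_restrict (s := s) (t := t) hρ hβ x hq₂ (A := fun η =>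
      giantSize (2 * β ^ 2) N (Fintype.card {v // agree s t v = x}) - ε * N ≤ 0 ∨
        ∃ v, giantSize (2 * β ^ 2) N (Fintype.card {v // agree s t v = x}) - ε * N ≤
          compSize (openGraph η) v) fun η ξ h hη =>
        hη.imp_right fun ⟨v, hv⟩ => ⟨v, hv.trans (Nat.cast_le.2 (compSize_mono (openGraph_mono h) v))⟩
    have h' := mul_le_mul_of_nonneg_left (h₂ N hN₂ _ _ (hcard x) hq₂ hd₂) hm
    have h'' := h'.trans h
    rw [mul_sub, mul_one] at h''
    unfold jointProb at *
    linarith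
  set C : (Bond N → Bool) → Prop := fun κ => ∃ b ∈ Finset.univ.filter
    (fun b : Bond N => agree s t b.1.1 ≠ agree s t b.1.2), κ b = true with hC
  set U : Bool → (Bond N → Bool) → Prop := fun x κ =>
    giantSize (2 * β ^ 2) N (Fintype.card {v // agree s t v = x}) + ε * N <
        (largeSet (openGraph (restrict (agree s t) x κ)) (ε * N)).card with hUdef
  set L : Bool → (Bond N → Bool) → Prop := fun x κ =>
    (giantSize (2 * β ^ 2) N (Fintype.card {v // agree s t v = x}) - ε * N ≤ 0 ∨
        ∃ v, giantSize (2 * β ^ 2) N (Fintype.card {v // agree s t v = x}) - ε * N ≤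
          compSize (openGraph (restrict (agree s t) x κ)) v) with hLdef
  have hC0 : jointProb ρ β s t C = 0 := jointProb_cross hβ
  have hsplit : jointProb ρ β s t (fun κ => ¬ HasTypicalClusters ε (2 * β ^ 2) s t κ) ≤
      jointProb ρ β s t (fun κ => C κ ∨ ((U true κ ∨ U false κ) ∨ (¬ L true κ ∨ ¬ L false κ))) := by
    refine jointProb_mono hβ fun κ h => ?_
    by_contra h'
    push Not at h'
    refine h ⟨h'.1, fun x => ?_⟩
    cases x
    · exact ⟨h'.2.1.2, h'.2.2.2⟩
    · exact ⟨h'.2.1.1, h'.2.2.1⟩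
  have e1 := jointProb_or_le (ρ := ρ) (s := s) (t := t) hβ C
    (fun κ => (U true κ ∨ U false κ) ∨ (¬ L true κ ∨ ¬ L false κ))
  have e2 := jointProb_or_le (ρ := ρ) (s := s) (t := t) hβ (fun κ => U true κ ∨ U false κ)
    (fun κ => ¬ L true κ ∨ ¬ L false κ)
  have e3 := jointProb_or_le (ρ := ρ) (s := s) (t := t) hβ (U true) (U false)
  have e4 := jointProb_or_le (ρ := ρ) (s := s) (t := t) hβ (fun κ => ¬ L true κ)
    (fun κ => ¬ L false κ)
  linarith [hU true, hU false, hL true, hL false]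

theorem eventually_law_not_typical_le (hρ : IsCouplingLaw ρ) (hβ : 0 < β) {ε : ℝ} (hε : 0 < ε) :
    ∀ᶠ N : ℕ in atTop, law ρ β N {ω | ¬ HasTypicalClusters ε (2 * β ^ 2) ω.1.2.1 ω.1.2.2
      (occupied β ω)} ≤ ENNReal.ofReal (4 * ε) := by
  have := hρ.prob
  filter_upwards [eventually_jointProb_not_typical_le hρ hβ hε] with N hN
  rw [law_eq hβ fun s t κ => ¬ HasTypicalClusters ε (2 * β ^ 2) s t κ]
  refine ENNReal.ofReal_le_ofReal ?_
  calc _ ≤ ∑ s : Spins N, ∑ t, spinsProb ρ β s t * (4 * ε) :=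
        Finset.sum_le_sum fun s _ => Finset.sum_le_sum fun t _ => hN s t
    _ = 4 * ε := by
        simp only [← Finset.sum_mul]
        rw [sum_spinsProb, one_mul]

lemma abs_overlap_le_one {N : ℕ} (ω : Sample N) : |overlap ω| ≤ 1 := by
  rcases N.eq_zero_or_pos with rfl | hN
  · simp [overlap]
  have h1 : ∀ i, |spin (replica ω 0) i * spin (replica ω 1) i| ≤ 1 := fun i => by
    unfold spin
    split_ifs <;> norm_num
  have h2 := (Finset.abs_sum_le_sum_abs _ _).trans (Finset.sum_le_sum fun i (_ : i ∈ Finset.univ) =>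
    h1 i)
  rw [Finset.sum_const, Finset.card_univ, Fintype.card_fin, nsmul_eq_mul, mul_one] at h2
  have hN' : (0 : ℝ) < N := Nat.cast_pos.2 hN
  rw [overlap, inv_mul_eq_div, abs_div, abs_of_pos hN']
  exact (div_le_one hN').2 h2

/-- The groups have `N (1 ± Q) / 2` sites, and the larger one has the larger giant cluster. -/
lemma cluster_of_hasTypicalClusters {N : ℕ} (hN : 0 < N) {ε c : ℝ} (hε : 0 < ε) (hc : 0 ≤ c)
    {ω : Sample N} (h : HasTypicalClusters ε c ω.1.2.1 ω.1.2.2 (occupied β ω)) :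
    |trfkDensity β ω 1 - survivalLim (c * ((1 + |overlap ω|) / 2)) * ((1 + |overlap ω|) / 2)| ≤
        3 * ε ∧
      |trfkDensity β ω 2 - survivalLim (c * ((1 - |overlap ω|) / 2)) * ((1 - |overlap ω|) / 2)| ≤
        3 * ε ∧ |trfkDensity β ω 3| ≤ 3 * ε := by
  have hN' : (0 : ℝ) < N := Nat.cast_pos.2 hN
  set s := ω.1.2.1 with hs
  set t := ω.1.2.2 with ht
  set n : Bool → ℕ := fun x => Fintype.card {v // agree s t v = x} with hn
  have hT : ∀ v w, (trfkGraph β ω).Adj v w → agree s t v = agree s t w := by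
    have key : ∀ i j : Fin N, i < j → (trfkGraph β ω).Adj i j → agree s t i = agree s t j := by
      intro i j hij hadj
      rw [trfkGraph_eq, openGraph_adj, edgeState_mk hij] at hadj
      by_contra hne
      exact h.1 ⟨⟨(i, j), hij⟩, Finset.mem_filter.2 ⟨Finset.mem_univ _, hne⟩, hadj.1⟩
    intro v w hvw
    rcases lt_or_gt_of_ne hvw.ne with hlt | hlt
    · exact key v w hlt hvw
    · exact (key w v hlt hvw.symm).symm
  have hcl := clusterSize_of_two_groups (T := agree s t) (x := fun x => giantSize c N (n x))
    (e := ε * N) hT (by positivity) (fun x => (giantSize_mem hc N (n x)).1)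
    (fun x => by
      rw [trfkGraph_eq, openGraph_restrict]
      exact not_lt.1 (h.2 x).1)
    (fun x => by
      rw [trfkGraph_eq, openGraph_restrict]
      exact (h.2 x).2)
  -- the overlap in terms of the numbers of sites in the two groups
  have hsum : n true + n false = N := by
    have h1 := Fintype.card_subtype_compl fun v => agree s t v = true
    have h2 : Fintype.card {v // ¬ agree s t v = true} = n false :=
      Fintype.card_congr (Equiv.subtypeEquivRight fun v => by simp)
    have h3 : n true ≤ N := (Fintype.card_subtype_le _).trans_eq (Fintype.card_fin N)
    rw [h2, Fintype.card_fin] at h1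
    change n false = N - n true at h1
    omega
  have hsumR : (n true : ℝ) + n false = N := by exact_mod_cast hsum
  have hQ : overlap ω = ((n true : ℝ) - n false) / N := by
    have h1 : ∀ i, spin (replica ω 0) i * spin (replica ω 1) i =
        (if agree s t i = true then 1 else 0) - (if agree s t i = false then (1 : ℝ) else 0) := by
      intro i
      have h0 : replica ω 0 = s := rfl
      have h1 : replica ω 1 = t := rfl
      rw [h0, h1]
      unfold spin agree
      cases s i <;> cases t i <;> norm_num
    rw [overlap, inv_mul_eq_div]
    simp only [h1, Finset.sum_sub_distrib, Finset.sum_boole, hn, Fintype.card_subtype]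
  have hmax : (1 + |overlap ω|) / 2 = max (n true : ℝ) (n false) / N := by
    rw [hQ, abs_div, abs_of_pos hN']
    rcases le_total (n true : ℝ) (n false) with hle | hle
    · rw [max_eq_right hle, abs_of_nonpos (sub_nonpos.2 hle)]
      field_simp
      linarith
    · rw [max_eq_left hle, abs_of_nonneg (sub_nonneg.2 hle)]
      field_simp
      linarith
  have hmin : (1 - |overlap ω|) / 2 = min (n true : ℝ) (n false) / N := by
    rw [hQ, abs_div, abs_of_pos hN']
    rcases le_total (n true : ℝ) (n false) with hle | hle
    · rw [min_eq_left hle, abs_of_nonpos (sub_nonpos.2 hle)]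
      field_simp
      linarith
    · rw [min_eq_right hle, abs_of_nonneg (sub_nonneg.2 hle)]
      field_simp
      linarith
  have hgmax : max (giantSize c N (n true)) (giantSize c N (n false)) =
      survivalLim (c * ((1 + |overlap ω|) / 2)) * ((1 + |overlap ω|) / 2) * N := by
    rw [← (giantSize_mono hc N).map_max, hmax, giantSize, Nat.cast_max]
    field_simp
  have hgmin : min (giantSize c N (n true)) (giantSize c N (n false)) =
      survivalLim (c * ((1 - |overlap ω|) / 2)) * ((1 - |overlap ω|) / 2) * N := by
    rw [← (giantSize_mono hc N).map_min, hmin, giantSize, Nat.cast_min]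
    field_simp
  have hdiv : ∀ a b : ℝ, |a - b * N| ≤ 3 * (ε * N) → |a / N - b| ≤ 3 * ε := by
    intro a b hab
    have : a / N - b = (a - b * N) / N := by
      field_simp
    rw [this, abs_div, abs_of_pos hN', div_le_iff₀ hN']
    linarith
  rw [hgmax, hgmin] at hcl
  refine ⟨hdiv _ _ hcl.1, hdiv _ _ hcl.2.1, ?_⟩
  have h3 := hdiv (clusterSize (trfkGraph β ω) 3) 0 (by
    rw [zero_mul, sub_zero, abs_of_nonneg (Nat.cast_nonneg _)]
    exact hcl.2.2)
  rwa [sub_zero] at h3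

end Typical

lemma tendsToZeroInProbability_of_typical {ρ : Measure ℝ} {β : ℝ} (hρ : IsCouplingLaw ρ)
    (hβ : 0 < β) {X : ∀ N, Sample N → ℝ}
    (hX : ∀ N : ℕ, 0 < N → ∀ ε : ℝ, 0 < ε → ∀ ω : Sample N,
      HasTypicalClusters ε (2 * β ^ 2) ω.1.2.1 ω.1.2.2 (occupied β ω) → |X N ω| ≤ 3 * ε) :
    TendsToZeroInProbability (law ρ β) X := by
  intro a ha
  rw [ENNReal.tendsto_nhds_zero]
  intro b hb
  obtain ⟨r, hr0, hrb⟩ : ∃ r : ℝ, 0 < r ∧ ENNReal.ofReal r ≤ b := by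
    obtain ⟨r, -, hr0, hrb⟩ := ENNReal.lt_iff_exists_real_btwn.1 hb
    exact ⟨r, ENNReal.ofReal_pos.1 hr0, hrb.le⟩
  set ε := min (a / 3) (r / 4) with hε
  have hε0 : 0 < ε := lt_min (by linarith) (by linarith)
  filter_upwards [eventually_law_not_typical_le hρ hβ hε0, eventually_gt_atTop 0] with N hN hN0
  refine (measure_mono fun ω hω => ?_).trans (hN.trans ((ENNReal.ofReal_le_ofReal ?_).trans hrb))
  · intro h
    have h1 := hX N hN0 ε hε0 ω h
    have h2 : a < |X N ω| := hω
    have h3 : ε ≤ a / 3 := min_le_left _ _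
    linarith
  · have : ε ≤ r / 4 := min_le_right _ _
    linarith

end

end SKPercolation

theorem theorem2 :
    (∀ c : ℝ, 0 ≤ c → IsGiantDensity c (theta c)) ∧
    ∀ (ρ : Measure ℝ), IsCouplingLaw ρ → ∀ β : ℝ, 0 < β →
      TendsToZeroInProbability (law ρ β) (fun _ ω =>
        trfkDensity β ω 1 -
          theta (2 * β ^ 2 * ((1 + |overlap ω|) / 2)) * ((1 + |overlap ω|) / 2)) ∧
      TendsToZeroInProbability (law ρ β) (fun _ ω =>
        trfkDensity β ω 2 -
          theta (2 * β ^ 2 * ((1 - |overlap ω|) / 2)) * ((1 - |overlap ω|) / 2)) ∧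
      TendsToZeroInProbability (law ρ β) (fun _ ω => trfkDensity β ω 3) := by
  refine ⟨fun c hc => ?_, fun ρ hρ β hβ => ?_⟩
  · rw [theta_eq_survivalLim hc]
    exact isGiantDensity_survivalLim hc
  · have hc : 0 ≤ 2 * β ^ 2 := by positivity
    refine ⟨tendsToZeroInProbability_of_typical hρ hβ fun N hN ε hε ω h => ?_,
      tendsToZeroInProbability_of_typical hρ hβ fun N hN ε hε ω h => ?_,
      tendsToZeroInProbability_of_typical hρ hβ fun N hN ε hε ω h =>
        (cluster_of_hasTypicalClusters hN hε hc h).2.2⟩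
    · rw [theta_eq_survivalLim (by positivity)]
      exact (cluster_of_hasTypicalClusters hN hε hc h).1
    · rw [theta_eq_survivalLim (mul_nonneg hc (by linarith [abs_overlap_le_one ω]))]
      exact (cluster_of_hasTypicalClusters hN hε hc h).2.1
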